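/- Let $D>1$ be a squarefree integer with $D\equiv 1 \pmod 4$ (equivalently: $D>1$ is squarefree and is a discriminant $B^2-4AC$ of integral binary quadratic forms), let $K=\mathbb{Q}(\sqrt D)$, and let $s\in\mathbb{C}$ with $\operatorname{Re} s>1$. All complex powers are principal: $w^s=e^{s\log w}$ with $\operatorname{Arg} w\in(-\pi,\pi]$. *Forms.* For $Q=[A,B,C]$ with $A,B,C\in\mathbb{Z}$ and $B^2-4AC=D$, put $Q(z)=Az^2+Bz+C$, $Q'(z)=2Az+B$ and $\phi(z,Q)=Q(z)/Q'(z)$. For $g=\begin{pmatrix}a&b\\c&d\end{pmatrix}\in SL_2(\mathbb{Z})$ put $(Q|g)(x,y)=Q(ax+by,cx+dy)$ and $gQ=Q|g^{-1}$. With $T=\begin{pmatrix}1&1\\0&1\end{pmatrix}$ and $z$ in the upper half-plane $\mathbb H$ set $$F_Q(s,z)=\sum_{g\in\langle T\rangle\backslash SL_2(\mathbb{Z})}\phi(gz,gQ)^s ,$$ so that there is one term for each coprime pair $(c,d)$, and $(c,d)$, $(-c,-d)$ are both counted. (Summing over $\langle T\rangle\backslash PSL_2(\mathbb{Z})$ instead,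 with one term for each $\pm(c,d)$, gives $\tfrac12F_Q$.) *Periods.* Let $(v,u)$ be the smallest positive integer solution of $v^2-Du^2=4$ and $$\gamma_Q=\tfrac v2 I+\tfrac u2\begin{pmatrix}-B&-2C\\2A&B\end{pmatrix}.$$ For $z_0\in\mathbb H$ consider $$-\sqrt D\int_{z_0}^{\gamma_Qz_0}F_Q(s,z)\,\frac{dz}{Q(z)}. \qquad (*)$$ *Classes.* The narrow class group of $K$ is the group of fractional ideals modulo principal ideals $(\lambda)$ with $N\lambda>0$; each narrow class lies in a wide ideal class. To $Q$ one attaches the narrow class of the ideal $(2A\mathbb{Z}+(-B+\sqrt D)\mathbb{Z})y$, where $y\in K^\times$ is any element with $\operatorname{sign}(Ny)=\operatorname{sign}(A)$. For a wide class $\alpha$ let $\zeta(\alpha,s)=\sum_{\mathfrak a\in\alpha}(N\mathfrak a)^{-s}$, the sum over nonzero integral ideals in $\alpha$, and let $c(s)=\int_{-\infty}^{\infty}(e^t+e^{-t})^{-s}\,dt$. **Theorem.** The series $F_Q(s,z)$ and $\zeta(\alpha,s)$ and the integral $c(s)$ converge absolutely, and $F_Q(s,z)$ is holomorphic in $z\in\mathbb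 H$. The class attached to $Q$ does not depend on $y$, every narrow class $\beta$ is attached to some $Q$ of discriminant $D$, and $(*)$ depends only on $\beta$, not on the choice of $Q$ in $\beta$ or of $z_0$; denote it by $\Phi_\beta(s)$. Every wide class contains one or two narrow classes, and for every wide class $\alpha$ $$\sum_{\beta\in\alpha^{-1}}\Phi_\beta(s)=4\,c(s)\,(i\sqrt D)^s\,\frac{\zeta(\alpha,s)}{\zeta(2s)},$$ the sum being over the narrow classes $\beta$ contained in $\alpha^{-1}$. If $F_Q$ is summed over $\langle T\rangle\backslash PSL_2(\mathbb{Z})$ instead, all of this holds with the constant $4$ replaced by $2$. -/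

import Mathlib

open scoped MatrixGroups NumberField nonZeroDivisors UpperHalfPlane

noncomputable section

namespace HeckePeriod

/-! ### Binary quadratic forms and the action of `SL(2, ℤ)` -/

/-- The integral binary quadratic form `[A, B, C] = A x² + B x y + C y²`. -/
@[ext]
structure QForm where
  A : ℤ
  B : ℤ
  C : ℤ

namespace QForm

/-- The discriminant `B² - 4 A C`. -/
def disc (Q : QForm) : ℤ := Q.B ^ 2 - 4 * Q.A * Q.C

/-- `Q|g (x, y) = Q (a x + b y, c x + d y)`. -/
def slash (Q : QForm) (g : SL(2, ℤ)) : QForm where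
  A := Q.A * g 0 0 ^ 2 + Q.B * g 0 0 * g 1 0 + Q.C * g 1 0 ^ 2
  B := 2 * Q.A * g 0 0 * g 0 1 + Q.B * (g 0 0 * g 1 1 + g 0 1 * g 1 0) + 2 * Q.C * g 1 0 * g 1 1
  C := Q.A * g 0 1 ^ 2 + Q.B * g 0 1 * g 1 1 + Q.C * g 1 1 ^ 2

/-- The left action `g Q = Q|g⁻¹`. -/
def act (g : SL(2, ℤ)) (Q : QForm) : QForm := Q.slash g⁻¹

/-- `Q(z) = A z² + B z + C`. -/
def eval (Q : QForm) (z : ℂ) : ℂ := Q.A * z ^ 2 + Q.B * z + Q.C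

/-- `Q'(z) = 2 A z + B`. -/
def evalDeriv (Q : QForm) (z : ℂ) : ℂ := 2 * Q.A * z + Q.B

/-- The matrix `N_Q = (-B, -2C; 2A, B)`. -/
def N (Q : QForm) : Matrix (Fin 2) (Fin 2) ℝ :=
  !![-(Q.B : ℝ), -2 * (Q.C : ℝ); 2 * (Q.A : ℝ), (Q.B : ℝ)]

end QForm

/-- `φ(z, Q) = Q(z) / Q'(z)`. -/
def phi (z : ℂ) (Q : QForm) : ℂ := Q.eval z / Q.evalDeriv z

/-! ### The holomorphic lift of the Eisenstein series -/

/-- The summand `φ(g z, g Q)^s`, with the principal branch of the power. -/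
def summand (s : ℂ) (Q : QForm) (z : ℍ) (g : SL(2, ℤ)) : ℂ :=
  phi (↑(g • z) : ℂ) (Q.act g) ^ s

/-- The subgroup `⟨T, -1⟩` of `SL(2, ℤ)`, the preimage of `⟨T⟩ ⊆ PSL(2, ℤ)`. -/
def cuspGroup : Subgroup SL(2, ℤ) := Subgroup.closure {ModularGroup.T, -1}

theorem slash_mul (Q : QForm) (g h : SL(2, ℤ)) : Q.slash (g * h) = (Q.slash g).slash h := by
  ext <;> simp [QForm.slash, Matrix.mul_apply, Fin.sum_univ_two] <;> ring

theorem act_mul (Q : QForm) (g h : SL(2, ℤ)) : Q.act (g * h) = (Q.act h).act g := by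
  simp [QForm.act, slash_mul]

theorem summand_T_mul (s : ℂ) (Q : QForm) (z : ℍ) (g : SL(2, ℤ)) :
    summand s Q z (ModularGroup.T * g) = summand s Q z g := by
  have h : (↑((ModularGroup.T * g) • z) : ℂ) = (↑(g • z) : ℂ) + 1 := by
    rw [mul_smul, UpperHalfPlane.modular_T_smul]
    simp [add_comm]
  have h2 : ∀ (P : QForm) (w : ℂ), phi (w + 1) (P.act ModularGroup.T) = phi w P := by
    intro P w
    have hT : P.act ModularGroup.T = ⟨P.A, P.B - 2 * P.A, P.A - P.B + P.C⟩ := by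
      have e00 : (ModularGroup.T⁻¹ : SL(2, ℤ)) 0 0 = 1 := by decide
      have e01 : (ModularGroup.T⁻¹ : SL(2, ℤ)) 0 1 = -1 := by decide
      have e10 : (ModularGroup.T⁻¹ : SL(2, ℤ)) 1 0 = 0 := by decide
      have e11 : (ModularGroup.T⁻¹ : SL(2, ℤ)) 1 1 = 1 := by decide
      ext <;> simp only [QForm.act, QForm.slash, e00, e01, e10, e11] <;> ring
    have e1 : (P.act ModularGroup.T).eval (w + 1) = P.eval w := by
      rw [hT]; simp [QForm.eval]; ring
    have e2 : (P.act ModularGroup.T).evalDeriv (w + 1) = P.evalDeriv w := by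
      rw [hT]; simp [QForm.evalDeriv]; ring
    rw [phi, phi, e1, e2]
  rw [summand, summand, h, act_mul, h2]

theorem summand_neg_mul (s : ℂ) (Q : QForm) (z : ℍ) (g : SL(2, ℤ)) :
    summand s Q z (-1 * g) = summand s Q z g := by
  have h : ((-1 * g) • z) = g • z := by
    rw [neg_one_mul]; exact ModularGroup.SL_neg_smul g z
  have h2 : ∀ P : QForm, P.act (-1) = P := by
    intro P
    have : ((-1 : SL(2, ℤ))⁻¹) = -1 := by decide
    ext <;> simp [QForm.act, QForm.slash, this]
  rw [summand, summand, h, act_mul, h2]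

theorem summand_mul_of_mem (s : ℂ) (Q : QForm) (z : ℍ) {h : SL(2, ℤ)} (hh : h ∈ cuspGroup) :
    ∀ g, summand s Q z (h * g) = summand s Q z g := by
  induction hh using Subgroup.closure_induction with
  | mem x hx =>
    rcases hx with rfl | rfl
    · exact summand_T_mul s Q z
    · exact summand_neg_mul s Q z
  | one => simp
  | mul x y _ _ hx hy => intro g; rw [mul_assoc, hx, hy]
  | inv x _ hx => intro g; rw [← hx, mul_inv_cancel_left]

/-- The summand as a function of the coset `H g ∈ H \ SL(2, ℤ)`, for `H ⊆ ⟨T, -1⟩`. -/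
def cosetSummand (H : Subgroup SL(2, ℤ)) (hH : H ≤ cuspGroup) (s : ℂ) (Q : QForm) (z : ℍ) :
    Quotient (QuotientGroup.rightRel H) → ℂ :=
  Quotient.lift (summand s Q z) (by
    intro a b hab
    have h1 : b * a⁻¹ ∈ H := QuotientGroup.rightRel_apply.mp hab
    have h2 := summand_mul_of_mem s Q z (hH h1) a
    rw [inv_mul_cancel_right] at h2
    exact h2.symm)

/-- `F_Q(s, z) = ∑_{g ∈ H \ SL(2, ℤ)} φ(g z, g Q)^s`. For `H = ⟨T⟩` the sum is over
`⟨T⟩ \ SL(2, ℤ)`, for `H = ⟨T, -1⟩` it is over `⟨T⟩ \ PSL(2, ℤ)`. -/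
def lift (H : Subgroup SL(2, ℤ)) (hH : H ≤ cuspGroup) (s : ℂ) (Q : QForm) (z : ℍ) : ℂ :=
  ∑' c, cosetSummand H hH s Q z c

/-! ### Hyperbolic periods -/

/-- `u` of the smallest positive solution `(v, u)` of `v² - D u² = 4`. -/
def pellU (D : ℕ) : ℕ := sInf {u : ℕ | 0 < u ∧ ∃ v : ℕ, v ^ 2 = D * u ^ 2 + 4}

/-- `v` of the smallest positive solution `(v, u)` of `v² - D u² = 4`. -/
def pellV (D : ℕ) : ℕ := sInf {v : ℕ | v ^ 2 = D * pellU D ^ 2 + 4}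

/-- The set whose infimum defines `pellU` is not empty, so `(pellV D, pellU D)` is a solution. -/
theorem pell_spec {D : ℕ} (hD : ¬ IsSquare D) :
    0 < pellU D ∧ pellV D ^ 2 = D * pellU D ^ 2 + 4 := by
  have hpos : 0 < D := Nat.pos_of_ne_zero (by rintro rfl; exact hD ⟨0, rfl⟩)
  have hne : {u : ℕ | 0 < u ∧ ∃ v : ℕ, v ^ 2 = D * u ^ 2 + 4}.Nonempty := by
    obtain ⟨x, y, hxy, hy⟩ := Pell.exists_of_not_isSquare (d := (D : ℤ)) (by exact_mod_cast hpos)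
      (by
        rintro ⟨r, hr⟩
        refine hD ⟨r.natAbs, ?_⟩
        zify
        rw [hr, abs_mul_abs_self])
    refine ⟨2 * y.natAbs, by have := Int.natAbs_pos.mpr hy; omega, 2 * x.natAbs, ?_⟩
    zify
    rw [mul_pow, mul_pow, sq_abs, sq_abs]
    linarith
  obtain ⟨h1, h2⟩ := Nat.sInf_mem hne
  exact ⟨h1, Nat.sInf_mem (s := {v : ℕ | v ^ 2 = D * pellU D ^ 2 + 4}) h2⟩

/-- The generator `γ_Q = (v/2) I + (u/2) N_Q` of the stabilizer of a form `Q` of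
discriminant `D`. -/
def gammaQ (D : ℕ) (Q : QForm) : Matrix (Fin 2) (Fin 2) ℝ :=
  ((pellV D : ℝ) / 2) • (1 : Matrix (Fin 2) (Fin 2) ℝ) + ((pellU D : ℝ) / 2) • Q.N

/-- The Möbius transformation of a real matrix. -/
def moebius (M : Matrix (Fin 2) (Fin 2) ℝ) (z : ℂ) : ℂ :=
  ((M 0 0 : ℂ) * z + (M 0 1 : ℂ)) / ((M 1 0 : ℂ) * z + (M 1 1 : ℂ))

/-- The integral `∫_z^w f` along the straight segment from `z` to `w`. -/
def segIntegral (f : ℂ → ℂ) (z w : ℂ) : ℂ := ∫ t in (0 : ℝ)..1, f (z + t * (w - z)) * (w - z)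

/-- `-√D ∫_{z₀}^{γ_Q z₀} F_Q(s, z) dz / Q(z)`. -/
def period (H : Subgroup SL(2, ℤ)) (hH : H ≤ cuspGroup) (s : ℂ) (D : ℕ) (Q : QForm) (z₀ : ℍ) : ℂ :=
  -(Real.sqrt D : ℂ) *
    segIntegral (fun z => lift H hH s Q (UpperHalfPlane.ofComplex z) / Q.eval z)
      z₀ (moebius (gammaQ D Q) z₀)

/-! ### Narrow ideal classes -/

section Classes

variable (K : Type*) [Field K] [NumberField K]

/-- The elements of `Kˣ` of positive norm. -/
def posNorm : Subgroup Kˣ where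
  carrier := {y | 0 < Algebra.norm ℚ (y : K)}
  one_mem' := by simp
  mul_mem' := by
    intro a b ha hb
    simpa using mul_pos ha hb
  inv_mem' := by
    intro a ha
    have ha' : 0 < Algebra.norm ℚ (a : K) := ha
    change 0 < Algebra.norm ℚ ((a⁻¹ : Kˣ) : K)
    have h : Algebra.norm ℚ ((a⁻¹ : Kˣ) : K) * Algebra.norm ℚ (a : K) = 1 := by
      rw [← map_mul, Units.inv_mul, map_one]
    exact pos_of_mul_pos_left (h ▸ one_pos) ha'.le

/-- The narrow class group of a quadratic field: fractional ideals modulo the principal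
fractional ideals generated by an element of positive norm. -/
abbrev NarrowClassGroup : Type _ :=
  (FractionalIdeal (𝓞 K)⁰ K)ˣ ⧸ (posNorm K).map (toPrincipalIdeal (𝓞 K) K)

variable {K}

/-- The wide class of a narrow class. -/
def toWide : NarrowClassGroup K →* ClassGroup (𝓞 K) :=
  QuotientGroup.lift _ (ClassGroup.mk (R := 𝓞 K) (K := K)) (by
    rintro _ ⟨y, _, rfl⟩
    rw [MonoidHom.mem_ker, ClassGroup.mk_eq_one_iff, coe_toPrincipalIdeal]
    exact ⟨⟨(y : K), by simp⟩⟩)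

/-- `β` is the class of the ideal `(2 A ℤ + (-B + δ) ℤ) y`, where `δ` is a square root of the
discriminant in `K` and `y` is an element with `sign (N y) = sign A`. -/
def QForm.HasClass (Q : QForm) (δ : K) (β : NarrowClassGroup K) : Prop :=
  ∃ (y : Kˣ) (I : (FractionalIdeal (𝓞 K)⁰ K)ˣ),
    SignType.sign (Algebra.norm ℚ (y : K)) = SignType.sign Q.A ∧
    (∀ x : K, x ∈ (I : FractionalIdeal (𝓞 K)⁰ K) ↔
      ∃ m n : ℤ, x = (2 * (Q.A : K) * m + (-(Q.B : K) + δ) * n) * y) ∧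
    (QuotientGroup.mk I : NarrowClassGroup K) = β

open Classical in
/-- `Φ_β(s)`: the period of a form `Q` of discriminant `D` with class `β`. It is evaluated at one
choice of `Q` and of the base point; independence of both is part of the theorem. -/
def Phi (H : Subgroup SL(2, ℤ)) (hH : H ≤ cuspGroup) (s : ℂ) (D : ℕ) (δ : K)
    (β : NarrowClassGroup K) : ℂ :=
  if h : ∃ Q : QForm, Q.disc = D ∧ Q.HasClass δ β then
    period H hH s D h.choose UpperHalfPlane.I
  else 0

/-- The term `1 / (N 𝔞)^s` of the partial zeta function of the wide class `α`. -/
def zetaTerm (α : ClassGroup (𝓞 K)) (s : ℂ) (a : {a : (Ideal (𝓞 K))⁰ // ClassGroup.mk0 a = α}) :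
    ℂ :=
  1 / (Ideal.absNorm (a.1 : Ideal (𝓞 K)) : ℂ) ^ s

/-- The partial zeta function `ζ(α, s) = ∑_{𝔞 ∈ α} 1 / (N 𝔞)^s` over the nonzero integral
ideals `𝔞` in the wide class `α`. -/
def partialZeta (α : ClassGroup (𝓞 K)) (s : ℂ) : ℂ := ∑' a, zetaTerm α s a

end Classes

/-- The integrand `1 / (e^t + e^{-t})^s`. -/
def cIntegrand (s : ℂ) (t : ℝ) : ℂ := 1 / ((Real.exp t + Real.exp (-t) : ℝ) : ℂ) ^ s

/-- `c(s) = ∫_{-∞}^{∞} dt / (e^t + e^{-t})^s`. -/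
def c (s : ℂ) : ℂ := ∫ t : ℝ, cIntegrand s t

end HeckePeriod

end

/-! The period is computed on the geodesic joining the roots `w'`, `w` of `Q`. In the coordinate `(z
- w) / (z - w') = ± i e^t` one has `√D dz / Q(z) = dt`, and the value of `φ(gz, gQ)` for bottom row
`(c, d)` is `i √D` divided by the positive definite form `|A| ((c w + d)² e^{-t} + (c w' + d)² e^t)`
(`rowPhi_geod`, `hasDerivAt_geod`). The matrix `γ_Q` shifts `t` by `-2 log ε`, where `ε = (v + u √D)
/ 2` (`moebius_geod`). Since `F_Q dz / Q` is holomorphic and invariant under `γ_Q`, the base point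
is immaterial and the path may be taken on the geodesic (`period_eq_primitive`).

Multiplication by `ζ(2s)` extends the sum from coprime pairs to all pairs. A pair `(c, d)` is an
element `x` of the ideal `J = A ℤ + ((-B + δ) / 2) ℤ` of norm `|A|`, and the definite form is `(x²
e^{-t} + x'² e^t) / N J` with `x`, `x'` the two real conjugates (`geodForm_eq_expForm`). The nonzero
`x` in `J` are the units times generators of `𝔞 J`, with `𝔞` running over the integral ideals in the
inverse class. Multiplication of `x` by `ε^k` translates `t`, so the sum over `k` unfolds the
integral over one period to the whole line, where it equals `c(s) (N 𝔞)^{-s}`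
(`hasSum_integral_expForm`). Each `𝔞` is counted `n` times, `n` being the index of `ε^ℤ` in the unit
group (`hasSum_zetaTerm`).

Hence the period is `n c(s) (i √D)^s ζ(α, s) / ζ(2s)` and depends only on the wide class. If some
unit has negative norm, then `n = 4` and a wide class is a single narrow class; otherwise `n = 2`
and it splits into two. In both cases the product is 4 (`exists_unit_reps`), which is the constant
in the sum formula. -/

noncomputable section

namespace HeckePeriod

/-! ### Arithmetic of the field `K`: norm, trace, real embeddings, integers. -/

section QuadraticField

variable {D : ℕ} {K : Type*} [Field K] [NumberField K] {δ : K}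

theorem delta_ne_ratCast (hD : ¬ IsSquare D) (hδ : δ ^ 2 = (D : K)) (q : ℚ) : δ ≠ (q : K) := by
  rintro rfl
  have h : q ^ 2 = (D : ℚ) := by exact_mod_cast hδ
  apply hD
  rw [← Rat.isSquare_natCast_iff]
  exact ⟨q, by rw [← h, sq]⟩

/-- The basis `1, δ` of the quadratic field `K`. -/
def quadBasis (hD : ¬ IsSquare D) (hK : Module.finrank ℚ K = 2) (hδ : δ ^ 2 = (D : K)) :
    Module.Basis (Fin 2) ℚ K :=
  basisOfLinearIndependentOfCardEqFinrank (b := ![1, δ])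
    (by
      rw [LinearIndependent.pair_iff]
      intro a b h
      have hb : b = 0 := by
        by_contra hb
        apply delta_ne_ratCast hD hδ (-a / b)
        have hb' : (b : K) ≠ 0 := by exact_mod_cast hb
        rw [Rat.smul_def, Rat.smul_def, mul_one] at h
        push_cast
        rw [eq_div_iff hb']
        linear_combination h
      subst hb
      refine ⟨?_, rfl⟩
      simpa [Rat.smul_def] using h)
    (by simp [hK])

theorem exists_rat_coords (hD : ¬ IsSquare D) (hK : Module.finrank ℚ K = 2)
    (hδ : δ ^ 2 = (D : K)) (x : K) : ∃ p q : ℚ, x = p + q * δ := by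
  set b := quadBasis hD hK hδ with hb
  have b0 : b 0 = 1 := by simp [hb, quadBasis]
  have b1 : b 1 = δ := by simp [hb, quadBasis]
  refine ⟨b.repr x 0, b.repr x 1, (b.sum_repr x).symm.trans ?_⟩
  rw [Fin.sum_univ_two, b0, b1, Rat.smul_def, Rat.smul_def, mul_one]

theorem norm_rat_coords (hD : ¬ IsSquare D) (hK : Module.finrank ℚ K = 2)
    (hδ : δ ^ 2 = (D : K)) (p q : ℚ) :
    Algebra.norm ℚ ((p : K) + q * δ) = p ^ 2 - D * q ^ 2 := by
  set b := quadBasis hD hK hδ with hb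
  have b0 : b 0 = 1 := by simp [hb, quadBasis]
  have b1 : b 1 = δ := by simp [hb, quadBasis]
  have h0 : ((p : K) + q * δ) * b 0 = p • b 0 + q • b 1 := by
    rw [b0, b1, Rat.smul_def, Rat.smul_def]; ring
  have h1 : ((p : K) + q * δ) * b 1 = (q * D) • b 0 + p • b 1 := by
    rw [b0, b1, Rat.smul_def, Rat.smul_def]; push_cast; rw [← hδ]; ring
  rw [Algebra.norm_eq_matrix_det b, Matrix.det_fin_two]
  simp only [Algebra.leftMulMatrix_eq_repr_mul, h0, h1]
  simp
  ring

/-- The `ℚ`-linear map with `1 ↦ 1`, `δ ↦ r` is multiplicative because `r` and `δ` satisfy the same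
quadratic equation. -/
theorem exists_embedding (hD : ¬ IsSquare D) (hK : Module.finrank ℚ K = 2)
    (hδ : δ ^ 2 = (D : K)) {r : ℝ} (hr : r ^ 2 = D) : ∃ σ : K →+* ℝ, σ δ = r := by
  set b := quadBasis hD hK hδ with hb
  have b0 : b 0 = 1 := by simp [hb, quadBasis]
  have b1 : b 1 = δ := by simp [hb, quadBasis]
  let f : K →ₗ[ℚ] ℝ := b.constr ℚ ![1, r]
  have hf : ∀ p q : ℚ, f (p + q * δ) = p + q * r := by
    intro p q
    have : (p : K) + q * δ = p • b 0 + q • b 1 := by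
      rw [b0, b1, Rat.smul_def, Rat.smul_def]; ring
    rw [this, map_add, map_smul, map_smul, Module.Basis.constr_basis, Module.Basis.constr_basis]
    simp [Rat.smul_def]
  have f1 : f 1 = 1 := by simpa using hf 1 0
  have hmul : ∀ x y, f (x * y) = f x * f y := by
    intro x y
    obtain ⟨p, q, rfl⟩ := exists_rat_coords hD hK hδ x
    obtain ⟨p', q', rfl⟩ := exists_rat_coords hD hK hδ y
    have : ((p : K) + q * δ) * (p' + q' * δ) =
        ((p * p' + D * (q * q') : ℚ) : K) + ((p * q' + q * p' : ℚ) : K) * δ := by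
      push_cast; rw [← hδ]; ring
    rw [this, hf, hf, hf]
    push_cast; rw [← hr]; ring
  refine ⟨{ toFun := f, map_one' := f1, map_zero' := map_zero f, map_add' := map_add f,
            map_mul' := hmul }, ?_⟩
  change f δ = r
  simpa using hf 0 1

/-- The real embedding of `K` that sends `δ` to `√D`. -/
def emb (hD : ¬ IsSquare D) (hK : Module.finrank ℚ K = 2) (hδ : δ ^ 2 = (D : K)) : K →+* ℝ :=
  (exists_embedding hD hK hδ (r := √D) (Real.sq_sqrt (Nat.cast_nonneg D))).choose

/-- The real embedding of `K` that sends `δ` to `-√D`. -/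
def emb' (hD : ¬ IsSquare D) (hK : Module.finrank ℚ K = 2) (hδ : δ ^ 2 = (D : K)) : K →+* ℝ :=
  (exists_embedding hD hK hδ (r := -√D)
    (by rw [neg_sq]; exact Real.sq_sqrt (Nat.cast_nonneg D))).choose

theorem emb_delta (hD : ¬ IsSquare D) (hK : Module.finrank ℚ K = 2) (hδ : δ ^ 2 = (D : K)) :
    emb hD hK hδ δ = √D :=
  (exists_embedding hD hK hδ (r := √D) (Real.sq_sqrt (Nat.cast_nonneg D))).choose_spec

theorem emb'_delta (hD : ¬ IsSquare D) (hK : Module.finrank ℚ K = 2) (hδ : δ ^ 2 = (D : K)) :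
    emb' hD hK hδ δ = -√D :=
  (exists_embedding hD hK hδ (r := -√D)
    (by rw [neg_sq]; exact Real.sq_sqrt (Nat.cast_nonneg D))).choose_spec

theorem norm_eq_emb_mul_emb' (hD : ¬ IsSquare D) (hK : Module.finrank ℚ K = 2)
    (hδ : δ ^ 2 = (D : K)) (x : K) :
    (Algebra.norm ℚ x : ℝ) = emb hD hK hδ x * emb' hD hK hδ x := by
  obtain ⟨p, q, rfl⟩ := exists_rat_coords hD hK hδ x
  rw [norm_rat_coords hD hK hδ]
  simp only [map_add, map_mul, map_ratCast, emb_delta, emb'_delta]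
  have := Real.sq_sqrt (Nat.cast_nonneg (α := ℝ) D)
  push_cast
  linear_combination (-(q : ℝ) ^ 2) * (-this)

theorem trace_rat_coords (hD : ¬ IsSquare D) (hK : Module.finrank ℚ K = 2)
    (hδ : δ ^ 2 = (D : K)) (p q : ℚ) :
    Algebra.trace ℚ K ((p : K) + q * δ) = 2 * p := by
  set b := quadBasis hD hK hδ with hb
  have b0 : b 0 = 1 := by simp [hb, quadBasis]
  have b1 : b 1 = δ := by simp [hb, quadBasis]
  have h0 : ((p : K) + q * δ) * b 0 = p • b 0 + q • b 1 := by
    rw [b0, b1, Rat.smul_def, Rat.smul_def]; ring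
  have h1 : ((p : K) + q * δ) * b 1 = (q * D) • b 0 + p • b 1 := by
    rw [b0, b1, Rat.smul_def, Rat.smul_def]; push_cast; rw [← hδ]; ring
  rw [Algebra.trace_eq_matrix_trace b, Matrix.trace_fin_two]
  simp only [Algebra.leftMulMatrix_eq_repr_mul, h0, h1]
  simp
  ring

/-- An algebraic integer of `K` is `(a + b δ) / 2` with integers `a ≡ b mod 2`. -/
theorem exists_int_coords (hDsq : Squarefree D) (hD4 : D % 4 = 1) (hD : ¬ IsSquare D)
    (hK : Module.finrank ℚ K = 2) (hδ : δ ^ 2 = (D : K)) {x : K} (hx : IsIntegral ℤ x) :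
    ∃ a b : ℤ, (2 : ℤ) ∣ a - b ∧ 2 * x = a + b * δ := by
  obtain ⟨p, q, rfl⟩ := exists_rat_coords hD hK hδ x
  have ht := Algebra.isIntegral_trace (L := ℚ) hx
  have hn := Algebra.isIntegral_norm ℚ hx
  rw [trace_rat_coords hD hK hδ] at ht
  rw [norm_rat_coords hD hK hδ] at hn
  obtain ⟨a, ha⟩ := IsIntegrallyClosed.isIntegral_iff.mp ht
  obtain ⟨n, hn⟩ := IsIntegrallyClosed.isIntegral_iff.mp hn
  simp only [algebraMap_int_eq, eq_intCast] at ha hn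
  -- With `a = 2p` the trace and `n` the norm, `D (2q)²` is an integer. As `D` is squarefree, the
  -- denominator of `2q` must be 1.
  have key : (D : ℚ) * (2 * q) ^ 2 = ((a ^ 2 - 4 * n : ℤ) : ℚ) := by
    push_cast; rw [ha, hn]; ring
  have hq : ∃ b : ℤ, (b : ℚ) = 2 * q := by
    have h1 : ((D : ℤ) : ℚ) * (2 * q).num ^ 2 = ((a ^ 2 - 4 * n : ℤ) : ℚ) * (2 * q).den ^ 2 := by
      have h0 : ((2 * q).den : ℚ) ≠ 0 := by exact_mod_cast (2 * q).den_nz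
      rw [← key]
      have := Rat.mul_den_eq_num (2 * q)
      push_cast
      rw [← this]; ring
    have h2 : (D : ℤ) * (2 * q).num ^ 2 = (a ^ 2 - 4 * n) * ((2 * q).den : ℤ) ^ 2 := by
      exact_mod_cast h1
    have h3 : ((2 * q).den : ℤ) ^ 2 ∣ (D : ℤ) := by
      have hc : IsCoprime (((2 * q).den : ℤ) ^ 2) ((2 * q).num ^ 2) := by
        apply IsCoprime.pow
        rw [Int.isCoprime_iff_gcd_eq_one, Int.gcd_comm]
        exact (2 * q).reduced
      exact hc.dvd_of_dvd_mul_right ⟨a ^ 2 - 4 * n, by rw [h2]; ring⟩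
    have h4 : (2 * q).den ^ 2 ∣ D := by exact_mod_cast h3
    have h5 := hDsq (2 * q).den (by rwa [← sq])
    rw [Nat.isUnit_iff] at h5
    exact ⟨(2 * q).num, Rat.coe_int_num_of_den_eq_one h5⟩
  obtain ⟨b, hb⟩ := hq
  refine ⟨a, b, ?_, ?_⟩
  · rw [← hb] at key
    have key' : (D : ℤ) * b ^ 2 = a ^ 2 - 4 * n := by exact_mod_cast key
    have hDi : (D : ℤ) % 2 = 1 := by omega
    -- Modulo 2 the relation `D b² = a² - 4n` with `D` odd reads `a² = b²`.
    have : (2 : ℤ) ∣ (a - b) ^ 2 := by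
      obtain ⟨k, hk⟩ : ∃ k : ℤ, (D : ℤ) = 2 * k + 1 := ⟨D / 2, by omega⟩
      rw [hk] at key'
      exact ⟨b ^ 2 + k * b ^ 2 + 2 * n - a * b, by linear_combination -key'⟩
    exact Int.prime_two.dvd_of_dvd_pow this
  · have ha' : (a : K) = 2 * p := by exact_mod_cast congrArg (Rat.cast (K := K)) ha
    have hb' : (b : K) = 2 * q := by exact_mod_cast congrArg (Rat.cast (K := K)) hb
    rw [ha', hb']; ring

theorem isIntegral_half (hδ : δ ^ 2 = (D : K)) {a b n : ℤ} (h : a ^ 2 - D * b ^ 2 = 4 * n) :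
    IsIntegral ℤ (((a : K) + b * δ) / 2) := by
  refine ⟨Polynomial.X ^ 2 - Polynomial.C a * Polynomial.X + Polynomial.C n, ?_, ?_⟩
  · monicity!
  · have h' : (a : K) ^ 2 - D * b ^ 2 = 4 * n := by exact_mod_cast congrArg (Int.cast (R := K)) h
    simp only [Polynomial.eval₂_add, Polynomial.eval₂_sub, Polynomial.eval₂_mul,
      Polynomial.eval₂_pow, Polynomial.eval₂_X, Polynomial.eval₂_C]
    simp only [algebraMap_int_eq, eq_intCast]
    rw [← hδ] at h'
    field_simp
    linear_combination (-h')

end QuadraticField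

/-! ### The unit group modulo powers of the smallest Pell unit. -/

section Units

variable {D : ℕ} {K : Type*} [Field K] [NumberField K] {δ : K}

theorem emb_pell_mul (hD : ¬ IsSquare D) :
    (((pellV D : ℝ) + pellU D * √D) / 2) * (((pellV D : ℝ) - pellU D * √D) / 2) = 1 := by
  have h : (pellV D : ℝ) ^ 2 = D * (pellU D : ℝ) ^ 2 + 4 := by exact_mod_cast (pell_spec hD).2
  have h2 := Real.sq_sqrt (Nat.cast_nonneg (α := ℝ) D)
  linear_combination (1 / 4 : ℝ) * h - (pellU D : ℝ) ^ 2 / 4 * h2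

/-- The real number `(v + u √D) / 2` of the smallest solution. -/
def pellUnit (D : ℕ) : ℝ := ((pellV D : ℝ) + pellU D * √D) / 2

theorem one_lt_pellUnit (hD : ¬ IsSquare D) : 1 < pellUnit D := by
  have hu : (1 : ℝ) ≤ pellU D := by exact_mod_cast (pell_spec hD).1
  have h : (pellV D : ℝ) ^ 2 = D * (pellU D : ℝ) ^ 2 + 4 := by exact_mod_cast (pell_spec hD).2
  have hv : (2 : ℝ) ≤ pellV D := by
    rw [← pow_le_pow_iff_left₀ (by norm_num) (by positivity) two_ne_zero, h]
    have : (0 : ℝ) ≤ D * (pellU D : ℝ) ^ 2 := by positivity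
    linarith
  have hpos : 0 < D := Nat.pos_of_ne_zero (by rintro rfl; exact hD ⟨0, rfl⟩)
  have hs : 0 < √(D : ℝ) := Real.sqrt_pos.mpr (by exact_mod_cast hpos)
  have : 0 < (pellU D : ℝ) * √D := by positivity
  unfold pellUnit
  linarith

theorem pellUnit_pos (hD : ¬ IsSquare D) : 0 < pellUnit D :=
  one_pos.trans (one_lt_pellUnit hD)

theorem pellUnit_inv (hD : ¬ IsSquare D) :
    (pellUnit D)⁻¹ = ((pellV D : ℝ) - pellU D * √D) / 2 :=
  inv_eq_of_mul_eq_one_right (emb_pell_mul hD)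

/-- The unit `(v + u δ) / 2`. -/
def fundUnit (hD : ¬ IsSquare D) (hδ : δ ^ 2 = (D : K)) : (𝓞 K)ˣ where
  val := ⟨(((pellV D : ℤ) : K) + ((pellU D : ℤ) : K) * δ) / 2, isIntegral_half hδ (n := 1) (by
    have := (pell_spec hD).2
    zify at this
    linarith)⟩
  inv := ⟨(((pellV D : ℤ) : K) + ((-pellU D : ℤ) : K) * δ) / 2, isIntegral_half hδ (n := 1) (by
    have := (pell_spec hD).2
    zify at this
    linarith)⟩
  val_inv := by
    apply NumberField.RingOfIntegers.ext
    have h : (pellV D : K) ^ 2 = D * (pellU D : K) ^ 2 + 4 := by exact_mod_cast (pell_spec hD).2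
    change _ / 2 * (_ / 2) = (1 : K)
    push_cast
    linear_combination (1 / 4 : K) * h - (pellU D : K) ^ 2 / 4 * hδ
  inv_val := by
    apply NumberField.RingOfIntegers.ext
    have h : (pellV D : K) ^ 2 = D * (pellU D : K) ^ 2 + 4 := by exact_mod_cast (pell_spec hD).2
    change _ / 2 * (_ / 2) = (1 : K)
    push_cast
    linear_combination (1 / 4 : K) * h - (pellU D : K) ^ 2 / 4 * hδ

variable (hD : ¬ IsSquare D) (hK : Module.finrank ℚ K = 2) (hδ : δ ^ 2 = (D : K))

theorem map_unit_zpow (f : K →+* ℝ) (ξ : (𝓞 K)ˣ) (k : ℤ) :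
    f (((ξ ^ k : (𝓞 K)ˣ) : 𝓞 K) : K) = f ((ξ : 𝓞 K) : K) ^ k := by
  have h := congrArg Units.val
    (map_zpow (Units.map ((f.comp (algebraMap (𝓞 K) K)) : 𝓞 K →* ℝ)) ξ k)
  rw [Units.val_zpow_eq_zpow_val] at h
  exact h

theorem emb_fundUnit : emb hD hK hδ (fundUnit hD hδ : (𝓞 K)ˣ) = pellUnit D := by
  simp [fundUnit, emb_delta, pellUnit, map_ofNat (emb hD hK hδ) 2]

theorem emb'_fundUnit : emb' hD hK hδ (fundUnit hD hδ : (𝓞 K)ˣ) = (pellUnit D)⁻¹ := by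
  rw [pellUnit_inv hD]
  simp [fundUnit, emb'_delta, map_ofNat (emb' hD hK hδ) 2]
  ring

theorem emb_mul_emb'_unit (η : (𝓞 K)ˣ) :
    emb hD hK hδ (η : 𝓞 K) * emb' hD hK hδ (η : 𝓞 K) = 1 ∨
    emb hD hK hδ (η : 𝓞 K) * emb' hD hK hδ (η : 𝓞 K) = -1 := by
  rw [← norm_eq_emb_mul_emb']
  have h := NumberField.isUnit_iff_norm.mp η.isUnit
  rw [RingOfIntegers.coe_norm] at h
  rcases abs_eq (zero_le_one) |>.mp h with h | h <;> rw [h] <;> simp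

/-- A unit `x > 1` of norm 1 has conjugate `0 < y < x`. Hence both coefficients in `2x = a + b √D`
are positive and `(a, b)` solves the Pell equation, so minimality of `pellU` bounds `b`, and then
`a`, from below. -/
theorem pellUnit_le (hDsq : Squarefree D) (hD4 : D % 4 = 1) (η : (𝓞 K)ˣ)
    (h1 : emb hD hK hδ (η : 𝓞 K) * emb' hD hK hδ (η : 𝓞 K) = 1)
    (h2 : 1 < emb hD hK hδ (η : 𝓞 K)) : pellUnit D ≤ emb hD hK hδ (η : 𝓞 K) := by
  obtain ⟨a, b, -, hab⟩ := exists_int_coords hDsq hD4 hD hK hδ (η : 𝓞 K).isIntegral_coe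
  have e1 := congrArg (emb hD hK hδ) hab
  have e2 := congrArg (emb' hD hK hδ) hab
  simp only [map_add, map_mul, map_intCast, emb_delta, emb'_delta, map_ofNat] at e1 e2
  set x := emb hD hK hδ (η : 𝓞 K)
  set y := emb' hD hK hδ (η : 𝓞 K)
  have hpos : 0 < D := Nat.pos_of_ne_zero (by rintro rfl; exact hD ⟨0, rfl⟩)
  have hs : 0 < √(D : ℝ) := Real.sqrt_pos.mpr (by exact_mod_cast hpos)
  have hsq := Real.sq_sqrt (Nat.cast_nonneg (α := ℝ) D)
  have hy : 0 < y := pos_of_mul_pos_right (h1 ▸ one_pos) (by linarith)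
  have hyx : y < x := by nlinarith
  have hb : 0 < b := by
    have : 0 < (b : ℝ) * √D := by linarith
    exact_mod_cast pos_of_mul_pos_left this hs.le
  have ha : 0 < a := by
    have : 0 < (a : ℝ) := by linarith
    exact_mod_cast this
  have hpell : a ^ 2 = D * b ^ 2 + 4 := by
    have : (a : ℝ) ^ 2 = D * (b : ℝ) ^ 2 + 4 := by
      have h3 : (2 * x) * (2 * y) = 4 := by linear_combination 4 * h1
      rw [e1, e2] at h3
      rw [← hsq]; linear_combination h3
    exact_mod_cast this
  lift a to ℕ using ha.le
  lift b to ℕ using hb.le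
  have hpell' : a ^ 2 = D * b ^ 2 + 4 := by exact_mod_cast hpell
  have hu : pellU D ≤ b := Nat.sInf_le ⟨by exact_mod_cast hb, a, hpell'⟩
  have hv : pellV D ≤ a := by
    rw [← pow_le_pow_iff_left₀ (by positivity) (by positivity) two_ne_zero,
      (pell_spec hD).2, hpell']
    gcongr
  have hu' : (pellU D : ℝ) ≤ b := by exact_mod_cast hu
  have hv' : (pellV D : ℝ) ≤ a := by exact_mod_cast hv
  have : (pellU D : ℝ) * √D ≤ b * √D := by gcongr
  unfold pellUnit
  push_cast at e1
  linarith

/-- Division by a power of `ε` moves the first conjugate into `[1, ε)`. The quotient still has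
positive conjugates, hence norm 1, so `pellUnit_le` leaves only the value 1. -/
theorem exists_eq_zpow_fundUnit (hDsq : Squarefree D) (hD4 : D % 4 = 1) (η : (𝓞 K)ˣ)
    (h1 : 0 < emb hD hK hδ (η : 𝓞 K)) (h2 : 0 < emb' hD hK hδ (η : 𝓞 K)) :
    ∃ k : ℤ, η = fundUnit hD hδ ^ k := by
  obtain ⟨k, hk1, hk2⟩ := exists_mem_Ico_zpow h1 (one_lt_pellUnit hD)
  refine ⟨k, ?_⟩
  have hpk : 0 < pellUnit D ^ k := zpow_pos (pellUnit_pos hD) k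
  set ξ := η * (fundUnit hD hδ ^ k)⁻¹ with hξ
  have e : ∀ (f : K →+* ℝ), f ((ξ : 𝓞 K) : K) =
      f ((η : 𝓞 K) : K) * (f ((fundUnit hD hδ : (𝓞 K)ˣ) : 𝓞 K) ^ k)⁻¹ := by
    intro f
    rw [hξ, ← zpow_neg, ← zpow_neg, ← map_unit_zpow f, Units.val_mul, ← map_mul]
    rfl
  have e1 := e (emb hD hK hδ)
  have e2 := e (emb' hD hK hδ)
  rw [emb_fundUnit, ← div_eq_mul_inv] at e1
  rw [emb'_fundUnit, inv_zpow, inv_inv] at e2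
  have hlt : emb hD hK hδ (ξ : 𝓞 K) < pellUnit D := by
    rw [e1, div_lt_iff₀ hpk, ← zpow_one_add₀ (pellUnit_pos hD).ne', add_comm]; exact hk2
  have hge : 1 ≤ emb hD hK hδ (ξ : 𝓞 K) := by
    rw [e1, le_div_iff₀ hpk, one_mul]; exact hk1
  have hn : emb hD hK hδ (ξ : 𝓞 K) * emb' hD hK hδ (ξ : 𝓞 K) = 1 := by
    rcases emb_mul_emb'_unit hD hK hδ ξ with h | h
    · exact h
    · have : 0 < emb hD hK hδ (ξ : 𝓞 K) * emb' hD hK hδ (ξ : 𝓞 K) := by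
        rw [e2]; positivity
      linarith
  have hone : emb hD hK hδ (ξ : 𝓞 K) = 1 := by
    by_contra hne
    exact absurd (pellUnit_le hD hK hδ hDsq hD4 ξ hn (lt_of_le_of_ne hge (Ne.symm hne)))
      (not_le.mpr hlt)
  have : ((ξ : 𝓞 K) : K) = 1 := (emb hD hK hδ).injective (by rw [hone, map_one])
  have hξ1 : ξ = 1 := by
    apply Units.ext
    apply NumberField.RingOfIntegers.ext
    simpa using this
  rwa [hξ, mul_inv_eq_one] at hξ1

/-- The signs of the two real conjugates of a unit. -/
def unitSigns (η : (𝓞 K)ˣ) : SignType × SignType :=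
  (SignType.sign (emb hD hK hδ (η : 𝓞 K)), SignType.sign (emb' hD hK hδ (η : 𝓞 K)))

theorem unitSigns_mul (η ξ : (𝓞 K)ˣ) :
    unitSigns hD hK hδ (η * ξ) = unitSigns hD hK hδ η * unitSigns hD hK hδ ξ := by
  simp [unitSigns, sign_mul]

theorem unitSigns_one : unitSigns hD hK hδ 1 = 1 := by
  simp [unitSigns]

theorem unitSigns_neg (η : (𝓞 K)ˣ) : unitSigns hD hK hδ (-η) = -unitSigns hD hK hδ η := by
  simp [unitSigns, Left.sign_neg]

theorem unitSigns_zpow_fundUnit (k : ℤ) : unitSigns hD hK hδ (fundUnit hD hδ ^ k) = 1 := by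
  have h1 : unitSigns hD hK hδ (fundUnit hD hδ) = 1 := by
    simp [unitSigns, emb_fundUnit, emb'_fundUnit, pellUnit_pos hD]
  let f : (𝓞 K)ˣ →* SignType × SignType :=
    ⟨⟨unitSigns hD hK hδ, unitSigns_one hD hK hδ⟩, unitSigns_mul hD hK hδ⟩
  have : fundUnit hD hδ ^ k ∈ f.ker := Subgroup.zpow_mem _ (by exact h1) k
  exact this

theorem zpow_fundUnit_injective (hK : Module.finrank ℚ K = 2) : Function.Injective fun k : ℤ => (fundUnit hD hδ : (𝓞 K)ˣ) ^ k := by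
  intro k l h
  have h' := congrArg (fun x : (𝓞 K)ˣ => emb hD hK hδ ((x : 𝓞 K) : K)) h
  simp only [map_unit_zpow, emb_fundUnit] at h'
  exact zpow_right_injective₀ (pellUnit_pos hD) (one_lt_pellUnit hD).ne' h'

/-- The sign map is a homomorphism with kernel `ε^ℤ`, so units with distinct sign patterns
exhausting the image represent the cosets of `ε^ℤ`. -/
theorem bijective_mul_zpow_fundUnit (hDsq : Squarefree D) (hD4 : D % 4 = 1) {ι : Type*}
    (rep : ι → (𝓞 K)ˣ) (hinj : Function.Injective fun i => unitSigns hD hK hδ (rep i))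
    (hsurj : ∀ η, ∃ i, unitSigns hD hK hδ (rep i) = unitSigns hD hK hδ η) :
    Function.Bijective fun p : ι × ℤ => rep p.1 * fundUnit hD hδ ^ p.2 := by
  constructor
  · rintro ⟨i, k⟩ ⟨j, l⟩ h
    have h' : unitSigns hD hK hδ (rep i) = unitSigns hD hK hδ (rep j) := by
      have := congrArg (unitSigns hD hK hδ) h
      simpa only [unitSigns_mul, unitSigns_zpow_fundUnit, mul_one] using this
    have hij : i = j := hinj h'
    subst hij
    have : k = l := zpow_fundUnit_injective hD hδ hK (mul_left_cancel h)
    rw [this]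
  · intro η
    obtain ⟨i, hi⟩ := hsurj η
    have hs : unitSigns hD hK hδ ((rep i)⁻¹ * η) = 1 := by
      rw [unitSigns_mul, ← hi, ← unitSigns_mul, inv_mul_cancel, unitSigns_one]
    have hs1 := congrArg Prod.fst hs
    have hs2 := congrArg Prod.snd hs
    obtain ⟨k, hk⟩ := exists_eq_zpow_fundUnit hD hK hδ hDsq hD4 ((rep i)⁻¹ * η)
      (sign_eq_one_iff.mp hs1) (sign_eq_one_iff.mp hs2)
    exact ⟨(i, k), by simp only [← hk, mul_inv_cancel_left]⟩

theorem unitSigns_cases (η : (𝓞 K)ˣ) :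
    (0 < Algebra.norm ℚ ((η : 𝓞 K) : K) ∧
      (unitSigns hD hK hδ η = (1, 1) ∨ unitSigns hD hK hδ η = (-1, -1))) ∨
    (Algebra.norm ℚ ((η : 𝓞 K) : K) < 0 ∧
      (unitSigns hD hK hδ η = (1, -1) ∨ unitSigns hD hK hδ η = (-1, 1))) := by
  have hn := norm_eq_emb_mul_emb' hD hK hδ ((η : 𝓞 K) : K)
  have h := emb_mul_emb'_unit hD hK hδ η
  have hx : emb hD hK hδ (η : 𝓞 K) ≠ 0 := by
    intro h0; rw [h0] at h; norm_num at h
  have hy : emb' hD hK hδ (η : 𝓞 K) ≠ 0 := by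
    intro h0; rw [h0] at h; norm_num at h
  unfold unitSigns
  rw [← Rat.cast_pos (K := ℝ), ← Rat.cast_lt_zero (K := ℝ), hn]
  rcases lt_or_gt_of_ne hx with hx | hx <;> rcases lt_or_gt_of_ne hy with hy | hy
  · exact Or.inl ⟨mul_pos_of_neg_of_neg hx hy, Or.inr (by simp [hx, hy])⟩
  · exact Or.inr ⟨mul_neg_of_neg_of_pos hx hy, Or.inr (by simp [hx, hy])⟩
  · exact Or.inr ⟨mul_neg_of_pos_of_neg hx hy, Or.inl (by simp [hx, hy])⟩
  · exact Or.inl ⟨mul_pos hx hy, Or.inl (by simp [hx, hy])⟩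

/-- Without units of negative norm only the patterns `(+,+)` and `(-,-)` occur. -/
theorem exists_unit_reps_of_forall (hK : Module.finrank ℚ K = 2) (hDsq : Squarefree D) (hD4 : D % 4 = 1)
    (h : ∀ η : (𝓞 K)ˣ, ¬ Algebra.norm ℚ ((η : 𝓞 K) : K) < 0) :
    ∃ rep : Fin 2 → (𝓞 K)ˣ,
      Function.Bijective fun p : Fin 2 × ℤ => rep p.1 * fundUnit hD hδ ^ p.2 := by
  refine ⟨![1, -1], bijective_mul_zpow_fundUnit hD hK hδ hDsq hD4 _ ?_ ?_⟩
  · intro i j hij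
    fin_cases i <;> fin_cases j <;>
      simp [unitSigns_neg, unitSigns_one, Prod.ext_iff] at hij ⊢
  · intro η
    rcases unitSigns_cases hD hK hδ η with ⟨-, h1 | h1⟩ | ⟨h0, -⟩
    · exact ⟨0, by simp [h1, unitSigns_one]; rfl⟩
    · exact ⟨1, by simp [h1, unitSigns_one, unitSigns_neg]; rfl⟩
    · exact absurd h0 (h η)

/-- A unit of negative norm has mixed signs; together with `-1` it produces all four patterns. -/
theorem exists_unit_reps_of_exists (hK : Module.finrank ℚ K = 2) (hDsq : Squarefree D) (hD4 : D % 4 = 1)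
    (h : ∃ η : (𝓞 K)ˣ, Algebra.norm ℚ ((η : 𝓞 K) : K) < 0) :
    ∃ rep : Fin 4 → (𝓞 K)ˣ,
      Function.Bijective fun p : Fin 4 × ℤ => rep p.1 * fundUnit hD hδ ^ p.2 := by
  obtain ⟨ξ, hξ⟩ : ∃ ξ : (𝓞 K)ˣ, unitSigns hD hK hδ ξ = (1, -1) := by
    obtain ⟨η, h⟩ := h
    rcases unitSigns_cases hD hK hδ η with ⟨h0, -⟩ | ⟨-, h1 | h1⟩
    · exact absurd h0 (not_lt.mpr h.le)
    · exact ⟨η, h1⟩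
    · exact ⟨-η, by rw [unitSigns_neg, h1]; rfl⟩
  refine ⟨![1, -1, ξ, -ξ], bijective_mul_zpow_fundUnit hD hK hδ hDsq hD4 _ ?_ ?_⟩
  · intro i j hij
    fin_cases i <;> fin_cases j <;>
      simp [unitSigns_neg, unitSigns_one, Prod.ext_iff, hξ] at hij ⊢
  · intro η
    rcases unitSigns_cases hD hK hδ η with ⟨-, h1 | h1⟩ | ⟨-, h1 | h1⟩
    · exact ⟨0, by simp [h1, unitSigns_one]; rfl⟩
    · exact ⟨1, by simp [h1, unitSigns_one, unitSigns_neg]; rfl⟩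
    · exact ⟨2, by simp [h1, hξ]⟩
    · exact ⟨3, by simp [h1, hξ, unitSigns_neg]⟩

end Units

/-! ### The ideal and the narrow class attached to a form. -/

section FormIdeal

variable {D : ℕ} {K : Type*} [Field K] [NumberField K] {δ : K}

theorem A_ne_zero (hD : ¬ IsSquare D) {Q : QForm} (hQ : Q.disc = D) : Q.A ≠ 0 := by
  intro h
  rw [QForm.disc, h] at hQ
  exact hD ⟨Q.B.natAbs, by zify; rw [abs_mul_abs_self, ← hQ]; ring⟩

/-- The algebraic integer `(-B + δ) / 2`. -/
def theta (hδ : δ ^ 2 = (D : K)) {Q : QForm} (hQ : Q.disc = D) : 𝓞 K :=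
  ⟨(((-Q.B : ℤ) : K) + ((1 : ℤ) : K) * δ) / 2, isIntegral_half hδ (n := Q.A * Q.C) (by
    rw [← hQ, QForm.disc]; ring)⟩

variable (hδ : δ ^ 2 = (D : K)) {Q : QForm} (hQ : Q.disc = D)

theorem coe_theta : algebraMap (𝓞 K) K (theta hδ hQ) = (-(Q.B : K) + δ) / 2 := by
  change (((-Q.B : ℤ) : K) + ((1 : ℤ) : K) * δ) / 2 = _
  push_cast
  ring

theorem theta_mul_theta :
    theta hδ hQ * theta hδ hQ = -(Q.B : 𝓞 K) * theta hδ hQ - (Q.A : 𝓞 K) * (Q.C : 𝓞 K) := by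
  apply NumberField.RingOfIntegers.coe_injective
  have h : (Q.B : K) ^ 2 - 4 * Q.A * Q.C = D := by
    have := congrArg (Int.cast (R := K)) hQ
    simpa [QForm.disc] using this
  simp only [map_sub, map_mul, map_neg, map_intCast]
  rw [coe_theta]
  linear_combination (1 / 4 : K) * hδ - (1 / 4 : K) * h

/-- Since `B² ≡ D ≡ 1 mod 4`, `B` is odd, so `θ` differs from `(1 + δ) / 2` by an integer. Thus
every form of discriminant `D` supplies a basis `1, θ` of the ring of integers. -/
theorem exists_int_add_theta (hDsq : Squarefree D) (hD4 : D % 4 = 1) (hD : ¬ IsSquare D)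
    (hK : Module.finrank ℚ K = 2) (x : 𝓞 K) :
    ∃ i j : ℤ, x = (i : 𝓞 K) + (j : 𝓞 K) * theta hδ hQ := by
  obtain ⟨a, b, h2, hx⟩ := exists_int_coords hDsq hD4 hD hK hδ x.isIntegral_coe
  have hB : ∃ k, Q.B = 2 * k + 1 := by
    have h4 : Q.B ^ 2 % 4 = 1 := by
      have h1 : Q.B ^ 2 = D + 4 * (Q.A * Q.C) := by rw [← hQ, QForm.disc]; ring
      omega
    rcases Int.even_or_odd' Q.B with ⟨k, hk | hk⟩
    · rw [hk] at h4; ring_nf at h4; omega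
    · exact ⟨k, hk⟩
  obtain ⟨k, hk⟩ := hB
  obtain ⟨l, hl⟩ := h2
  refine ⟨l + (k + 1) * b, b, ?_⟩
  apply NumberField.RingOfIntegers.coe_injective
  simp only [map_add, map_mul, map_intCast]
  rw [coe_theta, hk]
  have ha : (a : K) = b + 2 * l := by
    have := congrArg (Int.cast (R := K)) hl
    push_cast at this
    linear_combination this
  rw [ha] at hx
  push_cast
  linear_combination hx / 2

theorem int_add_theta_injective (hD : ¬ IsSquare D) {i j i' j' : ℤ}
    (h : (i : 𝓞 K) + (j : 𝓞 K) * theta hδ hQ = (i' : 𝓞 K) + (j' : 𝓞 K) * theta hδ hQ) :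
    i = i' ∧ j = j' := by
  have h' := congrArg (algebraMap (𝓞 K) K) h
  simp only [map_add, map_mul, map_intCast] at h'
  rw [coe_theta] at h'
  have hj : j = j' := by
    by_contra hne
    have hne' : (j : K) - j' ≠ 0 := by
      rw [sub_ne_zero]; exact_mod_cast hne
    apply delta_ne_ratCast hD hδ (Q.B + 2 * (i' - i) / (j - j'))
    push_cast
    field_simp
    linear_combination 2 * h'
  subst hj
  refine ⟨?_, rfl⟩
  exact_mod_cast add_right_cancel h'

/-- The ideal `A ℤ + ((-B + δ) / 2) ℤ`. -/
def formIdeal (hDsq : Squarefree D) (hD4 : D % 4 = 1) (hD : ¬ IsSquare D)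
    (hK : Module.finrank ℚ K = 2) : Ideal (𝓞 K) where
  carrier := {x | ∃ m n : ℤ, x = (Q.A : 𝓞 K) * m + theta hδ hQ * n}
  zero_mem' := ⟨0, 0, by simp⟩
  add_mem' := by
    rintro _ _ ⟨m, n, rfl⟩ ⟨m', n', rfl⟩
    exact ⟨m + m', n + n', by push_cast; ring⟩
  smul_mem' := by
    rintro r _ ⟨m, n, rfl⟩
    obtain ⟨i, j, rfl⟩ := exists_int_add_theta hδ hQ hDsq hD4 hD hK r
    -- Coefficients of `(i + j θ)(A m + θ n)` after substituting `θ² = -B θ - A C`.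
    refine ⟨i * m - j * Q.C * n, i * n + j * Q.A * m - j * Q.B * n, ?_⟩
    rw [smul_eq_mul]
    push_cast
    linear_combination (j : 𝓞 K) * n * theta_mul_theta hδ hQ

variable (hDsq : Squarefree D) (hD4 : D % 4 = 1) (hD : ¬ IsSquare D)
  (hK : Module.finrank ℚ K = 2)

theorem mem_formIdeal {x : 𝓞 K} : x ∈ formIdeal hδ hQ hDsq hD4 hD hK ↔
    ∃ m n : ℤ, x = (Q.A : 𝓞 K) * m + theta hδ hQ * n := Iff.rfl

/-- Coordinates of an algebraic integer with respect to `θ, 1`. -/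
def integerEquiv : (Fin 2 → ℤ) ≃ₗ[ℤ] 𝓞 K :=
  LinearEquiv.ofBijective
    { toFun := fun v => (v 1 : 𝓞 K) + (v 0 : 𝓞 K) * theta hδ hQ
      map_add' := by intro v w; simp only [Pi.add_apply]; push_cast; ring
      map_smul' := by
        intro k v; simp only [Pi.smul_apply, smul_eq_mul, zsmul_eq_mul, RingHom.id_apply]
        push_cast; ring }
    (by
      constructor
      · intro v w h
        obtain ⟨h1, h0⟩ := int_add_theta_injective hδ hQ hD h
        ext i; fin_cases i <;> assumption
      · intro x
        obtain ⟨i, j, rfl⟩ := exists_int_add_theta hδ hQ hDsq hD4 hD hK x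
        exact ⟨![j, i], rfl⟩)

/-- Coordinates of an element of the ideal of a form with respect to `θ, A`. -/
def formIdealEquiv : (Fin 2 → ℤ) ≃ₗ[ℤ] formIdeal hδ hQ hDsq hD4 hD hK :=
  LinearEquiv.ofBijective
    { toFun := fun v => ⟨(Q.A : 𝓞 K) * (v 1 : ℤ) + theta hδ hQ * (v 0 : ℤ), v 1, v 0, rfl⟩
      map_add' := by
        intro v w; apply Subtype.ext; simp only [Pi.add_apply, Submodule.coe_add]; push_cast; ring
      map_smul' := by
        intro k v; apply Subtype.ext
        change _ = k • ((Q.A : 𝓞 K) * (v 1 : ℤ) + theta hδ hQ * (v 0 : ℤ))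
        simp only [Pi.smul_apply, smul_eq_mul, zsmul_eq_mul]
        push_cast; ring }
    (by
      constructor
      · intro v w h
        have h := congrArg Subtype.val h
        change (Q.A : 𝓞 K) * (v 1 : ℤ) + theta hδ hQ * (v 0 : ℤ) =
          (Q.A : 𝓞 K) * (w 1 : ℤ) + theta hδ hQ * (w 0 : ℤ) at h
        obtain ⟨h1, h0⟩ := int_add_theta_injective hδ hQ hD (i := Q.A * v 1) (i' := Q.A * w 1)
          (j := v 0) (j' := w 0) (by push_cast; linear_combination h)
        have h1 := mul_left_cancel₀ (A_ne_zero hD hQ) h1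
        ext i; fin_cases i <;> assumption
      · rintro ⟨x, m, n, rfl⟩
        exact ⟨![n, m], rfl⟩)

theorem coe_formIdealEquiv (v : Fin 2 → ℤ) :
    algebraMap (𝓞 K) K (formIdealEquiv hδ hQ hDsq hD4 hD hK v) =
      (Q.A : K) * (v 1 : ℤ) + (-(Q.B : K) + δ) / 2 * (v 0 : ℤ) := by
  rw [← coe_theta hδ hQ]
  change algebraMap (𝓞 K) K ((Q.A : 𝓞 K) * (v 1 : ℤ) + theta hδ hQ * (v 0 : ℤ)) = _
  simp only [map_add, map_mul, map_intCast]

/-- The bases `θ, 1` of the ring and `θ, A` of the ideal are related by `diag(1, A)`. -/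
theorem absNorm_formIdeal :
    Ideal.absNorm (formIdeal hδ hQ hDsq hD4 hD hK) = Q.A.natAbs := by
  rw [← Ideal.natAbs_det_basis_change
    (Module.Basis.ofEquivFun (integerEquiv hδ hQ hDsq hD4 hD hK).symm) _
    (Module.Basis.ofEquivFun (formIdealEquiv hδ hQ hDsq hD4 hD hK).symm)]
  rw [Module.Basis.det_apply, Matrix.det_fin_two]
  simp only [Module.Basis.toMatrix_apply, Function.comp, Module.Basis.coe_ofEquivFun,
    LinearEquiv.symm_symm, Module.Basis.ofEquivFun_repr_apply]
  have h0 : (integerEquiv hδ hQ hDsq hD4 hD hK).symm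
      ((formIdealEquiv hδ hQ hDsq hD4 hD hK (Pi.single 0 1) : 𝓞 K)) = ![1, 0] := by
    rw [LinearEquiv.symm_apply_eq]
    change (Q.A : 𝓞 K) * ((Pi.single 0 1 : Fin 2 → ℤ) 1 : ℤ) +
      theta hδ hQ * ((Pi.single 0 1 : Fin 2 → ℤ) 0 : ℤ) = ((0 : ℤ) : 𝓞 K) + ((1 : ℤ) : 𝓞 K) * _
    simp
  have h1 : (integerEquiv hδ hQ hDsq hD4 hD hK).symm
      ((formIdealEquiv hδ hQ hDsq hD4 hD hK (Pi.single 1 1) : 𝓞 K)) = ![0, Q.A] := by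
    rw [LinearEquiv.symm_apply_eq]
    change (Q.A : 𝓞 K) * ((Pi.single 1 1 : Fin 2 → ℤ) 1 : ℤ) +
      theta hδ hQ * ((Pi.single 1 1 : Fin 2 → ℤ) 0 : ℤ) = (Q.A : 𝓞 K) + ((0 : ℤ) : 𝓞 K) * _
    simp
  rw [h0, h1]
  simp

theorem formIdeal_ne_bot : formIdeal hδ hQ hDsq hD4 hD hK ≠ ⊥ := by
  rw [Ne, ← Ideal.absNorm_eq_zero_iff, absNorm_formIdeal, Int.natAbs_eq_zero]
  exact A_ne_zero hD hQ

/-- The ideal of a form as a nonzero ideal. -/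
def formIdeal₀ : (Ideal (𝓞 K))⁰ :=
  ⟨formIdeal hδ hQ hDsq hD4 hD hK, mem_nonZeroDivisors_of_ne_zero (formIdeal_ne_bot hδ hQ hDsq hD4 hD hK)⟩

/-- The fractional ideal `(2 A ℤ + (-B + δ) ℤ) y`. -/
def formFractional (y : Kˣ) : (FractionalIdeal (𝓞 K)⁰ K)ˣ :=
  toPrincipalIdeal (𝓞 K) K (Units.mk0 2 two_ne_zero * y) *
    FractionalIdeal.mk0 K (formIdeal₀ hδ hQ hDsq hD4 hD hK)

theorem mem_formFractional (y : Kˣ) (x : K) :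
    x ∈ (formFractional hδ hQ hDsq hD4 hD hK y : FractionalIdeal (𝓞 K)⁰ K) ↔
      ∃ m n : ℤ, x = (2 * (Q.A : K) * m + (-(Q.B : K) + δ) * n) * y := by
  rw [formFractional, Units.val_mul, coe_toPrincipalIdeal, FractionalIdeal.coe_mk0,
    FractionalIdeal.mem_singleton_mul]
  constructor
  · rintro ⟨z, hz, rfl⟩
    obtain ⟨z, ⟨m, n, rfl⟩, rfl⟩ := FractionalIdeal.mem_coeIdeal _ |>.mp hz
    refine ⟨m, n, ?_⟩
    simp only [map_add, map_mul, map_intCast]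
    rw [coe_theta]
    simp
    ring
  · rintro ⟨m, n, rfl⟩
    refine ⟨_, FractionalIdeal.mem_coeIdeal_of_mem _
      ((mem_formIdeal hδ hQ hDsq hD4 hD hK).mpr ⟨m, n, rfl⟩), ?_⟩
    simp only [map_add, map_mul, map_intCast]
    rw [coe_theta]
    simp
    ring

theorem hasClass_iff (β : NarrowClassGroup K) : Q.HasClass δ β ↔
    ∃ y : Kˣ, SignType.sign (Algebra.norm ℚ (y : K)) = SignType.sign Q.A ∧
      (QuotientGroup.mk (formFractional hδ hQ hDsq hD4 hD hK y) : NarrowClassGroup K) = β := by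
  constructor
  · rintro ⟨y, I, hy, hI, rfl⟩
    refine ⟨y, hy, congrArg _ ?_⟩
    apply Units.ext
    ext x
    exact (mem_formFractional hδ hQ hDsq hD4 hD hK y x).trans (hI x).symm
  · rintro ⟨y, hy, rfl⟩
    exact ⟨y, _, hy, mem_formFractional hδ hQ hDsq hD4 hD hK y, rfl⟩

/-- The scaling by `2y` is principal and disappears in the wide class group; only the narrow class
sees the sign of the norm of `y`. -/
theorem toWide_of_hasClass {β : NarrowClassGroup K} (h : Q.HasClass δ β) :
    toWide β = ClassGroup.mk0 (formIdeal₀ hδ hQ hDsq hD4 hD hK) := by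
  obtain ⟨y, -, rfl⟩ := (hasClass_iff hδ hQ hDsq hD4 hD hK β).mp h
  change ClassGroup.mk (R := 𝓞 K) (K := K) (formFractional hδ hQ hDsq hD4 hD hK y) = _
  rw [formFractional, map_mul, ClassGroup.mk_mk0, mul_eq_right, ClassGroup.mk_eq_one_iff,
    coe_toPrincipalIdeal]
  exact ⟨⟨((Units.mk0 2 two_ne_zero * y : Kˣ) : K), by simp⟩⟩

include hδ hD hK in
theorem norm_delta : Algebra.norm ℚ δ = -D := by
  have := norm_rat_coords hD hK hδ 0 1
  simpa using this

include hδ hD in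
theorem delta_ne_zero : δ ≠ 0 := by
  have := delta_ne_ratCast hD hδ 0
  simpa using this

include hδ hQ hDsq hD4 hD hK in
-- An admissible `y` is `1` for `A > 0` and `δ`, of norm `-D`, for `A < 0`. Two admissible choices
-- differ by a factor of positive norm.
theorem existsUnique_hasClass : ∃! β : NarrowClassGroup K, Q.HasClass δ β := by
  simp only [hasClass_iff hδ hQ hDsq hD4 hD hK]
  have hpos : 0 < D := Nat.pos_of_ne_zero (by rintro rfl; exact hD ⟨0, rfl⟩)
  have hex : ∃ y : Kˣ, SignType.sign (Algebra.norm ℚ (y : K)) = SignType.sign Q.A := by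
    rcases lt_or_gt_of_ne (A_ne_zero hD hQ) with h | h
    · refine ⟨Units.mk0 δ (delta_ne_zero hδ hD), ?_⟩
      rw [Units.val_mk0, norm_delta hδ hD hK, sign_neg h, sign_neg]
      simpa using hpos
    · exact ⟨1, by simp [sign_pos h]⟩
  obtain ⟨y, hy⟩ := hex
  refine ⟨_, ⟨y, hy, rfl⟩, ?_⟩
  rintro _ ⟨z, hz, rfl⟩
  rw [QuotientGroup.eq]
  refine ⟨z⁻¹ * y, ?_, ?_⟩
  · change 0 < Algebra.norm ℚ ((z⁻¹ * y : Kˣ) : K)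
    rw [Units.val_mul, map_mul, Units.val_inv_eq_inv_val, ← sign_eq_one_iff, sign_mul, hy]
    have : SignType.sign (Algebra.norm ℚ ((z : K)⁻¹)) = SignType.sign Q.A := by
      have h1 : Algebra.norm ℚ ((z : K)⁻¹) * Algebra.norm ℚ (z : K) = 1 := by
        rw [← map_mul, inv_mul_cancel₀ z.ne_zero, map_one]
      have h2 := congrArg SignType.sign h1
      rw [sign_mul, hz, sign_one] at h2
      revert h2
      generalize SignType.sign (Algebra.norm ℚ ((z : K)⁻¹)) = a
      generalize SignType.sign Q.A = b
      revert a b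
      decide
    rw [this, ← sign_mul]
    exact sign_pos (mul_self_pos.mpr (A_ne_zero hD hQ))
  · simp only [formFractional, map_mul, map_inv]
    generalize toPrincipalIdeal (𝓞 K) K y = a
    generalize toPrincipalIdeal (𝓞 K) K z = b
    rw [eq_inv_mul_iff_mul_eq, mul_right_comm, mul_assoc _ b, mul_inv_cancel_left]

end FormIdeal

/-! ### Representing narrow classes by forms; the fibres over wide classes. -/

section NarrowClasses

variable {D : ℕ} {K : Type*} [Field K] [NumberField K] {δ : K}

theorem exists_integral_narrow (β : NarrowClassGroup K) :
    ∃ J : (Ideal (𝓞 K))⁰, (QuotientGroup.mk (FractionalIdeal.mk0 K J) : NarrowClassGroup K) = β := by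
  obtain ⟨I, rfl⟩ := QuotientGroup.mk_surjective β
  obtain ⟨a, J, ha, hJ⟩ := FractionalIdeal.exists_eq_spanSingleton_mul (I : FractionalIdeal (𝓞 K)⁰ K)
  have ha' : (a : K) ≠ 0 := by simpa using ha
  have hI0 : (I : FractionalIdeal (𝓞 K)⁰ K) ≠ 0 := I.ne_zero
  have hJ0 : J ≠ 0 := by
    rintro rfl
    apply hI0
    rw [hJ]
    simp
  have hJ' : Ideal.span {a} * J ≠ 0 := mul_ne_zero (by simpa using ha) hJ0
  refine ⟨⟨Ideal.span {a} * J, mem_nonZeroDivisors_of_ne_zero hJ'⟩, ?_⟩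
  rw [eq_comm, QuotientGroup.eq]
  -- From `I = a⁻¹ J`, multiplication by `a²`, whose norm is a square, gives the integral ideal `a
  -- J` in the same narrow class.
  refine ⟨Units.mk0 (a : K) ha' * Units.mk0 (a : K) ha', ?_, ?_⟩
  · change 0 < Algebra.norm ℚ ((a : K) * (a : K))
    rw [map_mul]
    exact mul_self_pos.mpr (by simpa [Algebra.norm_eq_zero_iff] using ha)
  · rw [eq_inv_mul_iff_mul_eq]
    apply Units.ext
    rw [Units.val_mul, coe_toPrincipalIdeal, FractionalIdeal.coe_mk0, hJ]
    simp only [Units.val_mul, Units.val_mk0, FractionalIdeal.coeIdeal_mul,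
      FractionalIdeal.coeIdeal_span_singleton]
    rw [mul_right_comm, FractionalIdeal.spanSingleton_mul_spanSingleton,
      inv_mul_cancel_left₀ ha']

/-- The form `x² - x y + (1 - D) / 4 y²` of discriminant `D`. -/
def baseForm (D : ℕ) : QForm := ⟨1, -1, (1 - D) / 4⟩

theorem baseForm_disc (hD4 : D % 4 = 1) : (baseForm D).disc = D := by
  simp only [baseForm, QForm.disc]
  omega

theorem exists_nat_dvd_iff (H : AddSubgroup ℤ) {x : ℤ} (hx : x ∈ H) (hx0 : x ≠ 0) :
    ∃ n : ℤ, 0 < n ∧ ∀ y, y ∈ H ↔ n ∣ y := by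
  obtain ⟨n, hn⟩ := Int.subgroup_cyclic H
  have h : ∀ y, y ∈ H ↔ |n| ∣ y := by
    intro y
    rw [hn, AddSubgroup.mem_closure_singleton, abs_dvd]
    constructor
    · rintro ⟨k, rfl⟩; exact ⟨k, by rw [smul_eq_mul, mul_comm]⟩
    · rintro ⟨k, rfl⟩; exact ⟨k, by rw [smul_eq_mul, mul_comm]⟩
  refine ⟨|n|, abs_pos.mpr ?_, h⟩
  rintro rfl
  have := (h x).mp hx
  simp at this
  exact hx0 this

variable (hδ : δ ^ 2 = (D : K)) (hDsq : Squarefree D) (hD4 : D % 4 = 1) (hD : ¬ IsSquare D)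
  (hK : Module.finrank ℚ K = 2)

include hδ hDsq hD4 hD hK in
/-- Every nonzero ideal is a positive integer multiple of the ideal of a form with `A > 0`. -/
theorem exists_form_of_ideal (J : Ideal (𝓞 K)) (hJ : J ≠ ⊥) :
    ∃ (Q : QForm) (_ : Q.disc = D) (m : ℤ), 0 < m ∧ 0 < Q.A ∧
      ∀ x : K, (∃ z ∈ J, algebraMap (𝓞 K) K z = x) ↔
        ∃ k l : ℤ, x = (2 * (Q.A : K) * k + (-(Q.B : K) + δ) * l) * (m / 2) := by
  have hQ := baseForm_disc hD4
  set ω := theta hδ hQ with hω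
  have hB : ((baseForm D).B : 𝓞 K) = -1 := by simp [baseForm]
  have hωω : ω * ω = ω - ((baseForm D).C : 𝓞 K) := by
    have := theta_mul_theta hδ hQ
    rw [this, hB]
    simp [baseForm, hω]
  set e : ℤ := (baseForm D).C with he
  have he4 : 4 * e = 1 - D := by
    have := hQ
    simp only [baseForm, QForm.disc] at this he
    rw [he]; linarith
  obtain ⟨N, hN0, hNJ⟩ : ∃ N : ℤ, N ≠ 0 ∧ (N : 𝓞 K) ∈ J := by
    refine ⟨Ideal.absNorm J, ?_, by simpa using Ideal.absNorm_mem J⟩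
    rw [Ne, Int.natCast_eq_zero, Ideal.absNorm_eq_zero_iff]
    exact hJ
  -- Hermite normal form of `J` in the basis `1, ω`: `S` collects the `ω`-coordinates and `R` is `J
  -- ∩ ℤ`. Their positive generators `m` and `m n'` yield the basis `m n'`, `m (a + ω)` of `J`.
  let S : AddSubgroup ℤ :=
    { carrier := {b | ∃ a : ℤ, (a : 𝓞 K) + b * ω ∈ J}
      zero_mem' := ⟨0, by simp⟩
      add_mem' := by
        rintro b b' ⟨a, h⟩ ⟨a', h'⟩
        refine ⟨a + a', ?_⟩
        convert! J.add_mem h h' using 1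
        push_cast; ring
      neg_mem' := by
        rintro b ⟨a, h⟩
        refine ⟨-a, ?_⟩
        convert! J.neg_mem h using 1
        push_cast; ring }
  let R : AddSubgroup ℤ := J.toAddSubgroup.comap (Int.castAddHom (𝓞 K))
  have hmulω : ∀ a b : ℤ, (a : 𝓞 K) + b * ω ∈ J →
      ((-(b * e) : ℤ) : 𝓞 K) + ((a + b : ℤ) : 𝓞 K) * ω ∈ J := by
    intro a b h
    convert! J.mul_mem_left ω h using 1
    push_cast
    linear_combination (-(b : 𝓞 K)) * hωω
  obtain ⟨m, hm, hmS⟩ := exists_nat_dvd_iff S (x := N)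
    ⟨0, by simpa using J.mul_mem_right ω hNJ⟩ hN0
  obtain ⟨n, hn, hnR⟩ := exists_nat_dvd_iff R (x := N) hNJ hN0
  have hnJ : (n : 𝓞 K) ∈ J := (hnR n).mpr dvd_rfl
  obtain ⟨n', rfl⟩ : m ∣ n := (hmS n).mp ⟨0, by simpa using J.mul_mem_right ω hnJ⟩
  obtain ⟨a₀, ha₀⟩ := (hmS m).mpr dvd_rfl
  -- The product `ω (a₀ + m ω)` lies in `J` and has `ω`-coordinate `a₀ + m`.
  obtain ⟨a, rfl⟩ : m ∣ a₀ := by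
    have := (hmS _).mp ⟨_, hmulω _ _ ha₀⟩
    rwa [dvd_add_left dvd_rfl] at this
  have hn' : 0 < n' := pos_of_mul_pos_right hn hm.le
  -- Multiplying `m (a + ω)` by the conjugate `a + 1 - ω` of `a + ω` gives the integer `m (a² + a +
  -- e)` of `J`. The quotient by `n'` is the third coefficient of the form, and `-(2a + 1)` is
  -- chosen as `B` so that `(-B + δ) / 2 = a + ω`.
  have hdvd : n' ∣ a * a + a + e := by
    have h1 := J.mul_mem_left ((a + 1 : 𝓞 K) - ω) ha₀
    have h2 : ((m * (a * a + a + e) : ℤ) : 𝓞 K) ∈ J := by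
      convert! h1 using 1
      push_cast
      linear_combination (m : 𝓞 K) * hωω
    exact Int.dvd_of_mul_dvd_mul_left hm.ne' ((hnR _).mp h2)
  obtain ⟨C, hC⟩ := hdvd
  have hdisc : (⟨n', -(2 * a + 1), C⟩ : QForm).disc = D := by
    simp only [QForm.disc]
    linear_combination 4 * hC - he4
  refine ⟨⟨n', -(2 * a + 1), C⟩, hdisc, m, hm, hn', ?_⟩
  have hωK : algebraMap (𝓞 K) K ω = (1 + δ) / 2 := by
    rw [hω, coe_theta]; simp [baseForm]
  intro x
  constructor
  · rintro ⟨z, hz, rfl⟩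
    obtain ⟨i, j, rfl⟩ := exists_int_add_theta hδ hQ hDsq hD4 hD hK z
    obtain ⟨l, rfl⟩ := (hmS j).mp ⟨i, hz⟩
    have h3 : ((i - l * (m * a) : ℤ) : 𝓞 K) ∈ J := by
      convert! J.sub_mem hz (J.mul_mem_left (l : 𝓞 K) ha₀) using 1
      push_cast; ring
    obtain ⟨k, hk⟩ := (hnR _).mp h3
    refine ⟨k, l, ?_⟩
    have hi : i = m * n' * k + l * (m * a) := by linarith
    rw [← hω, hi]
    simp only [map_add, map_mul, map_intCast, hωK]
    push_cast
    ring
  · rintro ⟨k, l, rfl⟩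
    refine ⟨(k : 𝓞 K) * ((m * n' : ℤ) : 𝓞 K) + (l : 𝓞 K) * (((m * a : ℤ) : 𝓞 K) + m * ω),
      J.add_mem (J.mul_mem_left _ hnJ) (J.mul_mem_left _ ha₀), ?_⟩
    simp only [map_add, map_mul, map_intCast, hωK]
    push_cast
    ring

include hδ hDsq hD4 hD hK in
theorem exists_form_hasClass (β : NarrowClassGroup K) :
    ∃ Q : QForm, Q.disc = D ∧ Q.HasClass δ β := by
  obtain ⟨J, rfl⟩ := exists_integral_narrow β
  obtain ⟨Q, hQ, m, hm, hA, h⟩ := exists_form_of_ideal hδ hDsq hD4 hD hK J.1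
    (nonZeroDivisors.ne_zero J.2)
  have hm' : (m : K) / 2 ≠ 0 := div_ne_zero (by exact_mod_cast hm.ne') two_ne_zero
  refine ⟨Q, hQ, Units.mk0 _ hm', FractionalIdeal.mk0 K J, ?_, ?_, rfl⟩
  · rw [sign_pos hA, Units.val_mk0]
    apply sign_pos
    have := norm_rat_coords hD hK hδ (m / 2) 0
    push_cast at this
    rw [zero_mul, add_zero] at this
    rw [this]
    have : (0 : ℚ) < m := by exact_mod_cast hm
    have : (0 : ℚ) < (m / 2) ^ 2 := by positivity
    linarith
  · intro x
    rw [FractionalIdeal.coe_mk0, FractionalIdeal.mem_coeIdeal, Units.val_mk0, ← h x]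

/-- The narrow class of the principal ideal `(δ)`. -/
def deltaClass (hδ0 : δ ≠ 0) : NarrowClassGroup K :=
  QuotientGroup.mk (toPrincipalIdeal (𝓞 K) K (Units.mk0 δ hδ0))

theorem toWide_deltaClass (hδ0 : δ ≠ 0) : toWide (deltaClass hδ0) = 1 := by
  change ClassGroup.mk (R := 𝓞 K) (K := K) (toPrincipalIdeal (𝓞 K) K (Units.mk0 δ hδ0)) = _
  rw [ClassGroup.mk_eq_one_iff, coe_toPrincipalIdeal]
  exact ⟨⟨δ, by simp⟩⟩

include hδ hD hK in
theorem norm_delta_neg : Algebra.norm ℚ δ < 0 := by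
  rw [norm_delta hδ hD hK]
  have hpos : 0 < D := Nat.pos_of_ne_zero (by rintro rfl; exact hD ⟨0, rfl⟩)
  simpa using hpos

include hD hK hδ in
-- A class in the kernel of `toWide` is that of some `(y)`. It is decided by the sign of the norm of
-- `y`, and `δ` realizes the negative sign.
theorem eq_one_or_eq_deltaClass (hδ0 : δ ≠ 0) {β : NarrowClassGroup K} (h : toWide β = 1) :
    β = 1 ∨ β = deltaClass hδ0 := by
  obtain ⟨I, rfl⟩ := QuotientGroup.mk_surjective β
  change ClassGroup.mk (R := 𝓞 K) (K := K) I = 1 at h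
  rw [ClassGroup.mk_eq_one_iff] at h
  obtain ⟨y, hy⟩ := h.principal
  have hyI : FractionalIdeal.spanSingleton (𝓞 K)⁰ y = (I : FractionalIdeal (𝓞 K)⁰ K) := by
    apply FractionalIdeal.coeToSubmodule_injective
    simpa only [FractionalIdeal.coe_spanSingleton] using hy.symm
  have hy0 : y ≠ 0 := by
    rintro rfl
    apply I.ne_zero
    rw [← hyI, FractionalIdeal.spanSingleton_zero]
  have hI : toPrincipalIdeal (𝓞 K) K (Units.mk0 y hy0) = I := toPrincipalIdeal_eq_iff.mpr hyI
  have hn0 : Algebra.norm ℚ y ≠ 0 := by rwa [Ne, Algebra.norm_eq_zero_iff]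
  rcases lt_or_gt_of_ne hn0 with hn | hn
  · right
    rw [deltaClass, QuotientGroup.eq]
    refine ⟨(Units.mk0 y hy0)⁻¹ * Units.mk0 δ hδ0, ?_, by rw [map_mul, map_inv, hI]⟩
    change 0 < Algebra.norm ℚ (((Units.mk0 y hy0)⁻¹ * Units.mk0 δ hδ0 : Kˣ) : K)
    rw [Units.val_mul, Units.val_inv_eq_inv_val, map_mul, Units.val_mk0, Units.val_mk0]
    have hinv : Algebra.norm ℚ y⁻¹ * Algebra.norm ℚ y = 1 := by
      rw [← map_mul, inv_mul_cancel₀ hy0, map_one]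
    rcases mul_pos_iff.mp (hinv ▸ one_pos) with h1 | h1
    · exact absurd h1.2 hn.not_gt
    · exact mul_pos_of_neg_of_neg h1.1 (norm_delta_neg hδ hD hK)
  · left
    rw [QuotientGroup.eq_one_iff]
    exact ⟨Units.mk0 y hy0, hn, hI⟩

include hD hK hδ in
-- Two generators of `(δ)` differ by a unit, so a generator of positive norm exists exactly when
-- some unit has negative norm. This links the splitting of wide classes to the index of `ε^ℤ` in
-- the units.
theorem deltaClass_eq_one_iff (hδ0 : δ ≠ 0) : deltaClass hδ0 = 1 ↔
    ∃ η : (𝓞 K)ˣ, Algebra.norm ℚ ((η : 𝓞 K) : K) < 0 := by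
  have hdn := norm_delta_neg hδ hD hK
  rw [deltaClass, QuotientGroup.eq_one_iff]
  constructor
  · rintro ⟨y, hy, h⟩
    have hy' : 0 < Algebra.norm ℚ (y : K) := hy
    rw [toPrincipalIdeal_eq_iff, coe_toPrincipalIdeal,
      FractionalIdeal.spanSingleton_eq_spanSingleton] at h
    obtain ⟨η, hη⟩ := h
    refine ⟨η, ?_⟩
    have h2 : ((η : 𝓞 K) : K) * y = δ := by
      rw [← Algebra.smul_def]; exact hη
    rw [← h2, map_mul] at hdn
    exact neg_of_mul_neg_left hdn hy'.le
  · rintro ⟨η, hη⟩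
    have hη0 : ((η : 𝓞 K) : K) ≠ 0 := by
      intro h; rw [h] at hη; simp at hη
    refine ⟨Units.mk0 _ hη0 * Units.mk0 δ hδ0, ?_, ?_⟩
    · change 0 < Algebra.norm ℚ (((η : 𝓞 K) : K) * δ)
      rw [map_mul]
      exact mul_pos_of_neg_of_neg hη hdn
    · rw [toPrincipalIdeal_eq_iff, coe_toPrincipalIdeal,
        FractionalIdeal.spanSingleton_eq_spanSingleton]
      refine ⟨η⁻¹, ?_⟩
      rw [Units.smul_def, Algebra.smul_def, Units.val_mul, Units.val_mk0, ← mul_assoc, ← map_mul,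
        Units.inv_mul, map_one, one_mul]

theorem toWide_surjective : Function.Surjective (toWide (K := K)) := by
  intro α
  obtain ⟨J, rfl⟩ := ClassGroup.mk0_surjective α
  exact ⟨QuotientGroup.mk (FractionalIdeal.mk0 K J), ClassGroup.mk_mk0 K J⟩

include hD hK hδ in
theorem exists_fiber_eq (hδ0 : δ ≠ 0) (α : ClassGroup (𝓞 K)) :
    ∃ β₀ : NarrowClassGroup K, {β : NarrowClassGroup K | toWide β = α} =
      {β₀, β₀ * deltaClass hδ0} := by
  obtain ⟨β₀, rfl⟩ := toWide_surjective α
  refine ⟨β₀, ?_⟩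
  ext β
  simp only [Set.mem_ofPred_eq, Set.mem_insert_iff, Set.mem_singleton_iff]
  constructor
  · intro h
    rcases eq_one_or_eq_deltaClass hδ hD hK hδ0 (β := β₀⁻¹ * β) (by simp [h]) with h | h
    · left; rw [inv_mul_eq_one] at h; exact h.symm
    · right; rw [← h, mul_inv_cancel_left]
  · rintro (rfl | rfl)
    · rfl
    · rw [map_mul, toWide_deltaClass, mul_one]

theorem narrow_mul_eq_left (a b : NarrowClassGroup K) : a * b = a ↔ b = 1 := by
  constructor
  · intro h
    have h1 := inv_mul_cancel_left a b
    rw [h, inv_mul_cancel] at h1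
    exact h1.symm
  · rintro rfl
    exact mul_one a

include hδ hD hK in
theorem ncard_fiber_of_exists (h : ∃ η : (𝓞 K)ˣ, Algebra.norm ℚ ((η : 𝓞 K) : K) < 0)
    (α : ClassGroup (𝓞 K)) : {β : NarrowClassGroup K | toWide β = α}.ncard = 1 := by
  have hδ0 := delta_ne_zero hδ hD
  obtain ⟨β₀, h0⟩ := exists_fiber_eq hδ hD hK hδ0 α
  have h1 : β₀ * deltaClass hδ0 = β₀ := (narrow_mul_eq_left _ _).mpr ((deltaClass_eq_one_iff hδ hD hK hδ0).mpr h)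
  rw [h0, h1, Set.pair_eq_singleton, Set.ncard_singleton]

include hδ hD hK in
theorem ncard_fiber_of_forall (h : ∀ η : (𝓞 K)ˣ, ¬ Algebra.norm ℚ ((η : 𝓞 K) : K) < 0)
    (α : ClassGroup (𝓞 K)) : {β : NarrowClassGroup K | toWide β = α}.ncard = 2 := by
  have hδ0 := delta_ne_zero hδ hD
  obtain ⟨β₀, h0⟩ := exists_fiber_eq hδ hD hK hδ0 α
  rw [h0, Set.ncard_pair]
  intro h1
  obtain ⟨η, hη⟩ := (deltaClass_eq_one_iff hδ hD hK hδ0).mp ((narrow_mul_eq_left _ _).mp h1.symm)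
  exact h η hη

end NarrowClasses

/-! ### The summands in terms of `(c, d)`; convergence and holomorphy. -/

section Summands

/-- The value of `φ(g z, g Q)` in terms of the bottom row `v` of `g`. -/
def rowPhi (Q : QForm) (z : ℂ) (v : Fin 2 → ℤ) : ℂ :=
  Q.eval z / (((v 0 : ℂ) * z + v 1) * (Q.evalDeriv z * v 1 - (Q.B * z + 2 * Q.C) * v 0))

theorem slash_inv_eq (Q : QForm) (g : SL(2, ℤ)) : Q.act g =
    ⟨Q.A * g 1 1 ^ 2 - Q.B * g 1 1 * g 1 0 + Q.C * g 1 0 ^ 2,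
     -2 * Q.A * g 1 1 * g 0 1 + Q.B * (g 0 0 * g 1 1 + g 0 1 * g 1 0) - 2 * Q.C * g 1 0 * g 0 0,
     Q.A * g 0 1 ^ 2 - Q.B * g 0 1 * g 0 0 + Q.C * g 0 0 ^ 2⟩ := by
  have h := Matrix.SpecialLinearGroup.SL2_inv_expl g
  ext <;> simp [QForm.act, QForm.slash, h] <;> ring

theorem disc_act (Q : QForm) (g : SL(2, ℤ)) : (Q.act g).disc = Q.disc := by
  have hdet := Matrix.det_fin_two (g : Matrix (Fin 2) (Fin 2) ℤ)
  rw [g.det_coe] at hdet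
  rw [slash_inv_eq]
  simp only [QForm.disc]
  linear_combination (-(Q.B ^ 2 - 4 * Q.A * Q.C) *
    (g 0 0 * g 1 1 - g 0 1 * g 1 0 + 1)) * hdet

theorem coe_smul_eq (g : SL(2, ℤ)) (z : ℍ) :
    (↑(g • z) : ℂ) = ((g 0 0 : ℂ) * z + g 0 1) / ((g 1 0 : ℂ) * z + g 1 1) := by
  rw [UpperHalfPlane.specialLinearGroup_apply]
  simp

theorem row_ne_zero {z : ℂ} (hz : 0 < z.im) {x : Fin 2 → ℝ} (hx : x ≠ 0) :
    (x 0 : ℂ) * z + x 1 ≠ 0 := by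
  intro h
  have him := congrArg Complex.im h
  have hre := congrArg Complex.re h
  simp at him hre
  have h0 : x 0 = 0 := by
    rcases him with h | h
    · exact h
    · exact absurd h hz.ne'
  rw [h0] at hre
  apply hx
  ext i; fin_cases i
  · exact h0
  · simpa using hre

theorem row_coe_ne_zero (g : SL(2, ℤ)) (z : ℍ) : (g 1 0 : ℂ) * z + g 1 1 ≠ 0 := by
  have hdet := Matrix.det_fin_two (g : Matrix (Fin 2) (Fin 2) ℤ)
  rw [g.det_coe] at hdet
  have := row_ne_zero z.im_pos (x := fun i => (g 1 i : ℝ)) (by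
    intro h
    have h0 := congrFun h 0
    have h1 := congrFun h 1
    simp at h0 h1
    rw [h0, h1] at hdet
    simp at hdet)
  simpa using this

theorem eval_act_smul (Q : QForm) (g : SL(2, ℤ)) (z : ℍ) :
    (Q.act g).eval (↑(g • z)) = Q.eval z / ((g 1 0 : ℂ) * z + g 1 1) ^ 2 := by
  have hdet := Matrix.det_fin_two (g : Matrix (Fin 2) (Fin 2) ℤ)
  rw [g.det_coe] at hdet
  have hdet' := congrArg (Int.cast (R := ℂ)) hdet
  push_cast at hdet'
  have hw := row_coe_ne_zero g z
  rw [coe_smul_eq, slash_inv_eq]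
  simp only [QForm.eval]
  push_cast
  field_simp
  linear_combination (-(Q.A * (z : ℂ) ^ 2 + Q.B * z + Q.C) *
    ((g 0 0 : ℂ) * g 1 1 - g 0 1 * g 1 0 + 1)) * hdet'

theorem evalDeriv_act_smul (Q : QForm) (g : SL(2, ℤ)) (z : ℍ) :
    (Q.act g).evalDeriv (↑(g • z)) =
      (Q.evalDeriv z * g 1 1 - (Q.B * z + 2 * Q.C) * g 1 0) / ((g 1 0 : ℂ) * z + g 1 1) := by
  have hdet := Matrix.det_fin_two (g : Matrix (Fin 2) (Fin 2) ℤ)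
  rw [g.det_coe] at hdet
  have hdet' := congrArg (Int.cast (R := ℂ)) hdet
  push_cast at hdet'
  have hw := row_coe_ne_zero g z
  rw [coe_smul_eq, slash_inv_eq]
  simp only [QForm.evalDeriv]
  push_cast
  field_simp
  linear_combination (-((2 * Q.A * (z : ℂ) + Q.B) * g 1 1 - (Q.B * z + 2 * Q.C) * g 1 0)) * hdet'

/-- Under `g`, `Q(z)` acquires the factor `(cz + d)^{-2}`, and the derivative at `gz` is a
combination of `Q'(z)` and `Bz + 2C` over `cz + d`. Both involve only the bottom row. -/
theorem phi_smul_act (Q : QForm) (g : SL(2, ℤ)) (z : ℍ) :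
    phi (↑(g • z) : ℂ) (Q.act g) = rowPhi Q z (g 1) := by
  have h3 : ∀ x y w : ℂ, w ≠ 0 → x / w ^ 2 / (y / w) = x / (w * y) := by
    intro x y w hw
    rcases eq_or_ne y 0 with rfl | hy
    · simp
    · field_simp
  rw [phi, rowPhi, eval_act_smul, evalDeriv_act_smul, h3 _ _ _ (row_coe_ne_zero g z)]

/-- Keeps the summands away from the cut of the principal power. Up to the positive factor
`|Q'(z)|^{-2}`, the imaginary part is a sum of terms that are nonnegative when the discriminant is
positive. -/
theorem phi_im_pos {Q : QForm} (hQ : 0 < Q.disc) {z : ℂ} (hz : 0 < z.im) : 0 < (phi z Q).im := by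
  have hd : (0 : ℝ) < (Q.B : ℝ) ^ 2 - 4 * Q.A * Q.C := by
    have : ((0 : ℤ) : ℝ) < ((Q.B ^ 2 - 4 * Q.A * Q.C : ℤ) : ℝ) := by exact_mod_cast hQ
    push_cast at this
    exact this
  have hne : Q.evalDeriv z ≠ 0 := by
    intro h
    have him := congrArg Complex.im h
    have hre := congrArg Complex.re h
    simp [QForm.evalDeriv, hz.ne'] at him hre
    rw [him] at hre hd
    simp at hre
    rw [hre] at hd
    simp at hd
  have h0 : 0 < Complex.normSq (Q.evalDeriv z) := Complex.normSq_pos.mpr hne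
  rw [phi, Complex.div_im, ← sub_div]
  apply div_pos _ h0
  simp [QForm.eval, QForm.evalDeriv, pow_two]
  have : 0 < z.im * (2 * (Q.A * z.im) ^ 2 + (2 * Q.A * z.re + Q.B) ^ 2 / 2 +
      ((Q.B : ℝ) ^ 2 - 4 * Q.A * Q.C) / 2) := by positivity
  linarith

/-- The second factor is linear in `z` with real coefficients, which vanish together only if `x` is
killed by a matrix of determinant `± disc`. Real `x` are allowed so that the modulus can be
minimized over the unit sphere. -/
theorem rowDenom_ne_zero {Q : QForm} (hQ : Q.disc ≠ 0) {z : ℂ} (hz : 0 < z.im) {x : Fin 2 → ℝ}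
    (hx : x ≠ 0) :
    ((x 0 : ℂ) * z + x 1) * (Q.evalDeriv z * x 1 - (Q.B * z + 2 * Q.C) * x 0) ≠ 0 := by
  refine mul_ne_zero (row_ne_zero hz hx) fun h => hx ?_
  have him := congrArg Complex.im h
  have hre := congrArg Complex.re h
  simp [QForm.evalDeriv] at him hre
  have h1 : 2 * Q.A * x 1 - Q.B * x 0 = 0 := by
    have : (2 * Q.A * x 1 - Q.B * x 0) * z.im = 0 := by linarith
    exact (mul_eq_zero.mp this).resolve_right hz.ne'
  have h2 : Q.B * x 1 - 2 * Q.C * x 0 = 0 := by linear_combination hre - z.re * h1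
  have hd : ((Q.B : ℝ) ^ 2 - 4 * Q.A * Q.C) ≠ 0 := by
    have : ((Q.B ^ 2 - 4 * Q.A * Q.C : ℤ) : ℝ) ≠ 0 := by exact_mod_cast hQ
    push_cast at this
    exact this
  ext i
  fin_cases i
  · apply (mul_eq_zero.mp (_ : ((Q.B : ℝ) ^ 2 - 4 * Q.A * Q.C) * x 0 = 0)).resolve_left hd
    linear_combination 2 * (Q.A : ℝ) * h2 - (Q.B : ℝ) * h1
  · apply (mul_eq_zero.mp (_ : ((Q.B : ℝ) ^ 2 - 4 * Q.A * Q.C) * x 1 = 0)).resolve_left hd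
    linear_combination (Q.B : ℝ) * h2 - 2 * (Q.C : ℝ) * h1

theorem norm_intCast_vec (v : Fin 2 → ℤ) : ‖(fun i => (v i : ℝ))‖ = ‖v‖ := by
  simp [Pi.norm_def, Int.norm_eq_abs, nnnorm, Real.norm_eq_abs]

/-- The denominator is homogeneous of degree 2 in `v`, so it is at least `κ ‖v‖²`, where `κ > 0` is
its minimum modulus over the compact product of `S` and the unit sphere. -/
theorem exists_rowPhi_bound {Q : QForm} (hQ : Q.disc ≠ 0) {S : Set ℂ} (hS : IsCompact S)
    (hS' : ∀ z ∈ S, 0 < z.im) :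
    ∃ M : ℝ, 0 ≤ M ∧ ∀ z ∈ S, ∀ v : Fin 2 → ℤ, ‖rowPhi Q z v‖ ≤ M * ‖v‖ ^ (-2 : ℝ) := by
  rcases S.eq_empty_or_nonempty with rfl | hne
  · exact ⟨0, le_rfl, by simp⟩
  obtain ⟨C, hC⟩ := hS.exists_bound_of_continuousOn (f := fun z => Q.eval z)
    (by unfold QForm.eval; fun_prop)
  have hcomp := hS.prod (isCompact_sphere (0 : Fin 2 → ℝ) 1)
  have hsne : (Metric.sphere (0 : Fin 2 → ℝ) 1).Nonempty := NormedSpace.sphere_nonempty.mpr zero_le_one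
  obtain ⟨p, hp, hmin⟩ := hcomp.exists_isMinOn (hne.prod hsne)
    (f := fun p : ℂ × (Fin 2 → ℝ) =>
      ‖((p.2 0 : ℂ) * p.1 + p.2 1) *
        (Q.evalDeriv p.1 * p.2 1 - (Q.B * p.1 + 2 * Q.C) * p.2 0)‖)
    (by unfold QForm.evalDeriv; fun_prop)
  have hp0 : p.2 ≠ 0 := by
    intro h
    have := hp.2
    rw [h] at this
    simp at this
  set κ := ‖((p.2 0 : ℂ) * p.1 + p.2 1) *
        (Q.evalDeriv p.1 * p.2 1 - (Q.B * p.1 + 2 * Q.C) * p.2 0)‖ with hκdef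
  have hκ : 0 < κ := norm_pos_iff.mpr (rowDenom_ne_zero hQ (hS' _ hp.1) hp0)
  have hC0 : 0 ≤ C := (norm_nonneg _).trans (hC _ hp.1)
  refine ⟨C / κ, by positivity, fun z hz v => ?_⟩
  -- For `v = 0` the left side is zero by the convention for division by zero.
  by_cases hv : v = 0
  · simp only [hv, rowPhi]; simp
  have hv0 : 0 < ‖v‖ := norm_pos_iff.mpr hv
  have hmin' := hmin (a := (z, fun i => ‖v‖⁻¹ * (v i : ℝ))) ⟨hz, by
    have : (fun i => ‖v‖⁻¹ * (v i : ℝ)) = ‖v‖⁻¹ • (fun i => (v i : ℝ)) := rfl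
    rw [mem_sphere_zero_iff_norm, this, norm_smul, norm_intCast_vec, norm_inv, norm_norm,
      inv_mul_cancel₀ hv0.ne']⟩
  have heq : (((‖v‖⁻¹ * (v 0 : ℝ) : ℝ) : ℂ) * z + ((‖v‖⁻¹ * (v 1 : ℝ) : ℝ) : ℂ)) *
        (Q.evalDeriv z * ((‖v‖⁻¹ * (v 1 : ℝ) : ℝ) : ℂ) -
          (Q.B * z + 2 * Q.C) * ((‖v‖⁻¹ * (v 0 : ℝ) : ℝ) : ℂ)) =
      ((‖v‖⁻¹ ^ 2 : ℝ) : ℂ) * (((v 0 : ℂ) * z + v 1) *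
        (Q.evalDeriv z * v 1 - (Q.B * z + 2 * Q.C) * v 0)) := by
    push_cast; ring
  have hmin2 : κ ≤ ‖v‖⁻¹ ^ 2 * ‖((v 0 : ℂ) * z + v 1) *
      (Q.evalDeriv z * v 1 - (Q.B * z + 2 * Q.C) * v 0)‖ := by
    have h1 : κ ≤ ‖_‖ := hmin'
    refine h1.trans_eq ?_
    rw [← Complex.norm_of_nonneg (r := ‖v‖⁻¹ ^ 2) (by positivity), ← norm_mul]
    exact congrArg norm heq
  have hden : 0 < ‖((v 0 : ℂ) * z + v 1) *
      (Q.evalDeriv z * v 1 - (Q.B * z + 2 * Q.C) * v 0)‖ := by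
    refine pos_of_mul_pos_right (hκ.trans_le hmin2) (by positivity)
  rw [rowPhi, norm_div, Real.rpow_neg hv0.le, Real.rpow_two, ← div_eq_mul_inv, div_div]
  apply div_le_div₀ hC0 (hC z hz) (by positivity)
  calc κ * ‖v‖ ^ 2 ≤ ‖v‖⁻¹ ^ 2 * _ * ‖v‖ ^ 2 := by gcongr
    _ = _ := by field_simp

theorem norm_cpow_le_mul (w s : ℂ) :
    ‖w ^ s‖ ≤ Real.exp (Real.pi * |s.im|) * ‖w‖ ^ s.re := by
  refine (Complex.norm_cpow_le w s).trans ?_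
  rw [div_eq_mul_inv, ← Real.exp_neg, mul_comm]
  gcongr
  calc -(w.arg * s.im) ≤ |w.arg * s.im| := neg_le_abs _
    _ = |w.arg| * |s.im| := abs_mul _ _
    _ ≤ Real.pi * |s.im| := by gcongr; exact Complex.abs_arg_le_pi w

theorem exists_rowPhi_cpow_bound {Q : QForm} (hQ : Q.disc ≠ 0) {s : ℂ} (hs : 0 < s.re)
    {S : Set ℂ} (hS : IsCompact S) (hS' : ∀ z ∈ S, 0 < z.im) :
    ∃ M : ℝ, ∀ z ∈ S, ∀ v : Fin 2 → ℤ, ‖rowPhi Q z v ^ s‖ ≤ M * ‖v‖ ^ (-(2 * s.re)) := by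
  obtain ⟨M, hM, h⟩ := exists_rowPhi_bound hQ hS hS'
  refine ⟨Real.exp (Real.pi * |s.im|) * M ^ s.re, fun z hz v => ?_⟩
  refine (norm_cpow_le_mul _ _).trans ?_
  rw [mul_assoc]
  gcongr
  refine (Real.rpow_le_rpow (norm_nonneg _) (h z hz v) hs.le).trans_eq ?_
  rw [Real.mul_rpow hM (by positivity), ← Real.rpow_mul (norm_nonneg _), neg_mul]

theorem summable_norm_rpow_vec {s : ℂ} (hs : 1 < s.re) :
    Summable fun v : Fin 2 → ℤ => ‖v‖ ^ (-(2 * s.re)) :=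
  EisensteinSeries.summable_one_div_norm_rpow (by linarith)

theorem summable_rowPhi_cpow {Q : QForm} (hQ : Q.disc ≠ 0) {s : ℂ} (hs : 1 < s.re) {z : ℂ}
    (hz : 0 < z.im) : Summable fun v : Fin 2 → ℤ => rowPhi Q z v ^ s := by
  obtain ⟨M, hM⟩ := exists_rowPhi_cpow_bound hQ (zero_lt_one.trans hs)
    (isCompact_singleton (x := z)) (by rintro _ rfl; exact hz)
  exact Summable.of_norm_bounded ((summable_norm_rpow_vec hs).mul_left M) (hM z rfl)

open ModularGroup in
-- For equal bottom rows, `h g⁻¹` is upper triangular with unit diagonal, and its upper right entry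
-- is the exponent.
theorem eq_T_zpow_mul_of_row_eq {g h : SL(2, ℤ)} (H : g 1 = h 1) :
    ∃ n : ℤ, h = T ^ n * g := by
  refine ⟨(h * g⁻¹) 0 1, ?_⟩
  rw [← mul_inv_eq_iff_eq_mul]
  have hg := Matrix.det_fin_two (g : Matrix (Fin 2) (Fin 2) ℤ)
  have hh := Matrix.det_fin_two (h : Matrix (Fin 2) (Fin 2) ℤ)
  rw [g.det_coe] at hg
  rw [h.det_coe] at hh
  have e0 : g 1 0 = h 1 0 := congrFun H 0
  have e1 : g 1 1 = h 1 1 := congrFun H 1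
  have hi := Matrix.SpecialLinearGroup.SL2_inv_expl g
  have i00 : g⁻¹ 0 0 = g 1 1 := by rw [hi]; rfl
  have i01 : g⁻¹ 0 1 = -g 0 1 := by rw [hi]; rfl
  have i10 : g⁻¹ 1 0 = -g 1 0 := by rw [hi]; rfl
  have i11 : g⁻¹ 1 1 = g 0 0 := by rw [hi]; rfl
  have m : ∀ i j, (h * g⁻¹) i j = h i 0 * g⁻¹ 0 j + h i 1 * g⁻¹ 1 j := by
    intro i j
    rw [Matrix.SpecialLinearGroup.coe_mul, Matrix.mul_apply, Fin.sum_univ_two]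
  have m00 : (h * g⁻¹) 0 0 = 1 := by rw [m, i00, i10, e0, e1]; linarith
  have m10 : (h * g⁻¹) 1 0 = 0 := by rw [m, i00, i10, e0, e1]; ring
  have m11 : (h * g⁻¹) 1 1 = 1 := by rw [m, i01, i11, ← e0, ← e1]; linarith
  ext i j
  rw [coe_T_zpow]
  fin_cases i <;> fin_cases j
  · exact m00
  · rfl
  · exact m10
  · exact m11

open ModularGroup in
theorem T_zpow_mul_row (n : ℤ) (g : SL(2, ℤ)) : (T ^ n * g) 1 = g 1 := by
  ext j
  simp

/-- The cosets of `⟨T⟩` correspond to the coprime pairs. -/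
def cosetEquiv : Quotient (QuotientGroup.rightRel (Subgroup.zpowers ModularGroup.T)) ≃
    EisensteinSeries.gammaSet 1 1 0 :=
  Equiv.ofBijective
    (Quotient.lift (fun g => ⟨g 1, (EisensteinSeries.mem_gammaSet_one _).mpr
        (ModularGroup.bottom_row_coprime g)⟩) (by
      intro a b hab
      obtain ⟨n, hn⟩ := QuotientGroup.rightRel_apply.mp hab
      apply Subtype.ext
      change a 1 = b 1
      have : b = ModularGroup.T ^ n * a := by rw [← mul_inv_eq_iff_eq_mul]; exact hn.symm
      rw [this, T_zpow_mul_row]))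
    (by
      constructor
      · rintro ⟨a⟩ ⟨b⟩ h
        obtain ⟨n, hn⟩ := eq_T_zpow_mul_of_row_eq (congrArg Subtype.val h)
        apply Quotient.sound
        apply QuotientGroup.rightRel_apply.mpr
        exact ⟨n, by rw [hn, mul_inv_cancel_right]⟩
      · rintro ⟨v, hv⟩
        obtain ⟨g, -, hg⟩ := ModularGroup.bottom_row_surj (R := ℤ)
          ((EisensteinSeries.mem_gammaSet_one v).mp hv)
        exact ⟨Quotient.mk _ g, Subtype.ext hg⟩)

theorem cosetSummand_zpowers (hH : Subgroup.zpowers ModularGroup.T ≤ cuspGroup) (s : ℂ)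
    (Q : QForm) (z : ℍ) (x) :
    cosetSummand _ hH s Q z x = rowPhi Q z (cosetEquiv x : Fin 2 → ℤ) ^ s := by
  obtain ⟨g⟩ := x
  change phi (↑(g • z) : ℂ) (Q.act g) ^ s = rowPhi Q z (g 1) ^ s
  rw [phi_smul_act]

theorem summable_cosetSummand_zpowers (hH : Subgroup.zpowers ModularGroup.T ≤ cuspGroup) {s : ℂ}
    (hs : 1 < s.re) {Q : QForm} (hQ : Q.disc ≠ 0) (z : ℍ) : Summable (cosetSummand _ hH s Q z) := by
  simp_rw [funext (cosetSummand_zpowers hH s Q z)]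
  exact cosetEquiv.summable_iff.mpr ((summable_rowPhi_cpow hQ hs z.im_pos).subtype _)

theorem lift_zpowers (hH : Subgroup.zpowers ModularGroup.T ≤ cuspGroup) (s : ℂ)
    (Q : QForm) (z : ℍ) :
    lift _ hH s Q z = ∑' v : EisensteinSeries.gammaSet 1 1 0, rowPhi Q z (v : Fin 2 → ℤ) ^ s := by
  rw [lift, ← cosetEquiv.tsum_eq]
  exact tsum_congr (cosetSummand_zpowers hH s Q z)

theorem rowPhi_im_pos {Q : QForm} (hQ : 0 < Q.disc) {z : ℂ} (hz : 0 < z.im)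
    (v : EisensteinSeries.gammaSet 1 1 0) : 0 < (rowPhi Q z (v : Fin 2 → ℤ)).im := by
  obtain ⟨g, -, hg⟩ := ModularGroup.bottom_row_surj (R := ℤ)
    ((EisensteinSeries.mem_gammaSet_one _).mp v.2)
  have := phi_smul_act Q g ⟨z, hz⟩
  rw [← hg]
  change 0 < (rowPhi Q ((⟨z, hz⟩ : ℍ) : ℂ) (g 1)).im
  rw [← this]
  exact phi_im_pos (by rwa [disc_act]) (UpperHalfPlane.im_pos _)

theorem coprime_ne_zero (v : EisensteinSeries.gammaSet 1 1 0) : (v : Fin 2 → ℤ) ≠ 0 := by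
  intro h
  have := (EisensteinSeries.mem_gammaSet_one _).mp v.2
  rw [h] at this
  simp [isCoprime_zero_left] at this

/-- Locally uniform convergence follows from the bound on a closed disc; each term is holomorphic
because its base lies in the upper half-plane. -/
theorem differentiableOn_lift_zpowers (hH : Subgroup.zpowers ModularGroup.T ≤ cuspGroup) {s : ℂ}
    (hs : 1 < s.re) {Q : QForm} (hQ : 0 < Q.disc) :
    DifferentiableOn ℂ (fun z : ℂ => lift _ hH s Q (UpperHalfPlane.ofComplex z))
      {z : ℂ | 0 < z.im} := by
  have hopen : IsOpen {z : ℂ | 0 < z.im} := isOpen_lt continuous_const Complex.continuous_im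
  intro z₀ hz₀
  obtain ⟨r, hr, hball⟩ := Metric.isOpen_iff.mp hopen z₀ hz₀
  obtain ⟨M, hM⟩ := exists_rowPhi_cpow_bound hQ.ne' (zero_lt_one.trans hs)
    (isCompact_closedBall z₀ (r / 2)) (fun z hz => hball
      (Metric.closedBall_subset_ball (half_lt_self hr) hz))
  have hsub : Metric.ball z₀ (r / 2) ⊆ {z : ℂ | 0 < z.im} :=
    (Metric.ball_subset_ball (half_le_self hr.le)).trans hball
  have hdiff : DifferentiableOn ℂ
      (fun z : ℂ => ∑' v : EisensteinSeries.gammaSet 1 1 0, rowPhi Q z (v : Fin 2 → ℤ) ^ s)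
      (Metric.ball z₀ (r / 2)) := by
    refine Complex.differentiableOn_tsum_of_summable_norm
      (u := fun v : EisensteinSeries.gammaSet 1 1 0 => M * ‖(v : Fin 2 → ℤ)‖ ^ (-(2 * s.re)))
      (((summable_norm_rpow_vec hs).mul_left M).subtype _) ?_ Metric.isOpen_ball
      (fun v z hz => hM z (Metric.ball_subset_closedBall hz) v)
    intro v z hz
    have hz' := hsub hz
    have hden := rowDenom_ne_zero hQ.ne' hz' (x := fun i => ((v : Fin 2 → ℤ) i : ℝ)) (by
      intro h
      apply coprime_ne_zero v
      ext i
      simpa using congrFun h i)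
    apply DifferentiableAt.differentiableWithinAt
    refine DifferentiableAt.cpow ?_ (differentiableAt_const s)
      (Or.inr (rowPhi_im_pos hQ hz' v).ne')
    unfold rowPhi
    refine DifferentiableAt.div ?_ ?_ (by simpa using hden)
    · unfold QForm.eval; fun_prop
    · unfold QForm.evalDeriv; fun_prop
  have hev : (fun z : ℂ => lift _ hH s Q (UpperHalfPlane.ofComplex z)) =ᶠ[nhds z₀]
      (fun z : ℂ => ∑' v : EisensteinSeries.gammaSet 1 1 0, rowPhi Q z (v : Fin 2 → ℤ) ^ s) := by
    filter_upwards [hopen.mem_nhds hz₀] with z hz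
    rw [lift_zpowers, UpperHalfPlane.ofComplex_apply_of_im_pos hz]
  exact ((hdiff.differentiableAt (Metric.ball_mem_nhds z₀ (half_pos hr))).congr_of_eventuallyEq
    hev).differentiableWithinAt

end Summands

/-! ### Comparison of the two normalizations; invariance of `F_Q` under the stabilizer of `Q`. -/

section CuspGroup

open ModularGroup

theorem zpowers_T_le_cuspGroup : Subgroup.zpowers T ≤ cuspGroup := by
  rw [Subgroup.zpowers_le]
  exact Subgroup.subset_closure (Or.inl rfl)

theorem mem_cuspGroup_iff {g : SL(2, ℤ)} :
    g ∈ cuspGroup ↔ g ∈ Subgroup.zpowers T ∨ -g ∈ Subgroup.zpowers T := by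
  constructor
  · intro h
    induction h using Subgroup.closure_induction with
    | mem x hx =>
      rcases hx with rfl | rfl
      · exact Or.inl (Subgroup.mem_zpowers T)
      · right; rw [neg_neg]; exact one_mem _
    | one => exact Or.inl (one_mem _)
    | mul x y _ _ hx hy =>
      rcases hx with hx | hx <;> rcases hy with hy | hy
      · exact Or.inl (mul_mem hx hy)
      · right; rw [← mul_neg]; exact mul_mem hx hy
      · right; rw [← neg_mul]; exact mul_mem hx hy
      · left; rw [← neg_mul_neg]; exact mul_mem hx hy
    | inv x _ hx =>
      rcases hx with hx | hx
      · exact Or.inl (inv_mem hx)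
      · right; have := inv_mem hx; rwa [inv_neg] at this
  · have hneg : (-1 : SL(2, ℤ)) ∈ cuspGroup := Subgroup.subset_closure (Or.inr rfl)
    rintro (h | h)
    · exact zpowers_T_le_cuspGroup h
    · have := mul_mem hneg (zpowers_T_le_cuspGroup h)
      rwa [neg_mul_neg, one_mul] at this

theorem neg_one_notMem_zpowers_T : (-1 : SL(2, ℤ)) ∉ Subgroup.zpowers T := by
  rintro ⟨n, hn⟩
  have := congrArg (fun g : SL(2, ℤ) => g 1 1) hn
  simp [coe_T_zpow] at this

/-- Each coset of `⟨T, -1⟩` is the union of two cosets of `⟨T⟩`. -/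
def cuspCosetEquiv : Quotient (QuotientGroup.rightRel cuspGroup) × Bool ≃
    Quotient (QuotientGroup.rightRel (Subgroup.zpowers T)) :=
  Equiv.ofBijective
    (fun p => Quotient.mk _ (if p.2 then p.1.out else -p.1.out))
    (by
      have hneg : ∀ g : SL(2, ℤ), -g * g⁻¹ = -1 := fun g => by simp
      have hneg' : ∀ g : SL(2, ℤ), g * (-g)⁻¹ = -1 := fun g => by simp [inv_neg]
      constructor
      · rintro ⟨p, b⟩ ⟨q, c⟩ h
        have h1 := QuotientGroup.rightRel_apply.mp (Quotient.exact h)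
        have hpq : p = q := by
          rw [← p.out_eq, ← q.out_eq]
          apply Quotient.sound
          apply QuotientGroup.rightRel_apply.mpr
          rw [mem_cuspGroup_iff]
          cases b <;> cases c <;> simp [inv_neg] at h1 <;> simp [h1]
        subst hpq
        cases b <;> cases c <;> simp only [Bool.false_eq_true, if_true, if_false] at h1
        · rfl
        · rw [hneg'] at h1; exact absurd h1 neg_one_notMem_zpowers_T
        · rw [hneg] at h1; exact absurd h1 neg_one_notMem_zpowers_T
        · rfl
      · rintro ⟨g⟩
        have h1 : g * (Quotient.mk (QuotientGroup.rightRel cuspGroup) g).out⁻¹ ∈ cuspGroup :=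
          QuotientGroup.rightRel_apply.mp (Quotient.mk_out (s := QuotientGroup.rightRel cuspGroup) g)
        rcases mem_cuspGroup_iff.mp h1 with h | h
        · exact ⟨(Quotient.mk _ g, true), Quotient.sound (QuotientGroup.rightRel_apply.mpr h)⟩
        · refine ⟨(Quotient.mk _ g, false), Quotient.sound (QuotientGroup.rightRel_apply.mpr ?_)⟩
          simp only [Bool.false_eq_true, if_false, inv_neg, mul_neg]
          exact h)

theorem cosetSummand_cuspCosetEquiv (s : ℂ) (Q : QForm) (z : ℍ) (p) :
    cosetSummand _ zpowers_T_le_cuspGroup s Q z (cuspCosetEquiv p) =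
      cosetSummand cuspGroup le_rfl s Q z p.1 := by
  obtain ⟨p, b⟩ := p
  have h : cosetSummand cuspGroup le_rfl s Q z p = summand s Q z p.out := by
    conv_lhs => rw [← p.out_eq]
    rfl
  rw [h]
  cases b
  · change summand s Q z (-p.out) = _
    rw [← summand_neg_mul s Q z p.out, neg_one_mul]
  · rfl

theorem summable_cosetSummand_cuspGroup {s : ℂ} (hs : 1 < s.re) {Q : QForm} (hQ : Q.disc ≠ 0)
    (z : ℍ) : Summable (cosetSummand cuspGroup le_rfl s Q z) := by
  have h := cuspCosetEquiv.summable_iff.mpr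
    (summable_cosetSummand_zpowers zpowers_T_le_cuspGroup hs hQ z)
  have h2 := h.comp_injective (i := fun p => (p, true)) (fun p q h => congrArg Prod.fst h)
  exact h2.congr fun p => cosetSummand_cuspCosetEquiv s Q z (p, true)

theorem lift_cuspGroup {s : ℂ} (hs : 1 < s.re) {Q : QForm} (hQ : Q.disc ≠ 0) (z : ℍ) :
    lift cuspGroup le_rfl s Q z = lift _ zpowers_T_le_cuspGroup s Q z / 2 := by
  have h := cuspCosetEquiv.summable_iff.mpr
    (summable_cosetSummand_zpowers zpowers_T_le_cuspGroup hs hQ z)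
  rw [lift, lift, ← cuspCosetEquiv.tsum_eq]
  rw [show (fun p => cosetSummand _ zpowers_T_le_cuspGroup s Q z (cuspCosetEquiv p)) =
    cosetSummand _ zpowers_T_le_cuspGroup s Q z ∘ cuspCosetEquiv from rfl, h.tsum_prod]
  simp only [Function.comp, cosetSummand_cuspCosetEquiv, tsum_bool, ← two_mul, tsum_mul_left]
  field_simp

/-- As `γ Q = Q`, the summand of `g` at `γ z` is that of `g γ` at `z`, and right translation by `γ`
permutes the cosets. -/
theorem lift_smul {H : Subgroup SL(2, ℤ)} (hH : H ≤ cuspGroup) (s : ℂ) {Q : QForm} {γ : SL(2, ℤ)}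
    (hγ : Q.act γ = Q) (z : ℍ) : lift H hH s Q (γ • z) = lift H hH s Q z := by
  let e : Quotient (QuotientGroup.rightRel H) ≃ Quotient (QuotientGroup.rightRel H) :=
    Quotient.congr (Equiv.mulRight γ) (by
      intro a b
      change (QuotientGroup.rightRel H) a b ↔ (QuotientGroup.rightRel H) (a * γ) (b * γ)
      rw [QuotientGroup.rightRel_apply, QuotientGroup.rightRel_apply, mul_inv_rev,
        mul_assoc b, mul_inv_cancel_left])
  rw [lift, lift, ← e.tsum_eq (cosetSummand H hH s Q z)]
  apply tsum_congr
  rintro ⟨g⟩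
  change phi (↑(g • γ • z) : ℂ) (Q.act g) ^ s = phi (↑((g * γ) • z) : ℂ) (Q.act (g * γ)) ^ s
  rw [act_mul, hγ, mul_smul]

end CuspGroup

/-! ### Primitives on the upper half-plane and independence of the base point. -/

section Geodesic

theorem isOpen_im_pos : IsOpen {z : ℂ | 0 < z.im} :=
  isOpen_lt continuous_const Complex.continuous_im

theorem convex_im_pos : Convex ℝ {z : ℂ | 0 < z.im} :=
  convex_halfSpace_im_gt 0

/-- A holomorphic function on the upper half-plane has a primitive. -/
theorem exists_primitive {f : ℂ → ℂ} (hf : DifferentiableOn ℂ f {z : ℂ | 0 < z.im}) :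
    ∃ P : ℂ → ℂ, ∀ z : ℂ, 0 < z.im → HasDerivAt P (f z) z := by
  -- The Cayley transform `ψ` and its inverse `χ` reduce the claim to the unit disc, for the
  -- function `f(ψ ζ) ψ'(ζ)` with `ψ' = 2i / (1 - ζ)²`.
  let ψ : ℂ → ℂ := fun ζ => Complex.I * (1 + ζ) / (1 - ζ)
  let χ : ℂ → ℂ := fun z => (z - Complex.I) / (z + Complex.I)
  have hne : ∀ ζ ∈ Metric.ball (0 : ℂ) 1, 1 - ζ ≠ 0 := by
    intro ζ hζ h
    rw [sub_eq_zero] at h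
    rw [← h] at hζ
    simp at hζ
  have hψ : ∀ ζ ∈ Metric.ball (0 : ℂ) 1, 0 < (ψ ζ).im := by
    intro ζ hζ
    have h1 : Complex.normSq ζ < 1 := by
      rw [Complex.normSq_eq_norm_sq]
      have : ‖ζ‖ < 1 := by simpa using hζ
      nlinarith [norm_nonneg ζ]
    have h0 : 0 < Complex.normSq (1 - ζ) := Complex.normSq_pos.mpr (hne ζ hζ)
    simp only [ψ]
    rw [Complex.div_im, ← sub_div]
    apply div_pos _ h0
    rw [Complex.normSq_apply] at h1
    simp
    nlinarith
  have hz' : ∀ z : ℂ, 0 < z.im → z + Complex.I ≠ 0 := by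
    intro z hz h
    have := congrArg Complex.im h
    simp at this
    linarith
  have hχ : ∀ z : ℂ, 0 < z.im → χ z ∈ Metric.ball (0 : ℂ) 1 := by
    intro z hz
    rw [mem_ball_zero_iff, norm_div, div_lt_one (norm_pos_iff.mpr (hz' z hz)),
      ← sq_lt_sq₀ (norm_nonneg _) (norm_nonneg _), ← Complex.normSq_eq_norm_sq,
      ← Complex.normSq_eq_norm_sq, Complex.normSq_apply, Complex.normSq_apply]
    simp
    nlinarith
  have hψχ : ∀ z : ℂ, 0 < z.im → ψ (χ z) = z := by
    intro z hz
    have h1 := hz' z hz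
    have h2 : 1 - χ z ≠ 0 := hne _ (hχ z hz)
    simp only [ψ]
    rw [div_eq_iff h2]
    simp only [χ]
    field_simp
    ring
  have hg : DifferentiableOn ℂ (fun ζ => f (ψ ζ) * (2 * Complex.I / (1 - ζ) ^ 2))
      (Metric.ball (0 : ℂ) 1) := by
    refine DifferentiableOn.mul (hf.comp ?_ hψ) ?_
    · intro ζ hζ
      have := hne ζ hζ
      apply DifferentiableAt.differentiableWithinAt
      simp only [ψ]
      fun_prop (disch := assumption)
    · intro ζ hζ
      have := hne ζ hζ
      apply DifferentiableAt.differentiableWithinAt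
      have h2 : (1 - ζ) ^ 2 ≠ 0 := pow_ne_zero 2 this
      fun_prop (disch := assumption)
  obtain ⟨P, hP⟩ := hg.isExactOn_ball
  refine ⟨fun z => P (χ z), fun z hz => ?_⟩
  have h1 := hz' z hz
  have hd : HasDerivAt χ (2 * Complex.I / (z + Complex.I) ^ 2) z := by
    have := ((hasDerivAt_id z).sub_const Complex.I).div ((hasDerivAt_id z).add_const Complex.I) h1
    convert! this using 1
    simp only [id]
    ring
  have := (hP (χ z) (hχ z hz)).comp z hd
  convert! this using 1
  change f z = f (ψ (χ z)) * (2 * Complex.I / (1 - χ z) ^ 2) * _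
  rw [hψχ z hz]
  have h3 : 1 - χ z = 2 * Complex.I / (z + Complex.I) := by
    simp only [χ]
    field_simp
    ring
  rw [h3]
  field_simp

theorem segIntegral_eq_sub {f P : ℂ → ℂ} (hf : ContinuousOn f {z : ℂ | 0 < z.im})
    (hP : ∀ z : ℂ, 0 < z.im → HasDerivAt P (f z) z) {z w : ℂ} (hz : 0 < z.im) (hw : 0 < w.im) :
    segIntegral f z w = P w - P z := by
  have him : ∀ t ∈ Set.uIcc (0 : ℝ) 1, 0 < (z + t * (w - z)).im := by
    intro t ht
    rw [Set.uIcc_of_le zero_le_one] at ht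
    have h := convex_im_pos hz hw (sub_nonneg.mpr ht.2) ht.1 (by ring)
    have e : (1 - t) • z + t • w = z + t * (w - z) := by
      simp only [Complex.real_smul]; push_cast; ring
    rwa [e] at h
  have hd : ∀ t ∈ Set.uIcc (0 : ℝ) 1, HasDerivAt (fun t : ℝ => P (z + t * (w - z)))
      (f (z + t * (w - z)) * (w - z)) t := by
    intro t ht
    have h1 : HasDerivAt (fun t : ℝ => z + (t : ℂ) * (w - z)) (w - z) t := by
      have := ((Complex.ofRealCLM.hasDerivAt (x := t)).mul_const (w - z)).const_add z
      simpa using this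
    exact (hP _ (him t ht)).comp t h1
  rw [segIntegral, intervalIntegral.integral_eq_sub_of_hasDerivAt hd]
  · simp
  · apply ContinuousOn.intervalIntegrable
    refine ContinuousOn.mul (hf.comp (by fun_prop) him) continuousOn_const

variable {D : ℕ} {Q : QForm}

theorem eval_ne_zero (hQ : 0 < Q.disc) {z : ℂ} (hz : 0 < z.im) : Q.eval z ≠ 0 := by
  intro h
  have := phi_im_pos hQ hz
  rw [phi, h] at this
  simp at this

/-- The matrix `γ_Q` as an element of `SL(2, ℤ)` fixing `Q`. -/
theorem exists_gammaQ_SL (hD : ¬ IsSquare D) (hQ : Q.disc = D) :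
    ∃ γ : SL(2, ℤ), Q.act γ = Q ∧ ∀ i j, gammaQ D Q i j = (γ i j : ℝ) := by
  have hp : (pellV D : ℤ) ^ 2 = D * (pellU D : ℤ) ^ 2 + 4 := by exact_mod_cast (pell_spec hD).2
  obtain ⟨v, hv⟩ : ∃ v : ℤ, v = (pellV D : ℤ) := ⟨_, rfl⟩
  obtain ⟨u, hu⟩ : ∃ u : ℤ, u = (pellU D : ℤ) := ⟨_, rfl⟩
  rw [← hv, ← hu, ← hQ, QForm.disc] at hp
  -- The Pell equation modulo 2 makes `v` and `u B` congruent, so the diagonal entries `(v ∓ u B) /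
  -- 2` are integers.
  obtain ⟨p, hp2⟩ : (2 : ℤ) ∣ v - u * Q.B := by
    apply Int.prime_two.dvd_of_dvd_pow (n := 2)
    exact ⟨2 - 2 * Q.A * Q.C * u ^ 2 + u ^ 2 * Q.B ^ 2 - u * v * Q.B, by linear_combination hp⟩
  have hvp : v = 2 * p + u * Q.B := by linarith
  have hdet : p * (p + u * Q.B) + u ^ 2 * Q.A * Q.C = 1 := by
    rw [hvp] at hp
    linarith
  have hM : Matrix.det !![p, -(u * Q.C); u * Q.A, p + u * Q.B] = 1 := by
    rw [Matrix.det_fin_two_of]; linear_combination hdet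
  refine ⟨⟨!![p, -(u * Q.C); u * Q.A, p + u * Q.B], hM⟩, ?_, ?_⟩
  · refine (slash_inv_eq Q _).trans ?_
    ext
    · simp
      linear_combination Q.A * hdet
    · simp
      linear_combination Q.B * hdet
    · simp
      linear_combination Q.C * hdet
  · have hvr : (pellV D : ℝ) = 2 * p + pellU D * Q.B := by
      rw [hv, hu] at hvp
      exact_mod_cast hvp
    have hur : (u : ℝ) = pellU D := by simp [hu]
    intro i j
    fin_cases i <;> fin_cases j <;> simp [gammaQ, QForm.N, hvr, hur] <;> ring

/-- The period as an integral over an arc, expressed by a primitive. -/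
theorem period_eq_primitive (hD : ¬ IsSquare D) (hQ : Q.disc = D) {s : ℂ}
    (hs : 1 < s.re) :
    ∃ P : ℂ → ℂ, (∀ z : ℂ, 0 < z.im → HasDerivAt P
        (lift _ zpowers_T_le_cuspGroup s Q (UpperHalfPlane.ofComplex z) / Q.eval z) z) ∧
      ∀ z₀ z₁ : ℍ, period _ zpowers_T_le_cuspGroup s D Q z₀ =
        -(Real.sqrt D : ℂ) * (P (moebius (gammaQ D Q) z₁) - P z₁) := by
  have hpos : 0 < D := Nat.pos_of_ne_zero (by rintro rfl; exact hD ⟨0, rfl⟩)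
  have hdisc : 0 < Q.disc := by rw [hQ]; exact_mod_cast hpos
  set f : ℂ → ℂ := fun z =>
    lift _ zpowers_T_le_cuspGroup s Q (UpperHalfPlane.ofComplex z) / Q.eval z with hf
  have hfd : DifferentiableOn ℂ f {z : ℂ | 0 < z.im} := by
    refine (differentiableOn_lift_zpowers _ hs hdisc).div ?_ (fun z hz => eval_ne_zero hdisc hz)
    unfold QForm.eval
    fun_prop
  obtain ⟨P, hP⟩ := exists_primitive hfd
  refine ⟨P, hP, ?_⟩
  obtain ⟨γ, hγ, hγe⟩ := exists_gammaQ_SL hD hQ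
  have hmob : ∀ z : ℍ, moebius (gammaQ D Q) z = (↑(γ • z) : ℂ) := by
    intro z
    rw [coe_smul_eq, moebius]
    simp only [hγe]
    push_cast
    rfl
  -- The form `F_Q dz / Q` is `γ`-invariant: the derivative `(cz + d)^{-2}` of `γ` cancels the
  -- factor acquired by `1 / Q`. So `P(γ z) - P(z)` has derivative zero on a connected set.
  have hconst : ∀ z w : ℂ, 0 < z.im → 0 < w.im →
      P (moebius (gammaQ D Q) z) - P z = P (moebius (gammaQ D Q) w) - P w := by
    have hderiv : ∀ z : ℂ, 0 < z.im →
        HasDerivAt (fun z => P (moebius (gammaQ D Q) z) - P z) 0 z := by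
      intro z hz
      have hz1 : ((⟨z, hz⟩ : ℍ) : ℂ) = z := rfl
      have hden := row_coe_ne_zero γ ⟨z, hz⟩
      have hm : HasDerivAt (moebius (gammaQ D Q)) (1 / ((γ 1 0 : ℂ) * z + γ 1 1) ^ 2) z := by
        have h0 : moebius (gammaQ D Q) = fun z : ℂ =>
            ((γ 0 0 : ℂ) * z + γ 0 1) / ((γ 1 0 : ℂ) * z + γ 1 1) := by
          ext z
          rw [moebius]
          simp only [hγe]
          push_cast
          rfl
        rw [h0]
        have := (((hasDerivAt_id z).const_mul (γ 0 0 : ℂ)).add_const (γ 0 1 : ℂ)).div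
          (((hasDerivAt_id z).const_mul (γ 1 0 : ℂ)).add_const (γ 1 1 : ℂ)) hden
        convert! this using 1
        have hdet := Matrix.det_fin_two (γ : Matrix (Fin 2) (Fin 2) ℤ)
        rw [γ.det_coe] at hdet
        have hdet' := congrArg (Int.cast (R := ℂ)) hdet
        push_cast at hdet'
        congr 1
        simp only [id]
        linear_combination hdet'
      have hγim : 0 < (moebius (gammaQ D Q) z).im := by
        have := hmob ⟨z, hz⟩
        rw [hz1] at this
        rw [this]
        exact UpperHalfPlane.im_pos _
      have h1 := ((hP _ hγim).comp z hm).sub (hP z hz)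
      convert! h1 using 1
      have hfz : f (moebius (gammaQ D Q) z) = f z * ((γ 1 0 : ℂ) * z + γ 1 1) ^ 2 := by
        have hE := eval_act_smul Q γ ⟨z, hz⟩
        have hm := hmob ⟨z, hz⟩
        rw [hz1] at hm hE
        rw [hγ, ← hm] at hE
        have hL : UpperHalfPlane.ofComplex (moebius (gammaQ D Q) z) = γ • (⟨z, hz⟩ : ℍ) := by
          rw [hm, UpperHalfPlane.ofComplex_apply]
        simp only [hf]
        rw [hE, hL, lift_smul _ s hγ, UpperHalfPlane.ofComplex_apply_of_im_pos hz]
        field_simp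
      rw [hfz]
      have hden' : ((γ 1 0 : ℂ) * z + γ 1 1) ≠ 0 := hden
      field_simp
      ring
    intro z w hz hw
    obtain ⟨a, ha⟩ := isOpen_im_pos.exists_is_const_of_deriv_eq_zero convex_im_pos.isPreconnected
      (fun z hz => (hderiv z hz).differentiableAt.differentiableWithinAt)
      (fun z hz => (hderiv z hz).deriv)
    rw [ha z hz, ha w hw]
  intro z₀ z₁
  rw [period, segIntegral_eq_sub hfd.continuousOn hP z₀.im_pos
    (by rw [hmob]; exact UpperHalfPlane.im_pos _), hconst z₀ z₁ z₀.im_pos z₁.im_pos]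

end Geodesic

/-! ### The geodesic of `Q` in the cross-ratio coordinate. -/

section GeodesicParam

variable {D : ℕ} {Q : QForm}

/-- The first root of a form of discriminant `D`. -/
def root (D : ℕ) (Q : QForm) : ℝ := (-Q.B + √D) / (2 * Q.A)

/-- The second root of a form of discriminant `D`. -/
def root' (D : ℕ) (Q : QForm) : ℝ := (-Q.B - √D) / (2 * Q.A)

/-- The point `z` with `(z - w) / (z - w') = q`. -/
def crossPoint (w w' q : ℂ) : ℂ := (w - q * w') / (1 - q)

theorem A_mul_root_sub (hA : Q.A ≠ 0) : Q.A * (root D Q - root' D Q) = √D := by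
  have : (Q.A : ℝ) ≠ 0 := by exact_mod_cast hA
  unfold root root'
  field_simp
  ring

theorem A_mul_root_add (hA : Q.A ≠ 0) : Q.A * (root D Q + root' D Q) = -Q.B := by
  have : (Q.A : ℝ) ≠ 0 := by exact_mod_cast hA
  unfold root root'
  field_simp
  ring

theorem A_mul_root_mul (hA : Q.A ≠ 0) (hQ : Q.disc = D) : Q.A * (root D Q * root' D Q) = Q.C := by
  have : (Q.A : ℝ) ≠ 0 := by exact_mod_cast hA
  have h : (Q.B : ℝ) ^ 2 - 4 * Q.A * Q.C = D := by
    have := congrArg (Int.cast (R := ℝ)) hQ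
    simpa [QForm.disc] using this
  have hs := Real.sq_sqrt (Nat.cast_nonneg (α := ℝ) D)
  unfold root root'
  field_simp
  linear_combination h - hs

theorem eval_crossPoint {a w w' q z : ℂ} (hq : 1 - q ≠ 0) (hz : z = crossPoint w w' q) :
    a * z ^ 2 + (-(a * (w + w'))) * z + a * (w * w') = a * q * (w - w') ^ 2 / (1 - q) ^ 2 := by
  rw [hz, crossPoint]
  field_simp
  ring

/-- In the coordinate `q`, the two factors of the denominator are `(xw + y) - q (xw' + y)` and `(xw
+ y) + q (xw' + y)`, up to factors independent of `x`, `y`; their product is a difference of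
squares. -/
theorem rowPhi_crossPoint_aux {a w w' q z : ℂ} (ha : a ≠ 0) (hq : 1 - q ≠ 0) (hw : w - w' ≠ 0)
    (hz : z = crossPoint w w' q) (x y : ℂ) :
    (a * q * (w - w') ^ 2 / (1 - q) ^ 2) / ((x * z + y) *
      ((2 * a * z + -(a * (w + w'))) * y - (-(a * (w + w')) * z + 2 * (a * (w * w'))) * x)) =
    q * (w - w') / ((x * w + y) ^ 2 - q ^ 2 * (x * w' + y) ^ 2) := by
  have h : (x * z + y) *
      ((2 * a * z + -(a * (w + w'))) * y - (-(a * (w + w')) * z + 2 * (a * (w * w'))) * x) =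
      (a * (w - w') / (1 - q) ^ 2) * ((x * w + y) ^ 2 - q ^ 2 * (x * w' + y) ^ 2) := by
    rw [hz, crossPoint]
    field_simp
    ring
  rw [h, show a * q * (w - w') ^ 2 / (1 - q) ^ 2 =
    (a * (w - w') / (1 - q) ^ 2) * (q * (w - w')) by field_simp]
  rw [mul_div_mul_left]
  exact div_ne_zero (mul_ne_zero ha hw) (pow_ne_zero 2 hq)

/-- The cross ratio parameter on the geodesic. -/
def geodQ (Q : QForm) (t : ℝ) : ℂ := Complex.I * ((|(Q.A : ℝ)| / Q.A * Real.exp t : ℝ) : ℂ)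

/-- The parametrized geodesic with end points `w'` and `w`. -/
def geod (D : ℕ) (Q : QForm) (t : ℝ) : ℂ := crossPoint (root D Q) (root' D Q) (geodQ Q t)

theorem geodQ_re (t : ℝ) : (geodQ Q t).re = 0 := by
  rw [geodQ, Complex.I_mul_re, Complex.ofReal_im, neg_zero]

theorem one_sub_geodQ_mul_ne_zero (t x y : ℝ) (hx : x ≠ 0) : (x : ℂ) - geodQ Q t * y ≠ 0 := by
  intro h
  have := congrArg Complex.re h
  simp [geodQ_re] at this
  exact hx this

theorem one_sub_geodQ_ne_zero (t : ℝ) : 1 - geodQ Q t ≠ 0 := by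
  simpa using one_sub_geodQ_mul_ne_zero (Q := Q) t 1 1 one_ne_zero

theorem geodQ_sq (hA : Q.A ≠ 0) (t : ℝ) : geodQ Q t ^ 2 = -(Real.exp t : ℂ) ^ 2 := by
  have hA' : (Q.A : ℝ) ≠ 0 := by exact_mod_cast hA
  have : (|(Q.A : ℝ)| / Q.A * Real.exp t) ^ 2 = Real.exp t ^ 2 := by
    rw [mul_pow, div_pow, sq_abs]; field_simp
  rw [geodQ, mul_pow, Complex.I_sq, ← Complex.ofReal_pow, this]
  push_cast
  ring

/-- The sign `|A| / A` in `geodQ` cancels the sign of `w - w' = √D / A`, so that both signs of `A`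
lead into the upper half-plane. -/
theorem geodQ_mul (hA : Q.A ≠ 0) (t : ℝ) :
    geodQ Q t * ((root D Q : ℂ) - root' D Q) = Complex.I * (√D / |(Q.A : ℝ)| * Real.exp t : ℝ) := by
  have hA' : (Q.A : ℝ) ≠ 0 := by exact_mod_cast hA
  have h : |(Q.A : ℝ)| / Q.A * Real.exp t * (root D Q - root' D Q) =
      √D / |(Q.A : ℝ)| * Real.exp t := by
    have h0 : |(Q.A : ℝ)| ≠ 0 := abs_ne_zero.mpr hA'
    rw [← A_mul_root_sub hA]
    field_simp
    rw [sq_abs]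
  rw [← h, geodQ]
  push_cast
  ring

theorem eval_eq_roots (hA : Q.A ≠ 0) (hQ : Q.disc = D) (z : ℂ) :
    Q.eval z = Q.A * z ^ 2 + (-(Q.A * ((root D Q : ℂ) + root' D Q))) * z +
      Q.A * ((root D Q : ℂ) * root' D Q) := by
  have h1 : (Q.A : ℂ) * ((root D Q : ℂ) + root' D Q) = -Q.B := by exact_mod_cast A_mul_root_add hA
  have h2 : (Q.A : ℂ) * ((root D Q : ℂ) * root' D Q) = Q.C := by
    exact_mod_cast A_mul_root_mul hA hQ
  rw [h1, h2, QForm.eval]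
  ring

theorem root_sub_ne_zero (hD : ¬ IsSquare D) (hA : Q.A ≠ 0) :
    (root D Q : ℂ) - root' D Q ≠ 0 := by
  have hpos : 0 < D := Nat.pos_of_ne_zero (by rintro rfl; exact hD ⟨0, rfl⟩)
  have hs : 0 < √(D : ℝ) := Real.sqrt_pos.mpr (by exact_mod_cast hpos)
  intro h
  have h' : root D Q - root' D Q = 0 := by exact_mod_cast h
  have := A_mul_root_sub (D := D) hA
  rw [h', mul_zero] at this
  exact hs.ne this

/-- The positive definite form `|A| ((c w + d)² e^{-t} + (c w' + d)² e^t)` of `(c, d)`. -/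
def geodForm (D : ℕ) (Q : QForm) (t : ℝ) (v : Fin 2 → ℤ) : ℝ :=
  |(Q.A : ℝ)| * ((v 0 * root D Q + v 1) ^ 2 * Real.exp (-t) +
    (v 0 * root' D Q + v 1) ^ 2 * Real.exp t)

theorem geodForm_nonneg (t : ℝ) (v : Fin 2 → ℤ) : 0 ≤ geodForm D Q t v := by
  unfold geodForm
  positivity

/-- As `q² = -e^{2t}`, the difference of squares becomes a sum, which makes the value `i` times a
nonnegative real number. -/
theorem rowPhi_geod (hD : ¬ IsSquare D) (hQ : Q.disc = D) (t : ℝ) (v : Fin 2 → ℤ) :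
    rowPhi Q (geod D Q t) v = ((geodForm D Q t v)⁻¹ : ℝ) * (Complex.I * (√D : ℝ)) := by
  have hA := A_ne_zero hD hQ
  have hA' : (Q.A : ℂ) ≠ 0 := by exact_mod_cast hA
  have h1 : (Q.A : ℂ) * ((root D Q : ℂ) + root' D Q) = -Q.B := by exact_mod_cast A_mul_root_add hA
  have h2 : (Q.A : ℂ) * ((root D Q : ℂ) * root' D Q) = Q.C := by
    exact_mod_cast A_mul_root_mul hA hQ
  have hB : (Q.B : ℂ) = -(Q.A * ((root D Q : ℂ) + root' D Q)) := by rw [h1, neg_neg]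
  have hq := one_sub_geodQ_ne_zero (Q := Q) t
  rw [rowPhi, eval_eq_roots hA hQ, eval_crossPoint (z := geod D Q t) hq rfl, QForm.evalDeriv, hB, ← h2,
    rowPhi_crossPoint_aux (z := geod D Q t) hA' hq (root_sub_ne_zero hD hA) rfl, geodQ_mul hA, geodQ_sq hA]
  have hA0 : |(Q.A : ℝ)| ≠ 0 := abs_ne_zero.mpr (by exact_mod_cast hA)
  have he : Real.exp t ≠ 0 := (Real.exp_pos t).ne'
  have key : √D / |(Q.A : ℝ)| * Real.exp t / ((v 0 * root D Q + v 1) ^ 2 +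
      Real.exp t ^ 2 * (v 0 * root' D Q + v 1) ^ 2) = (geodForm D Q t v)⁻¹ * √D := by
    rw [geodForm, Real.exp_neg]
    have : |(Q.A : ℝ)| * ((v 0 * root D Q + v 1) ^ 2 * (Real.exp t)⁻¹ +
        (v 0 * root' D Q + v 1) ^ 2 * Real.exp t) = (|(Q.A : ℝ)| / Real.exp t) *
        ((v 0 * root D Q + v 1) ^ 2 + Real.exp t ^ 2 * (v 0 * root' D Q + v 1) ^ 2) := by
      field_simp
    rw [this, mul_inv, inv_div]
    ring
  calc _ = Complex.I * ((√D / |(Q.A : ℝ)| * Real.exp t / ((v 0 * root D Q + v 1) ^ 2 +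
      Real.exp t ^ 2 * (v 0 * root' D Q + v 1) ^ 2) : ℝ) : ℂ) := by
        push_cast
        rw [neg_mul, sub_neg_eq_add]
        ring
    _ = _ := by rw [key]; push_cast; ring

theorem geod_im_pos (hD : ¬ IsSquare D) (hQ : Q.disc = D) (t : ℝ) : 0 < (geod D Q t).im := by
  have hA := A_ne_zero hD hQ
  have hpos : 0 < D := Nat.pos_of_ne_zero (by rintro rfl; exact hD ⟨0, rfl⟩)
  have hs : 0 < √(D : ℝ) := Real.sqrt_pos.mpr (by exact_mod_cast hpos)
  have hA0 : 0 < |(Q.A : ℝ)| := abs_pos.mpr (by exact_mod_cast hA)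
  have hq := one_sub_geodQ_ne_zero (Q := Q) t
  have h1 : geod D Q t = root D Q + geodQ Q t * ((root D Q : ℂ) - root' D Q) / (1 - geodQ Q t) := by
    rw [geod, crossPoint]; field_simp; ring
  -- In `z - w = q (w - w') / (1 - q)`, `q` is purely imaginary, so the conjugate of `1 - q` has
  -- real part 1 and the imaginary part can be read off.
  have h2 : geod D Q t * (Complex.normSq (1 - geodQ Q t) : ℂ) =
      root D Q * (Complex.normSq (1 - geodQ Q t) : ℂ) +
      geodQ Q t * ((root D Q : ℂ) - root' D Q) * (starRingEnd ℂ) (1 - geodQ Q t) := by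
    rw [h1, Complex.normSq_eq_conj_mul_self]
    field_simp
  have h3 := congrArg Complex.im h2
  rw [geodQ_mul hA, Complex.im_mul_ofReal] at h3
  have h0 : 0 < Complex.normSq (1 - geodQ Q t) := Complex.normSq_pos.mpr hq
  refine pos_of_mul_pos_left (b := Complex.normSq (1 - geodQ Q t)) ?_ h0.le
  rw [h3]
  have : 0 < √D / |(Q.A : ℝ)| * Real.exp t := by positivity
  rw [Complex.add_im, ← Complex.ofReal_mul, Complex.ofReal_im, zero_add, mul_assoc,
    Complex.I_mul_im, Complex.re_ofReal_mul, Complex.conj_re, Complex.sub_re, geodQ_re]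
  simpa using this

/-- Chain rule with `dq/dt = q` and `dz/dq = (w - w') / (1 - q)²`, compared with `Q(z) = A q (w -
w')² / (1 - q)²` and `A (w - w') = √D`. -/
theorem hasDerivAt_geod (hD : ¬ IsSquare D) (hQ : Q.disc = D) (t : ℝ) :
    HasDerivAt (geod D Q) (Q.eval (geod D Q t) / (√D : ℝ)) t := by
  have hA := A_ne_zero hD hQ
  have hA' : (Q.A : ℂ) ≠ 0 := by exact_mod_cast hA
  have hq := one_sub_geodQ_ne_zero (Q := Q) t
  have hw := root_sub_ne_zero hD hA
  have hs : ((√D : ℝ) : ℂ) = Q.A * ((root D Q : ℂ) - root' D Q) := by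
    exact_mod_cast (A_mul_root_sub hA).symm
  have hg : HasDerivAt (geodQ Q) (geodQ Q t) t := by
    exact (((Real.hasDerivAt_exp t).const_mul (|(Q.A : ℝ)| / Q.A)).ofReal_comp).const_mul Complex.I
  have hc : HasDerivAt (crossPoint (root D Q) (root' D Q))
      (((root D Q : ℂ) - root' D Q) / (1 - geodQ Q t) ^ 2) (geodQ Q t) := by
    have := (((hasDerivAt_id (geodQ Q t)).mul_const (root' D Q : ℂ)).const_sub (root D Q : ℂ)).div
      ((hasDerivAt_id (geodQ Q t)).const_sub 1) hq
    convert! this using 1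
    congr 1
    simp only [id]
    ring
  have := hc.comp t hg
  convert! this using 1
  rw [eval_eq_roots hA hQ, eval_crossPoint (z := geod D Q t) hq rfl, hs]
  field_simp

/-- The matrix `γ_Q` has eigenvectors `(w, 1)` and `(w', 1)` with eigenvalues `ε` and `ε⁻¹`, hence
it multiplies the cross ratio by `ε^{-2}`. -/
theorem moebius_geod (hD : ¬ IsSquare D) (hQ : Q.disc = D) (t : ℝ) :
    moebius (gammaQ D Q) (geod D Q t) = geod D Q (t - 2 * Real.log (pellUnit D)) := by
  have hA := A_ne_zero hD hQ
  have hA' : (Q.A : ℂ) ≠ 0 := by exact_mod_cast hA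
  have hq := one_sub_geodQ_ne_zero (Q := Q) t
  have hw := root_sub_ne_zero hD hA
  have hE := pellUnit_pos hD
  have hE' : (pellUnit D : ℂ) ≠ 0 := by exact_mod_cast hE.ne'
  have hqt : geodQ Q (t - 2 * Real.log (pellUnit D)) = geodQ Q t / (pellUnit D : ℂ) ^ 2 := by
    rw [geodQ, geodQ, Real.exp_sub, two_mul, Real.exp_add, Real.exp_log hE]
    push_cast
    ring
  have hq2 := one_sub_geodQ_ne_zero (Q := Q) (t - 2 * Real.log (pellUnit D))
  have hs : ((√D : ℝ) : ℂ) = Q.A * ((root D Q : ℂ) - root' D Q) := by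
    exact_mod_cast (A_mul_root_sub hA).symm
  have h1 : (Q.B : ℂ) = -(Q.A * ((root D Q : ℂ) + root' D Q)) := by
    have := A_mul_root_add (D := D) hA
    rw [eq_neg_iff_add_eq_zero]
    exact_mod_cast (by linarith : (Q.B : ℝ) + Q.A * (root D Q + root' D Q) = 0)
  have h2 : (Q.C : ℂ) = Q.A * ((root D Q : ℂ) * root' D Q) := by
    exact_mod_cast (A_mul_root_mul hA hQ).symm
  have hv : (pellV D : ℂ) = pellUnit D + (pellUnit D : ℂ)⁻¹ := by
    rw [← Complex.ofReal_inv, pellUnit_inv hD, pellUnit]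
    push_cast
    ring
  have hu : (pellU D : ℂ) * (Q.A * ((root D Q : ℂ) - root' D Q)) =
      pellUnit D - (pellUnit D : ℂ)⁻¹ := by
    rw [← hs, ← Complex.ofReal_inv, pellUnit_inv hD, pellUnit]
    push_cast
    ring
  have hk : (pellU D : ℂ) * Q.A = (pellUnit D - (pellUnit D : ℂ)⁻¹) /
      ((root D Q : ℂ) - root' D Q) := by
    rw [← hu]; field_simp
  have m00 : (gammaQ D Q 0 0 : ℂ) = (pellV D + pellU D * Q.A * ((root D Q : ℂ) + root' D Q)) / 2 := by
    simp [gammaQ, QForm.N, h1]; ring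
  have m01 : (gammaQ D Q 0 1 : ℂ) = -(pellU D * Q.A * ((root D Q : ℂ) * root' D Q)) := by
    simp [gammaQ, QForm.N, h2]; ring
  have m10 : (gammaQ D Q 1 0 : ℂ) = pellU D * Q.A := by
    simp [gammaQ, QForm.N]; ring
  have m11 : (gammaQ D Q 1 1 : ℂ) = (pellV D - pellU D * Q.A * ((root D Q : ℂ) + root' D Q)) / 2 := by
    simp [gammaQ, QForm.N, h1]; ring
  rw [moebius, m00, m01, m10, m11, hk, hv, geod, geod, crossPoint, crossPoint, hqt]
  rw [hqt] at hq2
  generalize geodQ Q t = q at *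
  generalize (root D Q : ℂ) = w at *
  generalize (root' D Q : ℂ) = w' at *
  generalize (pellUnit D : ℂ) = e at *
  have hden : (e - e⁻¹) / (w - w') * ((w - q * w') / (1 - q)) +
      (e + e⁻¹ - (e - e⁻¹) / (w - w') * (w + w')) / 2 = (1 - q / e ^ 2) * (e / (1 - q)) := by
    field_simp
    ring
  have hnum : (e + e⁻¹ + (e - e⁻¹) / (w - w') * (w + w')) / 2 * ((w - q * w') / (1 - q)) +
      -((e - e⁻¹) / (w - w') * (w * w')) = (w - q / e ^ 2 * w') * (e / (1 - q)) := by
    field_simp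
    ring
  rw [hden, hnum, mul_div_mul_right _ _ (div_ne_zero hE' hq)]

end GeodesicParam

/-! ### The period as a sum of integrals over all integer vectors. -/

section PeriodIntegral

open EisensteinSeries

variable {D : ℕ} {Q : QForm}

theorem period_eq_integral (hD : ¬ IsSquare D) (hQ : Q.disc = D) {s : ℂ} (hs : 1 < s.re) (z₀ : ℍ) :
    period _ zpowers_T_le_cuspGroup s D Q z₀ = ∫ t in (-(2 * Real.log (pellUnit D)))..0,
      lift _ zpowers_T_le_cuspGroup s Q (UpperHalfPlane.ofComplex (geod D Q t)) := by
  have hpos : 0 < D := Nat.pos_of_ne_zero (by rintro rfl; exact hD ⟨0, rfl⟩)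
  have hdisc : 0 < Q.disc := by rw [hQ]; exact_mod_cast hpos
  have hs0 : ((√D : ℝ) : ℂ) ≠ 0 := by
    have : 0 < √(D : ℝ) := Real.sqrt_pos.mpr (by exact_mod_cast hpos)
    exact_mod_cast this.ne'
  obtain ⟨P, hP, h⟩ := period_eq_primitive hD hQ hs
  have him := geod_im_pos hD hQ
  rw [h z₀ ⟨geod D Q 0, him 0⟩]
  change -_ * (P (moebius (gammaQ D Q) (geod D Q 0)) - P (geod D Q 0)) = _
  rw [moebius_geod hD hQ, zero_sub]
  have hd : ∀ t : ℝ, HasDerivAt (fun t => (√D : ℝ) * P (geod D Q t))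
      (lift _ zpowers_T_le_cuspGroup s Q (UpperHalfPlane.ofComplex (geod D Q t))) t := by
    intro t
    have h1 := ((hP _ (him t)).comp t (hasDerivAt_geod hD hQ t)).const_mul ((√D : ℝ) : ℂ)
    convert! h1 using 1
    have := eval_ne_zero hdisc (him t)
    field_simp
  rw [intervalIntegral.integral_eq_sub_of_hasDerivAt (fun t _ => hd t)]
  · ring
  · apply Continuous.intervalIntegrable
    have hc : Continuous (geod D Q) :=
      continuous_iff_continuousAt.mpr fun t => (hasDerivAt_geod hD hQ t).continuousAt
    exact (differentiableOn_lift_zpowers zpowers_T_le_cuspGroup hs hdisc).continuousOn.comp_continuous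
      hc him

/-- A positive real factor splits off from a principal power. Where the definite form is 0, both
sides are 0 since `s ≠ 0`. -/
theorem rowPhi_geod_cpow (hD : ¬ IsSquare D) (hQ : Q.disc = D) {s : ℂ} (hs : s ≠ 0) (t : ℝ)
    (v : Fin 2 → ℤ) : rowPhi Q (geod D Q t) v ^ s =
      (Complex.I * (√D : ℝ)) ^ s * (geodForm D Q t v : ℂ) ^ (-s) := by
  have hpos : 0 < D := Nat.pos_of_ne_zero (by rintro rfl; exact hD ⟨0, rfl⟩)
  have hs0 : (Complex.I * ((√D : ℝ) : ℂ)) ≠ 0 := by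
    have : 0 < √(D : ℝ) := Real.sqrt_pos.mpr (by exact_mod_cast hpos)
    exact mul_ne_zero Complex.I_ne_zero (by exact_mod_cast this.ne')
  rw [rowPhi_geod hD hQ]
  rcases (geodForm_nonneg (D := D) (Q := Q) t v).eq_or_lt with h | h
  · rw [← h]; simp [hs]
  · have hi := inv_pos.mpr h
    have h1 : ((geodForm D Q t v : ℝ) : ℂ) ≠ 0 := by exact_mod_cast h.ne'
    rw [Complex.cpow_def_of_ne_zero (mul_ne_zero (by exact_mod_cast hi.ne') hs0),
      Complex.log_ofReal_mul hi hs0, Complex.cpow_def_of_ne_zero hs0,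
      Complex.cpow_def_of_ne_zero h1, ← Complex.exp_add, Real.log_inv, ← Complex.ofReal_log h.le]
    push_cast
    ring_nf

theorem I_mul_sqrt_cpow_ne_zero (hD : ¬ IsSquare D) (s : ℂ) :
    (Complex.I * ((√D : ℝ) : ℂ)) ^ s ≠ 0 := by
  have hpos : 0 < D := Nat.pos_of_ne_zero (by rintro rfl; exact hD ⟨0, rfl⟩)
  have : 0 < √(D : ℝ) := Real.sqrt_pos.mpr (by exact_mod_cast hpos)
  have hs0 : (Complex.I * ((√D : ℝ) : ℂ)) ≠ 0 :=
    mul_ne_zero Complex.I_ne_zero (by exact_mod_cast this.ne')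
  rw [Complex.cpow_def_of_ne_zero hs0]
  exact Complex.exp_ne_zero _

theorem exists_geodForm_bound (hD : ¬ IsSquare D) (hQ : Q.disc = D) {s : ℂ} (hs : 1 < s.re)
    (a b : ℝ) : ∃ M : ℝ, ∀ t ∈ Set.Icc a b, ∀ v : Fin 2 → ℤ,
      ‖(geodForm D Q t v : ℂ) ^ (-s)‖ ≤ M * ‖v‖ ^ (-(2 * s.re)) := by
  have hpos : 0 < D := Nat.pos_of_ne_zero (by rintro rfl; exact hD ⟨0, rfl⟩)
  have hdisc : Q.disc ≠ 0 := by rw [hQ]; exact_mod_cast hpos.ne'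
  have hs0 : s ≠ 0 := by rintro rfl; simp at hs; linarith
  have hc : Continuous (geod D Q) :=
    continuous_iff_continuousAt.mpr fun t => (hasDerivAt_geod hD hQ t).continuousAt
  obtain ⟨M, hM⟩ := exists_rowPhi_cpow_bound hdisc (zero_lt_one.trans hs)
    ((isCompact_Icc (a := a) (b := b)).image hc)
    (by rintro _ ⟨t, -, rfl⟩; exact geod_im_pos hD hQ t)
  have hne := norm_pos_iff.mpr (I_mul_sqrt_cpow_ne_zero hD s)
  refine ⟨‖(Complex.I * ((√D : ℝ) : ℂ)) ^ s‖⁻¹ * M, fun t ht v => ?_⟩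
  have := hM _ ⟨t, ht, rfl⟩ v
  rw [rowPhi_geod_cpow hD hQ hs0, norm_mul] at this
  rw [mul_assoc, le_inv_mul_iff₀ hne]
  exact this

theorem summable_geodForm_cpow (hD : ¬ IsSquare D) (hQ : Q.disc = D) {s : ℂ} (hs : 1 < s.re)
    (t : ℝ) : Summable fun v : Fin 2 → ℤ => ‖(geodForm D Q t v : ℂ) ^ (-s)‖ := by
  obtain ⟨M, hM⟩ := exists_geodForm_bound hD hQ hs t t
  exact Summable.of_nonneg_of_le (fun _ => norm_nonneg _) (hM t ⟨le_rfl, le_rfl⟩)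
    ((summable_norm_rpow_vec hs).mul_left M)

theorem geodForm_nsmul (t : ℝ) (n : ℕ) (v : Fin 2 → ℤ) :
    geodForm D Q t (n • v) = (n : ℝ) ^ 2 * geodForm D Q t v := by
  simp only [geodForm, Pi.smul_apply, nsmul_eq_mul]
  push_cast
  ring

theorem geodForm_nsmul_cpow {s : ℂ} (hs : s ≠ 0) (t : ℝ) (n : ℕ) (v : Fin 2 → ℤ) :
    (geodForm D Q t (n • v) : ℂ) ^ (-s) = 1 / (n : ℂ) ^ (2 * s) * (geodForm D Q t v : ℂ) ^ (-s) := by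
  rw [geodForm_nsmul, Complex.ofReal_mul,
    Complex.mul_cpow_ofReal_nonneg (by positivity) (geodForm_nonneg t v)]
  congr 1
  rw [Complex.cpow_neg, one_div]
  congr 1
  rcases Nat.eq_zero_or_pos n with rfl | hn
  · simp [hs]
  · have hn' : (n : ℂ) ≠ 0 := by exact_mod_cast hn.ne'
    rw [two_mul, Complex.cpow_add _ _ hn', ← Complex.natCast_mul_natCast_cpow]
    push_cast
    rw [sq]

/-- Each nonzero vector is its gcd times a coprime vector; `k 0 = 0` disposes of the zero vector. -/
theorem tsum_eq_tsum_mul_tsum_coprime {g : (Fin 2 → ℤ) → ℂ} (hg : Summable g) {k : ℕ → ℂ}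
    (hk : k 0 = 0) (h : ∀ n v, g (n • v) = k n * g v) :
    ∑' v, g v = (∑' n, k n) * ∑' v : gammaSet 1 1 0, g v := by
  have hS : Summable fun p => g (gammaSetDivGcdSigmaEquiv.symm p) :=
    gammaSetDivGcdSigmaEquiv.symm.summable_iff.mpr hg
  rw [← gammaSetDivGcdSigmaEquiv.symm.tsum_eq g, hS.tsum_sigma, ← tsum_mul_right]
  apply tsum_congr
  intro n
  have hv (v : gammaSet 1 n 0) : g (gammaSetDivGcdSigmaEquiv.symm ⟨n, v⟩) =
      k n * g (divIntMap n v.1) := by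
    rw [← h, ← gammaSet_eq_gcd_mul_divIntMap v.2, gammaSetDivGcdSigmaEquiv_symm_eq]
  simp only [hv]
  rcases eq_or_ne n 0 with rfl | hn
  · simp [hk]
  · have : NeZero n := ⟨hn⟩
    rw [tsum_mul_left, ← (gammaSetDivGcdEquiv n).tsum_eq]
    simp only [gammaSetDivGcdEquiv_eq]

theorem zeta_mul_tsum_geodForm (hD : ¬ IsSquare D) (hQ : Q.disc = D) {s : ℂ} (hs : 1 < s.re)
    (t : ℝ) : riemannZeta (2 * s) *
      ∑' v : gammaSet 1 1 0, (geodForm D Q t (v : Fin 2 → ℤ) : ℂ) ^ (-s) =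
    ∑' v : Fin 2 → ℤ, (geodForm D Q t v : ℂ) ^ (-s) := by
  have hs0 : s ≠ 0 := by rintro rfl; simp at hs; linarith
  have hs2 : 1 < (2 * s).re := by simp; linarith
  rw [tsum_eq_tsum_mul_tsum_coprime (summable_geodForm_cpow hD hQ hs t).of_norm
    (k := fun n => 1 / (n : ℂ) ^ (2 * s)) (by simp [hs0]) (geodForm_nsmul_cpow hs0 t),
    zeta_eq_tsum_one_div_nat_cpow hs2]

theorem zeta_mul_lift_geod (hD : ¬ IsSquare D) (hQ : Q.disc = D) {s : ℂ} (hs : 1 < s.re)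
    (t : ℝ) : riemannZeta (2 * s) *
      lift _ zpowers_T_le_cuspGroup s Q (UpperHalfPlane.ofComplex (geod D Q t)) =
    (Complex.I * ((√D : ℝ) : ℂ)) ^ s * ∑' v : Fin 2 → ℤ, (geodForm D Q t v : ℂ) ^ (-s) := by
  have hs0 : s ≠ 0 := by rintro rfl; simp at hs; linarith
  rw [← zeta_mul_tsum_geodForm hD hQ hs, lift_zpowers,
    UpperHalfPlane.ofComplex_apply_of_im_pos (geod_im_pos hD hQ t)]
  simp only [rowPhi_geod_cpow hD hQ hs0, tsum_mul_left]
  ring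

theorem hasSum_integral_geodForm (hD : ¬ IsSquare D) (hQ : Q.disc = D) {s : ℂ} (hs : 1 < s.re)
    {a b : ℝ} (hab : a ≤ b) :
    HasSum (fun v : Fin 2 → ℤ => ∫ t in a..b, (geodForm D Q t v : ℂ) ^ (-s))
      (∫ t in a..b, ∑' v : Fin 2 → ℤ, (geodForm D Q t v : ℂ) ^ (-s)) := by
  obtain ⟨M, hM⟩ := exists_geodForm_bound hD hQ hs a b
  refine intervalIntegral.hasSum_integral_of_dominated_convergence
    (fun v _ => M * ‖v‖ ^ (-(2 * s.re))) ?_ ?_ ?_ ?_ ?_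
  · intro v
    have h1 : Continuous fun t => geodForm D Q t v := by unfold geodForm; fun_prop
    exact ((Complex.measurable_ofReal.comp h1.measurable).pow_const (-s)).aestronglyMeasurable
  · intro v
    refine Filter.Eventually.of_forall fun t ht => hM t ?_ v
    rw [Set.uIoc_of_le hab] at ht
    exact Set.Ioc_subset_Icc_self ht
  · exact Filter.Eventually.of_forall fun t _ => (summable_norm_rpow_vec hs).mul_left M
  · exact intervalIntegrable_const
  · exact Filter.Eventually.of_forall fun t _ => (summable_geodForm_cpow hD hQ hs t).of_norm.hasSum

theorem zeta_mul_period (hD : ¬ IsSquare D) (hQ : Q.disc = D) {s : ℂ} (hs : 1 < s.re) (z₀ : ℍ) :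
    riemannZeta (2 * s) * period _ zpowers_T_le_cuspGroup s D Q z₀ =
      (Complex.I * ((√D : ℝ) : ℂ)) ^ s * ∑' v : Fin 2 → ℤ,
        ∫ t in (-(2 * Real.log (pellUnit D)))..0, (geodForm D Q t v : ℂ) ^ (-s) := by
  have hL : 0 < Real.log (pellUnit D) := Real.log_pos (one_lt_pellUnit hD)
  rw [(hasSum_integral_geodForm hD hQ hs (by linarith)).tsum_eq, period_eq_integral hD hQ hs,
    ← intervalIntegral.integral_const_mul, ← intervalIntegral.integral_const_mul]
  simp only [zeta_mul_lift_geod hD hQ hs]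

end PeriodIntegral

/-! ### The integral `c(s)` and unfolding over translates. -/

section HyperbolicIntegral

open MeasureTheory

theorem norm_cIntegrand (s : ℂ) (t : ℝ) :
    ‖cIntegrand s t‖ = (Real.exp t + Real.exp (-t)) ^ (-s.re) := by
  have h : 0 < Real.exp t + Real.exp (-t) := by positivity
  rw [cIntegrand, norm_div, norm_one, Complex.norm_cpow_eq_rpow_re_of_pos h, Real.rpow_neg h.le,
    one_div]

theorem measurable_cIntegrand (s : ℂ) : Measurable (cIntegrand s) := by
  unfold cIntegrand
  fun_prop

theorem integrable_cIntegrand {s : ℂ} (hs : 0 < s.re) : Integrable (cIntegrand s) := by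
  have h1 : Integrable fun t : ℝ => Real.exp (-s.re * |t|) := by
    have hp : IntegrableOn (fun t : ℝ => Real.exp (-s.re * |t|)) (Set.Ioi 0) :=
      (exp_neg_integrableOn_Ioi 0 hs).congr_fun
        (fun t ht => by simp only [abs_of_pos (Set.mem_Ioi.mp ht)]) measurableSet_Ioi
    have hn : IntegrableOn (fun t : ℝ => Real.exp (-s.re * |t|)) (Set.Iic 0) := by
      have := (Iff.mpr integrableOn_Ici_iff_integrableOn_Ioi ((neg_zero (G := ℝ)).symm ▸ hp)).comp_neg_Iic
      simpa only [abs_neg] using this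
    rw [← integrableOn_univ, ← Set.Iic_union_Ioi (a := (0 : ℝ))]
    exact hn.union hp
  refine h1.mono' (measurable_cIntegrand s).aestronglyMeasurable (Filter.Eventually.of_forall ?_)
  intro t
  rw [norm_cIntegrand]
  have h2 : Real.exp |t| ≤ Real.exp t + Real.exp (-t) := by
    rcases abs_cases t with ⟨h, -⟩ | ⟨h, -⟩ <;> rw [h]
    · exact le_add_of_nonneg_right (Real.exp_pos _).le
    · exact le_add_of_nonneg_left (Real.exp_pos _).le
  calc (Real.exp t + Real.exp (-t)) ^ (-s.re) ≤ Real.exp |t| ^ (-s.re) :=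
        Real.rpow_le_rpow_of_nonpos (Real.exp_pos _) h2 (by linarith)
    _ = Real.exp (-s.re * |t|) := by rw [← Real.exp_mul]; ring_nf

/-- Allows division by `c(σ)` when the convergence of `ζ(α, s)` is deduced from the unfolded sum at
`σ = Re s`. -/
theorem c_ofReal_ne_zero {σ : ℝ} (hσ : 0 < σ) : c (σ : ℂ) ≠ 0 := by
  have hpos : ∀ t : ℝ, 0 < Real.exp t + Real.exp (-t) := fun t => by positivity
  have h1 : cIntegrand (σ : ℂ) = fun t => (((Real.exp t + Real.exp (-t)) ^ (-σ) : ℝ) : ℂ) := by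
    funext t
    rw [cIntegrand, Complex.ofReal_cpow (hpos t).le, Complex.ofReal_neg, Complex.cpow_neg, one_div]
  have h2 : Integrable fun t : ℝ => (Real.exp t + Real.exp (-t)) ^ (-σ) := by
    have := (integrable_cIntegrand (s := (σ : ℂ)) (by simpa using hσ)).norm
    simpa only [norm_cIntegrand, Complex.ofReal_re] using this
  rw [c, h1, integral_complex_ofReal]
  have h3 : 0 < ∫ t : ℝ, (Real.exp t + Real.exp (-t)) ^ (-σ) := by
    rw [integral_pos_iff_support_of_nonneg (fun t => (Real.rpow_pos_of_pos (hpos t) _).le) h2]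
    have : Function.support (fun t : ℝ => (Real.exp t + Real.exp (-t)) ^ (-σ)) = Set.univ :=
      Set.eq_univ_of_forall fun t => (Real.rpow_pos_of_pos (hpos t) _).ne'
    rw [this]
    simp
  exact_mod_cast h3.ne'

/-- The function `(a² e^{-t} + b² e^t) / N`. -/
def expForm (a b N t : ℝ) : ℝ := (a ^ 2 * Real.exp (-t) + b ^ 2 * Real.exp t) / N

/-- Translation by `log |a / b|` balances the two exponentials, whose product of coefficients is
`(ab)²`. -/
theorem expForm_eq {a b : ℝ} (ha : a ≠ 0) (hb : b ≠ 0) (N t : ℝ) :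
    expForm a b N t = |a * b| / N *
      (Real.exp (t - Real.log |a / b|) + Real.exp (-(t - Real.log |a / b|))) := by
  have h : 0 < |a / b| := abs_pos.mpr (div_ne_zero ha hb)
  have ha' := abs_pos.mpr ha
  have hb' := abs_pos.mpr hb
  rw [neg_sub, sub_eq_add_neg t, sub_eq_add_neg _ t, Real.exp_add, Real.exp_add, Real.exp_neg (Real.log _),
    Real.exp_log h, expForm, ← sq_abs a, ← sq_abs b, abs_mul, abs_div]
  field_simp
  ring

theorem expForm_cpow {a b N : ℝ} (ha : a ≠ 0) (hb : b ≠ 0) (hN : 0 < N) (s : ℂ) (t : ℝ) :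
    (expForm a b N t : ℂ) ^ (-s) =
      ((|a * b| / N : ℝ) : ℂ) ^ (-s) * cIntegrand s (t - Real.log |a / b|) := by
  rw [expForm_eq ha hb, Complex.ofReal_mul,
    Complex.mul_cpow_ofReal_nonneg (by positivity) (by positivity), cIntegrand,
    Complex.cpow_neg ((Real.exp (t - Real.log |a / b|) + _ : ℝ) : ℂ), one_div]

theorem integrable_expForm_cpow {a b N : ℝ} (ha : a ≠ 0) (hb : b ≠ 0) (hN : 0 < N) {s : ℂ}
    (hs : 0 < s.re) : Integrable fun t => (expForm a b N t : ℂ) ^ (-s) := by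
  simp only [expForm_cpow ha hb hN]
  exact ((integrable_cIntegrand hs).comp_sub_right _).const_mul _

theorem integral_expForm_cpow {a b N : ℝ} (ha : a ≠ 0) (hb : b ≠ 0) (hN : 0 < N) (s : ℂ) :
    ∫ t, (expForm a b N t : ℂ) ^ (-s) = c s * ((|a * b| / N : ℝ) : ℂ) ^ (-s) := by
  simp only [expForm_cpow ha hb hN]
  rw [integral_const_mul, integral_sub_right_eq_self (cIntegrand s), c, mul_comm]

theorem hasSum_integral_translates {f : ℝ → ℂ} (hf : Integrable f) {p : ℝ} (hp : 0 < p) :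
    HasSum (fun n : ℤ => ∫ t in (-p)..0, f (t - n * p)) (∫ t, f t) := by
  have h := hasSum_integral_iUnion (μ := volume) (f := f)
    (s := fun n : ℤ => Set.Ioc (-p + n • p) (-p + (n + 1) • p)) (fun _ => measurableSet_Ioc)
    (Set.pairwise_disjoint_Ioc_add_zsmul (-p) p) hf.integrableOn
  rw [iUnion_Ioc_add_zsmul hp, setIntegral_univ] at h
  rw [← (Equiv.neg ℤ).hasSum_iff] at h
  refine h.congr_fun ?_
  intro n
  rw [intervalIntegral.integral_comp_sub_right f, intervalIntegral.integral_of_le (by linarith)]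
  simp only [Function.comp, Equiv.neg_apply, zsmul_eq_mul]
  push_cast
  congr 3 <;> ring

theorem expForm_mul_zpow {ε : ℝ} (hε : 0 < ε) (a b N t : ℝ) (k : ℤ) :
    expForm (a * ε ^ k) (b * ε⁻¹ ^ k) N t = expForm a b N (t - k * (2 * Real.log ε)) := by
  have h : Real.exp (k * Real.log ε) = ε ^ k := by
    rw [mul_comm, Real.exp_mul, Real.exp_log hε, Real.rpow_intCast]
  have e1 : Real.exp (-(t - k * (2 * Real.log ε))) = (ε ^ k) ^ 2 * Real.exp (-t) := by
    rw [← h, sq, ← Real.exp_add, ← Real.exp_add]; ring_nf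
  have e2 : Real.exp (t - k * (2 * Real.log ε)) = (ε⁻¹ ^ k) ^ 2 * Real.exp t := by
    rw [inv_zpow, ← h, ← Real.exp_neg, sq, ← Real.exp_add, ← Real.exp_add]; ring_nf
  rw [expForm, expForm, e1, e2]
  ring

/-- Replacing `(a, b)` by `(a ε^k, b ε^{-k})` translates `t` by `2k log ε`, the length of the
interval; the translates tile the line. -/
theorem hasSum_integral_expForm {a b N : ℝ} (ha : a ≠ 0) (hb : b ≠ 0) (hN : 0 < N) {s : ℂ}
    (hs : 0 < s.re) {ε : ℝ} (hε : 1 < ε) :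
    HasSum (fun k : ℤ => ∫ t in (-(2 * Real.log ε))..0,
      (expForm (a * ε ^ k) (b * ε⁻¹ ^ k) N t : ℂ) ^ (-s))
      (c s * ((|a * b| / N : ℝ) : ℂ) ^ (-s)) := by
  simp only [expForm_mul_zpow (zero_lt_one.trans hε)]
  rw [← integral_expForm_cpow ha hb hN]
  exact hasSum_integral_translates (integrable_expForm_cpow ha hb hN hs)
    (by have := Real.log_pos hε; linarith)

end HyperbolicIntegral

/-! ### Elements of an ideal and integral ideals in the inverse class. -/

section IdealsInClass

variable {K : Type*} [Field K] [NumberField K]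

theorem mk0_eq_one_iff_exists_span (I : (Ideal (𝓞 K))⁰) :
    ClassGroup.mk0 I = 1 ↔ ∃ x : 𝓞 K, (I : Ideal (𝓞 K)) = Ideal.span {x} :=
  (ClassGroup.mk0_eq_one_iff I.2).trans ⟨fun ⟨x, hx⟩ => ⟨x, hx⟩, fun ⟨x, hx⟩ => ⟨x, hx⟩⟩

theorem exists_span_eq_mul {J : (Ideal (𝓞 K))⁰}
    (a : {a : (Ideal (𝓞 K))⁰ // ClassGroup.mk0 a = (ClassGroup.mk0 J)⁻¹}) :
    ∃ x : 𝓞 K, Ideal.span {x} = (a.1 : Ideal (𝓞 K)) * J := by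
  have h : ClassGroup.mk0 (a.1 * J) = 1 := by rw [map_mul, a.2, inv_mul_cancel]
  obtain ⟨x, hx⟩ := (mk0_eq_one_iff_exists_span _).mp h
  exact ⟨x, hx.symm⟩

/-- A generator of `𝔞 J` for an ideal `𝔞` in the class inverse to that of `J`. -/
def mulGenerator {J : (Ideal (𝓞 K))⁰}
    (a : {a : (Ideal (𝓞 K))⁰ // ClassGroup.mk0 a = (ClassGroup.mk0 J)⁻¹}) : 𝓞 K :=
  (exists_span_eq_mul a).choose

theorem span_mulGenerator {J : (Ideal (𝓞 K))⁰}
    (a : {a : (Ideal (𝓞 K))⁰ // ClassGroup.mk0 a = (ClassGroup.mk0 J)⁻¹}) :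
    Ideal.span {mulGenerator a} = (a.1 : Ideal (𝓞 K)) * J := (exists_span_eq_mul a).choose_spec

theorem mulGenerator_mem {J : (Ideal (𝓞 K))⁰}
    (a : {a : (Ideal (𝓞 K))⁰ // ClassGroup.mk0 a = (ClassGroup.mk0 J)⁻¹}) :
    mulGenerator a ∈ (J : Ideal (𝓞 K)) := by
  rw [← Ideal.span_singleton_le_iff_mem, span_mulGenerator]
  exact Ideal.mul_le_right

theorem mulGenerator_ne_zero {J : (Ideal (𝓞 K))⁰}
    (a : {a : (Ideal (𝓞 K))⁰ // ClassGroup.mk0 a = (ClassGroup.mk0 J)⁻¹}) :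
    mulGenerator a ≠ 0 := by
  intro h
  have h1 := span_mulGenerator a
  rw [h, Ideal.span_singleton_eq_bot.mpr rfl] at h1
  exact nonZeroDivisors.ne_zero (a.1 * J).2 h1.symm

/-- A nonzero `x` in `J` determines `𝔞` by `(x) = 𝔞 J`, and then a unit by comparison with the
chosen generator. -/
theorem bijective_unit_mul_mulGenerator (J : (Ideal (𝓞 K))⁰) : Function.Bijective
    fun p : {a : (Ideal (𝓞 K))⁰ // ClassGroup.mk0 a = (ClassGroup.mk0 J)⁻¹} × (𝓞 K)ˣ =>
      (⟨⟨p.2 * mulGenerator p.1, Ideal.mul_mem_left _ _ (mulGenerator_mem p.1)⟩, by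
        rw [Ne, Submodule.mk_eq_zero]
        exact mul_ne_zero p.2.ne_zero (mulGenerator_ne_zero p.1)⟩ :
          {x : (J : Ideal (𝓞 K)) // x ≠ 0}) := by
  have hspan : ∀ (u : (𝓞 K)ˣ) (x : 𝓞 K), Ideal.span {(u : 𝓞 K) * x} = Ideal.span {x} := fun u x =>
    Ideal.span_singleton_mul_left_unit u.isUnit x
  constructor
  · rintro ⟨a, u⟩ ⟨b, v⟩ h
    have h' : (u : 𝓞 K) * mulGenerator a = v * mulGenerator b :=
      congrArg (fun x => (x.1 : 𝓞 K)) h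
    have h1 : (a.1 : Ideal (𝓞 K)) * J = b.1 * J := by
      rw [← span_mulGenerator, ← span_mulGenerator, ← hspan u, h', hspan]
    have h2 : a = b := Subtype.ext (Subtype.ext
      (mul_right_cancel₀ (nonZeroDivisors.ne_zero J.2) h1))
    subst h2
    exact Prod.ext rfl (Units.ext (mul_right_cancel₀ (mulGenerator_ne_zero a) h'))
  · rintro ⟨⟨x, hx⟩, hx0⟩
    have hx0' : x ≠ 0 := fun h => hx0 ((Submodule.mk_eq_zero _ _).mpr h)
    obtain ⟨b, hb⟩ := Ideal.dvd_iff_le.mpr ((Ideal.span_singleton_le_iff_mem _).mpr hx)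
    have hs0 : Ideal.span {x} ≠ 0 := fun h => hx0' (Ideal.span_singleton_eq_bot.mp h)
    have hb0 : b ≠ 0 := by
      rintro rfl
      exact hs0 (hb.trans (mul_zero _))
    have hcl : ClassGroup.mk0 ⟨b, mem_nonZeroDivisors_of_ne_zero hb0⟩ = (ClassGroup.mk0 J)⁻¹ := by
      rw [eq_inv_iff_mul_eq_one, mul_comm, ← map_mul]
      exact (mk0_eq_one_iff_exists_span _).mpr ⟨x, hb.symm⟩
    have h1 : Ideal.span {mulGenerator ⟨_, hcl⟩} = Ideal.span {x} := by
      rw [span_mulGenerator, hb, mul_comm]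
    obtain ⟨u, hu⟩ := Ideal.span_singleton_eq_span_singleton.mp h1
    exact ⟨(⟨_, hcl⟩, u), Subtype.ext (Subtype.ext ((mul_comm _ _).trans hu))⟩

end IdealsInClass

/-! ### From the lattice sum to the partial zeta function. -/

section Unfolding

variable {D : ℕ} {K : Type*} [Field K] [NumberField K] {δ : K}
  (hδ : δ ^ 2 = (D : K)) {Q : QForm} (hQ : Q.disc = D)
  (hDsq : Squarefree D) (hD4 : D % 4 = 1) (hD : ¬ IsSquare D) (hK : Module.finrank ℚ K = 2)

theorem abs_emb_mul_emb' (x : 𝓞 K) :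
    |emb hD hK hδ (x : K) * emb' hD hK hδ (x : K)| = Ideal.absNorm (Ideal.span {x}) := by
  rw [← norm_eq_emb_mul_emb', Ideal.absNorm_span_singleton, ← Algebra.coe_norm_int]
  push_cast
  rw [Nat.cast_natAbs]
  push_cast
  rfl

/-- The integral of `((a² e^{-t} + b² e^t) / N)^(-s)` over a fundamental interval, where `a`, `b`
are the conjugates of `x`. -/
def unitIntegral (N : ℝ) (s : ℂ) (x : 𝓞 K) : ℂ :=
  ∫ t in (-(2 * Real.log (pellUnit D)))..0,
    (expForm (emb hD hK hδ (x : K)) (emb' hD hK hδ (x : K)) N t : ℂ) ^ (-s)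

/-- The vector `(c, d)` stands for `c θ + d A`, with conjugates `A (c w + d)` and `A (c w' + d)`;
the extra `A²` over the norm `|A|` is the factor `|A|` of the definite form. -/
theorem geodForm_eq_expForm (t : ℝ) (v : Fin 2 → ℤ) :
    geodForm D Q t v = expForm
      (emb hD hK hδ (algebraMap (𝓞 K) K (formIdealEquiv hδ hQ hDsq hD4 hD hK v)))
      (emb' hD hK hδ (algebraMap (𝓞 K) K (formIdealEquiv hδ hQ hDsq hD4 hD hK v)))
      (Ideal.absNorm (formIdeal hδ hQ hDsq hD4 hD hK)) t := by
  have hA : (Q.A : ℝ) ≠ 0 := by exact_mod_cast A_ne_zero hD hQ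
  have hA' : |(Q.A : ℝ)| ≠ 0 := abs_ne_zero.mpr hA
  have h1 : emb hD hK hδ (algebraMap (𝓞 K) K (formIdealEquiv hδ hQ hDsq hD4 hD hK v)) =
      Q.A * (v 0 * root D Q + v 1) := by
    rw [coe_formIdealEquiv]
    simp only [map_add, map_mul, map_div₀, map_neg, map_intCast, map_ofNat, emb_delta, root]
    field_simp
    ring
  have h2 : emb' hD hK hδ (algebraMap (𝓞 K) K (formIdealEquiv hδ hQ hDsq hD4 hD hK v)) =
      Q.A * (v 0 * root' D Q + v 1) := by
    rw [coe_formIdealEquiv]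
    simp only [map_add, map_mul, map_div₀, map_neg, map_intCast, map_ofNat, emb'_delta, root']
    field_simp
    ring
  rw [h1, h2, absNorm_formIdeal, Nat.cast_natAbs, Int.cast_abs, expForm, geodForm, eq_div_iff hA']
  linear_combination ((v 0 * root D Q + v 1) ^ 2 * Real.exp (-t) +
    (v 0 * root' D Q + v 1) ^ 2 * Real.exp t) * abs_mul_abs_self (Q.A : ℝ)

theorem unitIntegral_zero (N : ℝ) {s : ℂ} (hs : s ≠ 0) : unitIntegral hδ hD hK N s 0 = 0 := by
  simp [unitIntegral, expForm, hs]

/-- The conjugates of `η` times the generator have product of modulus `N 𝔞 · N J`, so the value does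
not depend on `η`. -/
theorem hasSum_unitIntegral_unit {J : (Ideal (𝓞 K))⁰} {s : ℂ} (hs : 0 < s.re)
    (a : {a : (Ideal (𝓞 K))⁰ // ClassGroup.mk0 a = (ClassGroup.mk0 J)⁻¹}) (η : (𝓞 K)ˣ) :
    HasSum (fun k : ℤ => unitIntegral hδ hD hK (Ideal.absNorm (J : Ideal (𝓞 K))) s
      ((η * fundUnit hD hδ ^ k : (𝓞 K)ˣ) * mulGenerator a)) (c s * zetaTerm _ s a) := by
  have hx : (η : 𝓞 K) * mulGenerator a ≠ 0 := mul_ne_zero η.ne_zero (mulGenerator_ne_zero a)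
  have hx' : (((η : 𝓞 K) * mulGenerator a : 𝓞 K) : K) ≠ 0 := by
    simpa using hx
  have hJ : 0 < (Ideal.absNorm (J : Ideal (𝓞 K)) : ℝ) := by
    exact_mod_cast Nat.pos_of_ne_zero (Ideal.absNorm_ne_zero_of_nonZeroDivisors J)
  have hnorm : |emb hD hK hδ (((η : 𝓞 K) * mulGenerator a : 𝓞 K) : K) *
      emb' hD hK hδ (((η : 𝓞 K) * mulGenerator a : 𝓞 K) : K)| /
        Ideal.absNorm (J : Ideal (𝓞 K)) = Ideal.absNorm (a.1 : Ideal (𝓞 K)) := by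
    rw [abs_emb_mul_emb', Ideal.span_singleton_mul_left_unit η.isUnit, span_mulGenerator, map_mul,
      Nat.cast_mul, mul_div_cancel_right₀ _ hJ.ne']
  have h := hasSum_integral_expForm ((map_ne_zero (emb hD hK hδ)).mpr hx')
    ((map_ne_zero (emb' hD hK hδ)).mpr hx') hJ hs (one_lt_pellUnit hD)
  rw [hnorm] at h
  have hz : ((Ideal.absNorm (a.1 : Ideal (𝓞 K)) : ℝ) : ℂ) ^ (-s) = zetaTerm _ s a := by
    rw [zetaTerm, Complex.cpow_neg, one_div, Complex.ofReal_natCast]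
  rw [hz] at h
  convert! h using 1
  funext k
  have e : ∀ f : K →+* ℝ,
      f ((((η * fundUnit hD hδ ^ k : (𝓞 K)ˣ) : 𝓞 K) * mulGenerator a : 𝓞 K) : K) =
        f (((η : 𝓞 K) * mulGenerator a : 𝓞 K) : K) *
          f ((fundUnit hD hδ : (𝓞 K)ˣ) : 𝓞 K) ^ k := by
    intro f
    rw [← map_unit_zpow f, ← map_mul, ← map_mul, Units.val_mul]
    congr 2
    ring
  rw [unitIntegral, e, e, emb_fundUnit, emb'_fundUnit]

/-- The nonzero elements of `J` as multiples of generators of the ideals `𝔞 J`. -/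
def idealUnitEquiv (J : (Ideal (𝓞 K))⁰) :
    {a : (Ideal (𝓞 K))⁰ // ClassGroup.mk0 a = (ClassGroup.mk0 J)⁻¹} × (𝓞 K)ˣ ≃
      {x : ↥(J : Ideal (𝓞 K)) // x ≠ 0} :=
  Equiv.ofBijective _ (bijective_unit_mul_mulGenerator J)

theorem coe_idealUnitEquiv (J : (Ideal (𝓞 K))⁰)
    (p : {a : (Ideal (𝓞 K))⁰ // ClassGroup.mk0 a = (ClassGroup.mk0 J)⁻¹} × (𝓞 K)ˣ) :
    (((idealUnitEquiv J p : {x : ↥(J : Ideal (𝓞 K)) // x ≠ 0}) : ↥(J : Ideal (𝓞 K))) : 𝓞 K) =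
      (p.2 : 𝓞 K) * mulGenerator p.1 := rfl

theorem hasSum_nat_mul_of_prod {A U : Type*} {n : ℕ} (e : Fin n × ℤ ≃ U) {f : A × U → ℂ} {S : ℂ}
    (h : HasSum f S) {G : A → ℂ} (hG : ∀ a i, HasSum (fun k => f (a, e (i, k))) (G a)) :
    HasSum (fun a => n * G a) S := by
  have h5 : HasSum (fun p : (A × Fin n) × ℤ => f (p.1.1, e (p.1.2, p.2))) S :=
    ((Equiv.prodAssoc _ _ _).trans ((Equiv.refl _).prodCongr e)).hasSum_iff.mpr h
  have h6 := h5.prod_fiberwise (g := fun p => G p.1) fun p => hG p.1 p.2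
  refine h6.prod_fiberwise fun a => ?_
  convert! hasSum_fintype (fun _ : Fin n => G a) using 1
  simp

theorem hasSum_ideals_of_hasSum {n : ℕ} {rep : Fin n → (𝓞 K)ˣ} {ε : (𝓞 K)ˣ}
    (hrep : Function.Bijective fun p : Fin n × ℤ => rep p.1 * ε ^ p.2) (J : (Ideal (𝓞 K))⁰)
    {F : 𝓞 K → ℂ} (hF : F 0 = 0)
    {G : {a : (Ideal (𝓞 K))⁰ // ClassGroup.mk0 a = (ClassGroup.mk0 J)⁻¹} → ℂ}
    (hG : ∀ a i, HasSum (fun k : ℤ => F (((rep i * ε ^ k : (𝓞 K)ˣ) : 𝓞 K) * mulGenerator a)) (G a))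
    {S : ℂ} (h : HasSum (fun x : ↥(J : Ideal (𝓞 K)) => F x) S) :
    HasSum (fun a => n * G a) S := by
  have h3 : HasSum (fun x : {x : ↥(J : Ideal (𝓞 K)) // x ≠ 0} => F (x : ↥(J : Ideal (𝓞 K)))) S := by
    refine (hasSum_subtype_iff_of_support_subset (s := {x : ↥(J : Ideal (𝓞 K)) | x ≠ 0}) ?_).mpr h
    intro x hx h0
    apply hx
    rw [h0]
    exact hF
  have h4 : HasSum (fun p : {a : (Ideal (𝓞 K))⁰ // ClassGroup.mk0 a = (ClassGroup.mk0 J)⁻¹} ×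
      (𝓞 K)ˣ => F ((p.2 : 𝓞 K) * mulGenerator p.1)) S := by
    rw [← (idealUnitEquiv J).hasSum_iff] at h3
    simpa only [Function.comp_def, coe_idealUnitEquiv] using h3
  exact hasSum_nat_mul_of_prod (Equiv.ofBijective _ hrep) h4 hG

/-- The sum over the ideal is regrouped by `𝔞`, by the `n` cosets of `ε^ℤ`, and by the exponent of
`ε`; each coset contributes the same amount. -/
theorem hasSum_zetaTerm {n : ℕ} {rep : Fin n → (𝓞 K)ˣ}
    (hrep : Function.Bijective fun p : Fin n × ℤ => rep p.1 * fundUnit hD hδ ^ p.2)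
    {s : ℂ} (hs : 1 < s.re) :
    HasSum (fun a => n * (c s * zetaTerm (ClassGroup.mk0 (formIdeal₀ hδ hQ hDsq hD4 hD hK))⁻¹ s a))
      (∑' v : Fin 2 → ℤ, ∫ t in (-(2 * Real.log (pellUnit D)))..0,
        (geodForm D Q t v : ℂ) ^ (-s)) := by
  have hL : 0 < Real.log (pellUnit D) := Real.log_pos (one_lt_pellUnit hD)
  have h1 := (hasSum_integral_geodForm hD hQ hs
    (a := -(2 * Real.log (pellUnit D))) (b := 0) (by linarith)).summable.hasSum
  generalize ∑' v : Fin 2 → ℤ, ∫ t in (-(2 * Real.log (pellUnit D)))..0,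
        (geodForm D Q t v : ℂ) ^ (-s) = S at h1 ⊢
  have hs0 : s ≠ 0 := by rintro rfl; simp at hs; linarith
  refine hasSum_ideals_of_hasSum hrep _ (unitIntegral_zero hδ hD hK _ hs0)
    (fun a i => hasSum_unitIntegral_unit hδ hD hK (zero_lt_one.trans hs) a (rep i)) ?_
  simp only [geodForm_eq_expForm hδ hQ hDsq hD4 hD hK] at h1
  exact (formIdealEquiv hδ hQ hDsq hD4 hD hK).toEquiv.hasSum_iff.mp h1

include hδ hDsq hD4 hD hK in
theorem exists_form_mk0 (α : ClassGroup (𝓞 K)) :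
    ∃ (Q : QForm) (hQ : Q.disc = D), (ClassGroup.mk0 (formIdeal₀ hδ hQ hDsq hD4 hD hK))⁻¹ = α := by
  obtain ⟨β, hβ⟩ := toWide_surjective α⁻¹
  obtain ⟨Q, hQ, h⟩ := exists_form_hasClass hδ hDsq hD4 hD hK β
  exact ⟨Q, hQ, by rw [← toWide_of_hasClass hδ hQ hDsq hD4 hD hK h, hβ, inv_inv]⟩

theorem norm_zetaTerm (α : ClassGroup (𝓞 K)) (s : ℂ)
    (a : {a : (Ideal (𝓞 K))⁰ // ClassGroup.mk0 a = α}) :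
    ‖zetaTerm α s a‖ = ‖zetaTerm α (s.re : ℂ) a‖ := by
  have h : 0 < Ideal.absNorm (a.1 : Ideal (𝓞 K)) :=
    Nat.pos_of_ne_zero (Ideal.absNorm_ne_zero_of_nonZeroDivisors a.1)
  rw [zetaTerm, zetaTerm, norm_div, norm_div, Complex.norm_natCast_cpow_of_pos h,
    Complex.norm_natCast_cpow_of_pos h, Complex.ofReal_re]

include hδ hDsq hD4 hD hK in
theorem exists_unit_reps : ∃ (n : ℕ) (rep : Fin n → (𝓞 K)ˣ),
    (Function.Bijective fun p : Fin n × ℤ => rep p.1 * fundUnit hD hδ ^ p.2) ∧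
    ∀ α : ClassGroup (𝓞 K), {β : NarrowClassGroup K | toWide β = α}.ncard ∈ ({1, 2} : Set ℕ) ∧
      {β : NarrowClassGroup K | toWide β = α}.ncard * n = 4 := by
  by_cases h : ∃ η : (𝓞 K)ˣ, Algebra.norm ℚ ((η : 𝓞 K) : K) < 0
  · obtain ⟨rep, hrep⟩ := exists_unit_reps_of_exists hD hδ hK hDsq hD4 h
    refine ⟨4, rep, hrep, fun α => ?_⟩
    rw [ncard_fiber_of_exists hδ hD hK h]
    simp
  · push Not at h
    obtain ⟨rep, hrep⟩ := exists_unit_reps_of_forall hD hδ hK hDsq hD4 fun η => not_lt.mpr (h η)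
    refine ⟨2, rep, hrep, fun α => ?_⟩
    rw [ncard_fiber_of_forall hδ hD hK fun η => not_lt.mpr (h η)]
    simp

include hδ hDsq hD4 hD hK in
-- The absolute values of the terms depend only on `Re s`, and at that real exponent the unfolded
-- sum converges with a nonzero factor `n c(Re s)`.
theorem summable_zetaTerm {s : ℂ} (hs : 1 < s.re) (α : ClassGroup (𝓞 K)) :
    Summable (zetaTerm α s) := by
  obtain ⟨Q, hQ, rfl⟩ := exists_form_mk0 hδ hDsq hD4 hD hK α
  obtain ⟨n, rep, hrep, hn⟩ := exists_unit_reps hδ hDsq hD4 hD hK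
  have hn0 : (n : ℂ) ≠ 0 := by
    rintro h
    have := (hn 1).2
    rw [Nat.cast_eq_zero.mp h] at this
    simp at this
  have h := (hasSum_zetaTerm hδ hQ hDsq hD4 hD hK hrep (s := (s.re : ℂ)) (by simpa)).summable
  rw [summable_mul_left_iff hn0, summable_mul_left_iff (c_ofReal_ne_zero (by linarith))] at h
  refine Summable.of_norm ?_
  simp only [norm_zetaTerm _ s]
  exact h.norm

include hQ hDsq hD4 hK in
-- The right side involves neither `z₀` nor `Q`, and `β` only through its wide class; this is the
-- independence asserted for `Φ_β`.
theorem period_eq_partialZeta {n : ℕ} {rep : Fin n → (𝓞 K)ˣ}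
    (hrep : Function.Bijective fun p : Fin n × ℤ => rep p.1 * fundUnit hD hδ ^ p.2)
    {s : ℂ} (hs : 1 < s.re) {β : NarrowClassGroup K} (hβ : Q.HasClass δ β) (z₀ : ℍ) :
    period _ zpowers_T_le_cuspGroup s D Q z₀ =
      n * c s * (Complex.I * (√D : ℝ)) ^ s * partialZeta (toWide β)⁻¹ s / riemannZeta (2 * s) := by
  have hz : riemannZeta (2 * s) ≠ 0 := riemannZeta_ne_zero_of_one_lt_re (by simp; linarith)
  rw [eq_div_iff hz, mul_comm _ (riemannZeta _), zeta_mul_period hD hQ hs,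
    ← (hasSum_zetaTerm hδ hQ hDsq hD4 hD hK hrep hs).tsum_eq, tsum_mul_left, tsum_mul_left,
    toWide_of_hasClass hδ hQ hDsq hD4 hD hK hβ, partialZeta]
  ring

end Unfolding

/-! ### Both normalizations at once: `κ / 4` is 1 or 1/2. -/

section Normalizations

theorem lift_eq_mul_lift_zpowers {H : Subgroup SL(2, ℤ)} (hH : H ≤ cuspGroup) {κ : ℂ}
    (hκ : (H = Subgroup.zpowers ModularGroup.T ∧ κ = 4) ∨ (H = cuspGroup ∧ κ = 2)) {s : ℂ}
    (hs : 1 < s.re) {Q : QForm} (hQ : Q.disc ≠ 0) (z : ℍ) :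
    lift H hH s Q z = κ / 4 * lift _ zpowers_T_le_cuspGroup s Q z := by
  rcases hκ with ⟨rfl, rfl⟩ | ⟨rfl, rfl⟩
  · norm_num
  · rw [lift_cuspGroup hs hQ]; ring

theorem summable_cosetSummand {H : Subgroup SL(2, ℤ)} (hH : H ≤ cuspGroup) {κ : ℂ}
    (hκ : (H = Subgroup.zpowers ModularGroup.T ∧ κ = 4) ∨ (H = cuspGroup ∧ κ = 2)) {s : ℂ}
    (hs : 1 < s.re) {Q : QForm} (hQ : Q.disc ≠ 0) (z : ℍ) : Summable (cosetSummand H hH s Q z) := by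
  rcases hκ with ⟨rfl, rfl⟩ | ⟨rfl, rfl⟩
  · exact summable_cosetSummand_zpowers hH hs hQ z
  · exact summable_cosetSummand_cuspGroup hs hQ z

theorem period_eq_mul_period_zpowers {H : Subgroup SL(2, ℤ)} (hH : H ≤ cuspGroup) {κ : ℂ}
    (hκ : (H = Subgroup.zpowers ModularGroup.T ∧ κ = 4) ∨ (H = cuspGroup ∧ κ = 2)) {s : ℂ}
    (hs : 1 < s.re) {D : ℕ} {Q : QForm} (hQ : Q.disc ≠ 0) (z₀ : ℍ) :
    period H hH s D Q z₀ = κ / 4 * period _ zpowers_T_le_cuspGroup s D Q z₀ := by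
  simp only [period, segIntegral, lift_eq_mul_lift_zpowers hH hκ hs hQ]
  rw [mul_left_comm (κ / 4), ← intervalIntegral.integral_const_mul (κ / 4)]
  congr 2
  funext t
  ring

end Normalizations

end HeckePeriod

end

open HeckePeriod in
/-- The pair `(H, κ)` fixes the normalization of `F_Q`: `κ = 4` if the sum runs over
`⟨T⟩ \ SL(2, ℤ)` and `κ = 2` if it runs over `⟨T⟩ \ PSL(2, ℤ)`. -/
theorem mainTheorem1 (D : ℕ) (hD1 : 1 < D) (hDsq : Squarefree D) (hD4 : D % 4 = 1)
    {K : Type*} [Field K] [NumberField K] (hK : Module.finrank ℚ K = 2)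
    (δ : K) (hδ : δ ^ 2 = (D : K)) (s : ℂ) (hs : 1 < s.re) :
    -- forms of discriminant `D` correspond to narrow ideal classes
    (∀ Q : QForm, Q.disc = D → ∃! β : NarrowClassGroup K, Q.HasClass δ β) ∧
    (∀ β : NarrowClassGroup K, ∃ Q : QForm, Q.disc = D ∧ Q.HasClass δ β) ∧
    -- every wide class contains one or two narrow classes
    (∀ α : ClassGroup (𝓞 K),
      {β : NarrowClassGroup K | toWide β = α}.ncard = 1 ∨
      {β : NarrowClassGroup K | toWide β = α}.ncard = 2) ∧
    -- `ζ(α, s)` and `c(s)` converge absolutely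
    (∀ α : ClassGroup (𝓞 K), Summable (zetaTerm α s)) ∧
    MeasureTheory.Integrable (cIntegrand s) ∧
    ∀ (H : Subgroup SL(2, ℤ)) (hH : H ≤ cuspGroup) (κ : ℂ),
      ((H = Subgroup.zpowers ModularGroup.T ∧ κ = 4) ∨ (H = cuspGroup ∧ κ = 2)) →
      -- `F_Q(s, z)` converges absolutely and is holomorphic in the upper half-plane
      (∀ Q : QForm, Q.disc = D →
        (∀ z : ℍ, Summable (cosetSummand H hH s Q z)) ∧
        DifferentiableOn ℂ (fun z : ℂ => lift H hH s Q (UpperHalfPlane.ofComplex z))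
          {z : ℂ | 0 < z.im}) ∧
      -- `Φ_β(s)` is given by every form `Q` in the class `β` and every base point
      (∀ (Q : QForm) (β : NarrowClassGroup K), Q.disc = D → Q.HasClass δ β →
        ∀ z₀ : ℍ, period H hH s D Q z₀ = Phi H hH s D δ β) ∧
      -- the sum formula
      ∀ α : ClassGroup (𝓞 K),
        ∑ᶠ β ∈ {β : NarrowClassGroup K | toWide β = α⁻¹}, Phi H hH s D δ β =
          κ * c s * (Complex.I * (Real.sqrt D : ℂ)) ^ s * partialZeta α s /
            riemannZeta (2 * s) := by

  have hD : ¬ IsSquare D := by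
    rintro ⟨r, rfl⟩
    have := hDsq r dvd_rfl
    rw [Nat.isUnit_iff] at this
    simp [this] at hD1
  have hs0 : 0 < s.re := zero_lt_one.trans hs
  obtain ⟨n, rep, hrep, hn⟩ := exists_unit_reps hδ hDsq hD4 hD hK
  refine ⟨fun Q hQ => existsUnique_hasClass hδ hQ hDsq hD4 hD hK,
    exists_form_hasClass hδ hDsq hD4 hD hK, fun α => (hn α).1,
    summable_zetaTerm hδ hDsq hD4 hD hK hs, integrable_cIntegrand hs0, ?_⟩
  intro H hH κ hκ
  have hdisc : ∀ {Q : QForm}, Q.disc = D → 0 < Q.disc := by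
    intro Q hQ
    rw [hQ]
    exact_mod_cast zero_lt_one.trans hD1
  have hperiod : ∀ (Q : QForm) (β : NarrowClassGroup K), Q.disc = D → Q.HasClass δ β →
      ∀ z₀ : ℍ, period H hH s D Q z₀ = κ / 4 * (n * c s * (Complex.I * (Real.sqrt D : ℂ)) ^ s *
        partialZeta (toWide β)⁻¹ s / riemannZeta (2 * s)) := by
    intro Q β hQ hβ z₀
    rw [period_eq_mul_period_zpowers hH hκ hs (hdisc hQ).ne',
      period_eq_partialZeta hδ hQ hDsq hD4 hD hK hrep hs hβ]
  have hPhi : ∀ β : NarrowClassGroup K, Phi H hH s D δ β =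
      κ / 4 * (n * c s * (Complex.I * (Real.sqrt D : ℂ)) ^ s *
        partialZeta (toWide β)⁻¹ s / riemannZeta (2 * s)) := by
    intro β
    have h := exists_form_hasClass hδ hDsq hD4 hD hK β
    rw [Phi, dif_pos h]
    exact hperiod _ β h.choose_spec.1 h.choose_spec.2 _
  refine ⟨fun Q hQ => ⟨summable_cosetSummand hH hκ hs (hdisc hQ).ne', ?_⟩, ?_, ?_⟩
  · simp only [lift_eq_mul_lift_zpowers hH hκ hs (hdisc hQ).ne']
    exact (differentiableOn_lift_zpowers zpowers_T_le_cuspGroup hs (hdisc hQ)).const_mul _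
  · intro Q β hQ hβ z₀
    rw [hperiod Q β hQ hβ, hPhi]
  · intro α
    have hcard : (({β : NarrowClassGroup K | toWide β = α⁻¹}.ncard : ℕ) : ℂ) * n = 4 := by
      exact_mod_cast (hn α⁻¹).2
    -- All `Φ_β` in the fibre are equal, so the sum is the size of the fibre times a common value
    -- with factor `n`, and `hcard` turns the product into 4.
    rw [finsum_mem_congr rfl (g := fun _ => κ / 4 * (n * c s *
      (Complex.I * (Real.sqrt D : ℂ)) ^ s * partialZeta α s / riemannZeta (2 * s)))]
    -- `Set.ncard` is 0 on infinite sets, so a nonzero value gives finiteness.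
    · have hfin : {β : NarrowClassGroup K | toWide β = α⁻¹}.Finite := by
        apply Set.finite_of_ncard_ne_zero
        intro h0
        rw [h0] at hcard
        simp at hcard
      rw [finsum_mem_eq_finite_toFinset_sum _ hfin, Finset.sum_const, ← Set.ncard_eq_toFinset_card _ hfin,
        nsmul_eq_mul]
      linear_combination (κ / 4 * (c s * (Complex.I * (Real.sqrt D : ℂ)) ^ s * partialZeta α s /
        riemannZeta (2 * s))) * hcard
    · intro β hβ
      have hβ' : toWide β = α⁻¹ := hβ
      rw [hPhi, hβ', inv_inv]
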